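/- **Type-and-term structures.** Let $\mathbb H$ be the category generated by the graph with vertices $n$ and $n_t$ ($n\ge 1$) and edges $n\to n+1$, $n\to n_t$. A type-and-term structure is a presheaf $X\in[\mathbb H^{\mathrm{op}},\mathbf{Set}]$; elements of $X(n)$ (of $X(n_t)$) are its type-elements (term-elements) of degree $n$, the actions of the edges are the boundary maps $\partial:X(n+1)\to X(n)$ and $\partial:X(n_t)\to X(n)$, and $\mathrm{Tm}_X(A)=\{a\in X(n_t):\partial a=A\}$ for $A\in X(n)$. **The weakening monad.** A $\{w\}$-GAT is a generalised algebraic theory in Cartmell's sense whose deduction rules are only the equality rules (reflexivity, symmetry and transitivity for types and for terms, conversion of a term or term equality along an equality of types, and conversion of a context along an equality of types: from $\Gamma\vdash T_1=T_2\ \mathsf{type}$ and $\Gamma,x:T_1,\Delta\vdash\mathcal J$ infer $\Gamma,x:T_2,\Delta\vdash\mathcal J$), renaming of variables along permutations, and weakening (from $\Gamma\vdash T\ \mathsf{type}$ and $\Gamma,\Delta\vdash\mathcal J$ infer $\Gamma,y:T,\Delta\vdash\mathcal J$ for $y$ not occurring in $\Gamma,\Delta$). Interpretations are maps on derived judgements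 preserving boundaries and deductions; $\{w\}\text{-}\mathbf{GAT}$ has as morphisms interpretations modulo $\equiv$ (derivable equality, up to renaming of the context variables) of the images of all derived type and term judgements. The forgetful functor $V:\{w\}\text{-}\mathbf{GAT}\to[\mathbb H^{\mathrm{op}},\mathbf{Set}]$ sends a theory to its derived type and term judgements modulo $\equiv$, graded by degree (length of the context plus one). It has a left adjoint $G$, where $GX$ has the elements of $X$ as its constants, with basic judgements $x_1:A_1,\dots,x_{n-1}:A_{n-1}(x_1,\dots,x_{n-2})\vdash A(x_1,\dots,x_{n-1})\ \mathsf{type}$ for $A\in X(n)$ with successive boundaries $A_{n-1},\dots,A_1$, and likewise $\dots\vdash a(x_1,\dots,x_{n-1}):A(x_1,\dots,x_{n-1})$ for $a\in\mathrm{Tm}_X(A)$; the unit sends each element to the class of its basic judgement. The weakening monad $W$, with multiplication $\mu^W$, is the monad induced by $G\dashv V$. **Heaps.** A min-heap of size $n$ is a map $\phi:\{0,\dots,n\}\to\{0,\dots,n\}$ with $\phi(0)=0$ and $\phi(i)<i$ for $i\ge1$. For $i,j\in\{1,\dots,n\}$ write $i\preccurlyeq_\phi j$ iff $i=\phi^k(j)$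 for some $k\ge0$; a min-heap is determined by this partial order. The depth $\mathrm{dp}_\phi(i)$ is $|\{\phi(i),\phi^2(i),\dots\}|$. Let $[\phi]$ be the type-and-term structure with no term-elements, with $[\phi](m)=\{i\in\{1,\dots,n\}:\mathrm{dp}_\phi(i)=m\}$, and with boundary $i\mapsto\phi(i)$. For $n\geq 2$, let $\partial\phi$ be the restriction of $\phi$ to $\{0,\dots,n-1\}$, and for $h:[\phi]\to X$ let $\partial h$ be the restriction of $h$ to $[\partial\phi]$. **Description of $W$.** Naturally in $X$, $WX(n)$ is identified with the set of pairs $(\phi,h)$, with $\phi$ a min-heap of size $n$ and $h:[\phi]\to X$, with boundary $(\phi,h)\mapsto(\partial\phi,\partial h)$, and $\mathrm{Tm}_{WX}(\phi,h)=\mathrm{Tm}_X(h(n))$. The pair $(\phi,h)$ stands for the class of the judgement $x_1:T_1,\dots,x_{n-1}:T_{n-1}\vdash T_n\ \mathsf{type}$ of $GX$, where $T_i=h(i)(x_{j_1},\dots,x_{j_{k-1}})$ with $k=\mathrm{dp}_\phi(i)$ and $j_\ell=\phi^{k-\ell}(i)$; a term-element $a\in \mathrm{Tm}_X(h(n))$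 stands for the class of $x_1:T_1,\dots,x_{n-1}:T_{n-1}\vdash a(x_{j_1},\dots,x_{j_{k-1}}):T_n$, with the arguments of $T_n$. Hence an element of $W^2X(n)$ is a pair $(\psi,(\phi,h))$ with $\psi$ a min-heap of size $n$ and $(\phi,h):[\psi]\to WX$, that is, a compatible family of pairs $(\phi_i,h_i)\in WX(\#i)$, $1\le i\le n$, where $\#i=\mathrm{dp}_\psi(i)$; and $\mathrm{Tm}_{W^2X}(\psi,(\phi,h))=\mathrm{Tm}_{WX}(\phi_n,h_n)=\mathrm{Tm}_X(h_n(\#n))$. **Proposition.** Under these identifications, for each $X$ and $n\ge1$, the multiplication $\mu^W_X:W^2X\to WX$ of the weakening monad sends $(\psi,(\phi,h))\in W^2X(n)$ to $(\psi\star\phi,\psi\star h)\in WX(n)$, where $\psi\star\phi$ is the min-heap with $$i\preccurlyeq_{\psi\star\phi}j\iff i\preccurlyeq_\psi j\ \text{ and }\ \#i\preccurlyeq_{\phi_j}\#j ,$$ and $(\psi\star h)(i)=h_i(\#i)$ for $1\le i\le n$. On term-elements, $\mu^W_X:\mathrm{Tm}_{W^2X}(\psi,(\phi,h))\to\mathrm{Tm}_{WX}(\psi\star\phi,\psi\star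 h)$ is the identity $a\mapsto a$ of $\mathrm{Tm}_X(h_n(\#n))$. -/

import Mathlib

open CategoryTheory Opposite

universe u

namespace TypeDep

/-! ## Type-and-term structures -/

/-- Vertices of the graph generating `H`. Degrees are shifted by one: `ty n` and `tm n` are the
vertices written `n + 1` and `(n + 1)_t`, so that `n` is the length of the context. -/
inductive HVertex : Type
  | ty (n : ℕ) : HVertex
  | tm (n : ℕ) : HVertex

/-- Edges of the graph generating `H`. -/
inductive HEdge : HVertex → HVertex → Type
  | succ (n : ℕ) : HEdge (HVertex.ty n) (HVertex.ty (n + 1))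
  | term (n : ℕ) : HEdge (HVertex.ty n) (HVertex.tm n)

instance : Quiver HVertex := ⟨HEdge⟩

/-- The category generated by the graph. -/
abbrev H : Type := Paths HVertex

/-- The object `n + 1` of `H`. -/
def H.ty (n : ℕ) : H := HVertex.ty n

/-- The object `(n + 1)_t` of `H`. -/
def H.tm (n : ℕ) : H := HVertex.tm n

/-- The generating arrow `n + 1 ⟶ n + 2`. -/
def H.succ (n : ℕ) : H.ty n ⟶ H.ty (n + 1) := (Paths.of HVertex).map (HEdge.succ n)

/-- The generating arrow `n + 1 ⟶ (n + 1)_t`. -/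
def H.term (n : ℕ) : H.ty n ⟶ H.tm n := (Paths.of HVertex).map (HEdge.term n)

/-- Type-and-term structures: presheaves on `H`. -/
abbrev TTStr : Type (u + 1) := Hᵒᵖ ⥤ Type u

namespace TTStr

/-- Type-elements of degree `n + 1`. -/
def Ty (X : TTStr.{u}) (n : ℕ) : Type u := X.obj (op (H.ty n))

/-- Term-elements of degree `n + 1`. -/
def Tm (X : TTStr.{u}) (n : ℕ) : Type u := X.obj (op (H.tm n))

/-- The boundary of a type-element. -/
def bd (X : TTStr.{u}) {n : ℕ} (A : X.Ty (n + 1)) : X.Ty n := X.map (H.succ n).op A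

/-- The boundary of a term-element. -/
def bdTm (X : TTStr.{u}) {n : ℕ} (a : X.Tm n) : X.Ty n := X.map (H.term n).op a

/-- The action of a map of type-and-term structures on type-elements. -/
def mapTy {X Y : TTStr.{u}} (f : X ⟶ Y) {n : ℕ} (A : X.Ty n) : Y.Ty n := f.app (op (H.ty n)) A

/-- The action of a map of type-and-term structures on term-elements. -/
def mapTm {X Y : TTStr.{u}} (f : X ⟶ Y) {n : ℕ} (a : X.Tm n) : Y.Tm n := f.app (op (H.tm n)) a

theorem mapTy_bd {X Y : TTStr.{u}} (f : X ⟶ Y) {n : ℕ} (A : X.Ty (n + 1)) :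
    mapTy f (X.bd A) = Y.bd (mapTy f A) :=
  NatTrans.naturality_apply f (H.succ n).op A

theorem mapTy_bdTm {X Y : TTStr.{u}} (f : X ⟶ Y) {n : ℕ} (a : X.Tm n) :
    mapTy f (X.bdTm a) = Y.bdTm (mapTm f a) :=
  NatTrans.naturality_apply f (H.term n).op a

theorem mapTy_id (X : TTStr.{u}) {n : ℕ} (A : X.Ty n) : mapTy (𝟙 X) A = A := rfl

theorem mapTm_id (X : TTStr.{u}) {n : ℕ} (a : X.Tm n) : mapTm (𝟙 X) a = a := rfl

theorem mapTy_comp {X Y Z : TTStr.{u}} (f : X ⟶ Y) (g : Y ⟶ Z) {n : ℕ} (A : X.Ty n) :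
    mapTy (f ≫ g) A = mapTy g (mapTy f A) := rfl

theorem mapTm_comp {X Y Z : TTStr.{u}} (f : X ⟶ Y) (g : Y ⟶ Z) {n : ℕ} (a : X.Tm n) :
    mapTm (f ≫ g) a = mapTm g (mapTm f a) := rfl

theorem hom_ext {X Y : TTStr.{u}} {f g : X ⟶ Y}
    (hty : ∀ (n : ℕ) (A : X.Ty n), mapTy f A = mapTy g A)
    (htm : ∀ (n : ℕ) (a : X.Tm n), mapTm f a = mapTm g a) : f = g := by
  apply NatTrans.ext
  funext v
  apply ConcreteCategory.hom_ext
  intro x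
  match v, x with
  | ⟨HVertex.ty n⟩, x => exact hty n x
  | ⟨HVertex.tm n⟩, x => exact htm n x

section OfData

variable (ty tm : ℕ → Type u) (bd : ∀ n, ty (n + 1) → ty n) (bdTm : ∀ n, tm n → ty n)

/-- Auxiliary prefunctor for `ofData`. -/
def ofDataPre : HVertex ⥤q (Type u)ᵒᵖ where
  obj v := match v with
    | HVertex.ty n => op (ty n)
    | HVertex.tm n => op (tm n)
  map {v w} e := match v, w, e with
    | _, _, HEdge.succ n => Quiver.Hom.op (TypeCat.ofHom (bd n))
    | _, _, HEdge.term n => Quiver.Hom.op (TypeCat.ofHom (bdTm n))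

/-- The type-and-term structure with given elements and boundary maps. -/
def ofData : TTStr.{u} := (Paths.lift (ofDataPre ty tm bd bdTm)).leftOp

theorem ofData_bd {n : ℕ} (A : ty (n + 1)) :
    TTStr.bd (ofData ty tm bd bdTm) (n := n) A = bd n A := rfl

theorem ofData_bdTm {n : ℕ} (a : tm n) :
    TTStr.bdTm (ofData ty tm bd bdTm) (n := n) a = bdTm n a := rfl

end OfData

/-- Auxiliary: the components of `homMk`. -/
def homMkApp {X Y : TTStr.{u}} (fty : ∀ n, X.Ty n → Y.Ty n) (ftm : ∀ n, X.Tm n → Y.Tm n) :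
    ∀ v : H, X.obj (op v) → Y.obj (op v)
  | HVertex.ty n => fty n
  | HVertex.tm n => ftm n

/-- The map of type-and-term structures with given components. -/
def homMk {X Y : TTStr.{u}} (fty : ∀ n, X.Ty n → Y.Ty n) (ftm : ∀ n, X.Tm n → Y.Tm n)
    (hty : ∀ n (A : X.Ty (n + 1)), fty n (X.bd A) = Y.bd (fty (n + 1) A))
    (htm : ∀ n (a : X.Tm n), fty n (X.bdTm a) = Y.bdTm (ftm n a)) : X ⟶ Y where
  app v := TypeCat.ofHom (homMkApp fty ftm v.unop)
  naturality := by
    have key : ∀ {a b : H} (p : a ⟶ b) (x : X.obj (op b)),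
        homMkApp fty ftm a (X.map p.op x) = Y.map p.op (homMkApp fty ftm b x) := by
      intro a b p
      refine Paths.induction (V := HVertex) (P := fun {a b} p => ∀ x : X.obj (op b),
        homMkApp fty ftm a (X.map p.op x) = Y.map p.op (homMkApp fty ftm b x)) ?_ ?_ p
      · intro v x
        rw [op_id, X.map_id, Y.map_id]
        rfl
      · intro a b c p q ih x
        rw [op_comp, X.map_comp, Y.map_comp]
        refine (ih _).trans ?_
        change _ = Y.map p.op (Y.map _ _)
        congr 1
        match b, c, q, x with
        | _, _, HEdge.succ n, x => exact hty n x
        | _, _, HEdge.term n, x => exact htm n x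
    intro v w f
    apply ConcreteCategory.hom_ext
    intro x
    exact key f.unop x

theorem mapTy_homMk {X Y : TTStr.{u}} (fty : ∀ n, X.Ty n → Y.Ty n) (ftm : ∀ n, X.Tm n → Y.Tm n)
    (hty) (htm) {n : ℕ} (A : X.Ty n) : mapTy (homMk fty ftm hty htm) A = fty n A := rfl

theorem mapTm_homMk {X Y : TTStr.{u}} (fty : ∀ n, X.Ty n → Y.Ty n) (ftm : ∀ n, X.Tm n → Y.Tm n)
    (hty) (htm) {n : ℕ} (a : X.Tm n) : mapTm (homMk fty ftm hty htm) a = ftm n a := rfl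

end TTStr

/-! ## Syntax -/

/-- Expressions over an alphabet `W`; the variables are the natural numbers. -/
inductive Exp (W : Type u) : Type u
  | var (x : ℕ) : Exp W
  | app (w : W) (n : ℕ) (args : Fin n → Exp W) : Exp W

namespace Exp

variable {W : Type u}

/-- Free variables. -/
def fv : Exp W → Set ℕ
  | var x => {x}
  | app _ _ args => ⋃ i, (args i).fv

/-- Simultaneous replacement of each variable `x` by the variable `f x`. -/
def rename (f : ℕ → ℕ) : Exp W → Exp W
  | var x => var (f x)
  | app w n args => app w n fun i => (args i).rename f

/-- The expression `w(x_1, …, x_k)`, for a list of variables `x_1, …, x_k`. -/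
def appVars (w : W) (xs : List ℕ) : Exp W := app w xs.length fun i => var (xs.get i)

theorem rename_congr {f g : ℕ → ℕ} (e : Exp W) (h : ∀ v ∈ e.fv, f v = g v) :
    e.rename f = e.rename g := by
  induction e with
  | var x => simp [rename, h x (by simp [fv])]
  | app w n args ih =>
    simp only [rename]
    congr 1
    funext i
    exact ih i fun v hv => h v (by simp only [fv, Set.mem_iUnion]; exact ⟨i, hv⟩)

theorem rename_id (e : Exp W) : e.rename (fun v => v) = e := by
  induction e with
  | var x => rfl
  | app w n args ih => simp only [rename, ih]

theorem rename_rename (f g : ℕ → ℕ) (e : Exp W) :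
    (e.rename f).rename g = e.rename (fun v => g (f v)) := by
  induction e with
  | var x => rfl
  | app w n args ih => simp only [rename, ih]

theorem fv_rename (f : ℕ → ℕ) (e : Exp W) : (e.rename f).fv = f '' e.fv := by
  induction e with
  | var x => simp [rename, fv]
  | app w n args ih => simp only [rename, fv, ih, Set.image_iUnion]

theorem fv_appVars (w : W) (xs : List ℕ) : (appVars w xs).fv = {x | x ∈ xs} := by
  ext x
  simp only [appVars, fv, Set.mem_iUnion, Set.mem_singleton_iff, Set.mem_ofPred_eq]
  constructor
  · rintro ⟨i, rfl⟩
    exact List.get_mem _ _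
  · intro h
    obtain ⟨i, hi⟩ := List.get_of_mem h
    exact ⟨i, hi.symm⟩

end Exp

/-- Contexts `x_1 : T_1, …, x_n : T_n`, stored with the last declaration at the head of the list,
so that `Δ ++ Γ` is the context written `Γ, Δ`. The declared variables are required to be distinct
in `Judg.IsJudgement` below. -/
abbrev Ctx (W : Type u) : Type u := List (ℕ × Exp W)

/-- What stands to the right of the turnstile in a judgement. -/
inductive Body (W : Type u) : Type u
  | ty (T : Exp W) : Body W
  | tm (t T : Exp W) : Body W
  | tyEq (T T' : Exp W) : Body W
  | tmEq (t t' T : Exp W) : Body W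

/-- Judgements `ctx ⊢ body`. -/
structure Judg (W : Type u) : Type u where
  ctx : Ctx W
  body : Body W

namespace Ctx

variable {W : Type u}

/-- The declared variables of a context, the last one first. -/
def vars (Γ : Ctx W) : List ℕ := Γ.map Prod.fst

/-- The variables that occur in a context, in a declaration or in a type. -/
def fv (Γ : Ctx W) : Set ℕ := {v | ∃ p ∈ Γ, v = p.1 ∨ v ∈ p.2.fv}

/-- Replacement of variables in a context. -/
def rename (f : ℕ → ℕ) (Γ : Ctx W) : Ctx W := Γ.map fun p => (f p.1, p.2.rename f)

end Ctx

/-- Replacement of variables in a body. -/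
def Body.rename {W : Type u} (f : ℕ → ℕ) : Body W → Body W
  | ty T => ty (T.rename f)
  | tm t T => tm (t.rename f) (T.rename f)
  | tyEq T T' => tyEq (T.rename f) (T'.rename f)
  | tmEq t t' T => tmEq (t.rename f) (t'.rename f) (T.rename f)

namespace Judg

variable {W : Type u}

/-- Replacement of variables in a judgement. -/
def rename (f : ℕ → ℕ) (J : Judg W) : Judg W := ⟨Ctx.rename f J.ctx, J.body.rename f⟩

/-- The variables declared in the context of a judgement are distinct. -/
def IsJudgement (J : Judg W) : Prop := J.ctx.vars.Nodup

/-- The boundary of a judgement. -/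
def boundary (J : Judg W) : List (Judg W) :=
  match J.body with
  | Body.ty _ =>
    match J.ctx with
    | [] => []
    | (_, T) :: Γ => [⟨Γ, Body.ty T⟩]
  | Body.tm _ T => [⟨J.ctx, Body.ty T⟩]
  | Body.tyEq T T' => [⟨J.ctx, Body.ty T⟩, ⟨J.ctx, Body.ty T'⟩]
  | Body.tmEq t t' T => [⟨J.ctx, Body.tm t T⟩, ⟨J.ctx, Body.tm t' T⟩]

end Judg

/-- Names of the deduction rules: the equality rules, the action of a permutation `σ` of the
variables, and weakening by a variable `y`. -/
inductive RuleName : Type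
  | tmRefl | tmSymm | tmTrans | tyRefl | tySymm | tyTrans | tmConv | tmEqConv | ctxConv
  | alpha (σ : Equiv.Perm ℕ)
  | weaken (y : ℕ)

/-- `Rule r Js J`: the deduction rule `r` derives `J` from the premisses `Js`. For each `r` this is
a partial function of `Js`. The rule `ctxConv` replaces a type in a context by an equal one; it is
derivable from the other rules whenever weakening, projection and substitution are all present. -/
inductive Rule {W : Type u} : RuleName → List (Judg W) → Judg W → Prop
  | tmRefl (Γ : Ctx W) (t T : Exp W) :
      Rule .tmRefl [⟨Γ, .tm t T⟩] ⟨Γ, .tmEq t t T⟩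
  | tmSymm (Γ : Ctx W) (t₁ t₂ T : Exp W) :
      Rule .tmSymm [⟨Γ, .tmEq t₁ t₂ T⟩] ⟨Γ, .tmEq t₂ t₁ T⟩
  | tmTrans (Γ : Ctx W) (t₁ t₂ t₃ T : Exp W) :
      Rule .tmTrans [⟨Γ, .tmEq t₁ t₂ T⟩, ⟨Γ, .tmEq t₂ t₃ T⟩] ⟨Γ, .tmEq t₁ t₃ T⟩
  | tyRefl (Γ : Ctx W) (T : Exp W) :
      Rule .tyRefl [⟨Γ, .ty T⟩] ⟨Γ, .tyEq T T⟩
  | tySymm (Γ : Ctx W) (T₁ T₂ : Exp W) :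
      Rule .tySymm [⟨Γ, .tyEq T₁ T₂⟩] ⟨Γ, .tyEq T₂ T₁⟩
  | tyTrans (Γ : Ctx W) (T₁ T₂ T₃ : Exp W) :
      Rule .tyTrans [⟨Γ, .tyEq T₁ T₂⟩, ⟨Γ, .tyEq T₂ T₃⟩] ⟨Γ, .tyEq T₁ T₃⟩
  | tmConv (Γ : Ctx W) (t T₁ T₂ : Exp W) :
      Rule .tmConv [⟨Γ, .tyEq T₁ T₂⟩, ⟨Γ, .tm t T₁⟩] ⟨Γ, .tm t T₂⟩
  | tmEqConv (Γ : Ctx W) (t₁ t₂ T₁ T₂ : Exp W) :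
      Rule .tmEqConv [⟨Γ, .tyEq T₁ T₂⟩, ⟨Γ, .tmEq t₁ t₂ T₁⟩] ⟨Γ, .tmEq t₁ t₂ T₂⟩
  | ctxConv (Γ Δ : Ctx W) (x : ℕ) (T₁ T₂ : Exp W) (B : Body W) :
      Rule .ctxConv [⟨Γ, .tyEq T₁ T₂⟩, ⟨Δ ++ (x, T₁) :: Γ, B⟩] ⟨Δ ++ (x, T₂) :: Γ, B⟩
  | alpha (σ : Equiv.Perm ℕ) (J : Judg W) :
      Rule (.alpha σ) [J] (J.rename σ)
  | weaken (y : ℕ) (Γ Δ : Ctx W) (T : Exp W) (B : Body W) (hΓ : y ∉ Γ.fv) (hΔ : y ∉ Δ.fv) :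
      Rule (.weaken y) [⟨Γ, .ty T⟩, ⟨Δ ++ Γ, B⟩] ⟨Δ ++ (y, T) :: Γ, B⟩

/-- The derived judgements of a collection `Λ` of basic judgements: the smallest collection that is
closed under the deduction rules and contains a basic judgement whenever it contains all the
judgements in its boundary. -/
inductive Derivable {W : Type u} (Λ : Set (Judg W)) : Judg W → Prop
  | basic (J : Judg W) (hJ : J ∈ Λ) (h : ∀ K ∈ J.boundary, Derivable Λ K) : Derivable Λ J
  | rule (r : RuleName) (Js : List (Judg W)) (J : Judg W) (hr : Rule r Js J)
      (h : ∀ K ∈ Js, Derivable Λ K) : Derivable Λ J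

/-- `x_1 : T_1, …, x_k : T_k ⊢ A(x_1, …, x_k) type`. -/
def IsTyIntro {W : Type u} (A : W) (J : Judg W) : Prop :=
  ∃ Γ : Ctx W, J = ⟨Γ, .ty (.appVars A Γ.vars.reverse)⟩

/-- `x_1 : T_1, …, x_k : T_k ⊢ f(x_1, …, x_k) : T`. -/
def IsTmIntro {W : Type u} (f : W) (J : Judg W) : Prop :=
  ∃ (Γ : Ctx W) (T : Exp W), J = ⟨Γ, .tm (.appVars f Γ.vars.reverse) T⟩

/-- A type equality or term equality judgement. -/
def Judg.IsEquality {W : Type u} (J : Judg W) : Prop :=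
  (∃ T T', J.body = .tyEq T T') ∨ ∃ t t' T, J.body = .tmEq t t' T

/-- Generalised algebraic theories with the weakening rule as their only structural rule. -/
structure WGAT : Type (u + 1) where
  /-- type-constants -/
  TyConst : Type u
  /-- term-constants -/
  TmConst : Type u
  /-- basic judgements -/
  basics : Set (Judg (TyConst ⊕ TmConst))
  isJudgement : ∀ J ∈ basics, J.IsJudgement
  tyIntro : ∀ A : TyConst, ∃! J, J ∈ basics ∧ IsTyIntro (Sum.inl A) J
  tmIntro : ∀ f : TmConst, ∃! J, J ∈ basics ∧ IsTmIntro (Sum.inr f) J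
  cases_basics : ∀ J ∈ basics, (∃ A : TyConst, IsTyIntro (Sum.inl A) J) ∨
    (∃ f : TmConst, IsTmIntro (Sum.inr f) J) ∨ J.IsEquality
  derivable_basics : ∀ J ∈ basics, Derivable basics J

namespace WGAT

/-- The alphabet of a theory. -/
abbrev Alph (T : WGAT.{u}) : Type u := T.TyConst ⊕ T.TmConst

/-- Derived judgements of a theory. -/
abbrev Der (T : WGAT.{u}) (J : Judg T.Alph) : Prop := Derivable T.basics J

/-- The collection of derived judgements of a theory. -/
abbrev Derived (T : WGAT.{u}) : Type u := {J : Judg T.Alph // T.Der J}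

end WGAT

/-- Interpretations: assignments on derived judgements that preserve boundaries and deductions,
the latter in the sense that `f (r J₁ … Jₖ) = r (f J₁) … (f Jₖ)` for each deduction rule `r`
whenever both sides are defined. -/
structure Interp (T U : WGAT.{u}) : Type u where
  toFun : T.Derived → U.Derived
  map_boundary : ∀ (J : T.Derived) (Ks : List T.Derived),
    Ks.map Subtype.val = J.1.boundary → (Ks.map fun K => (toFun K).1) = (toFun J).1.boundary
  map_rule : ∀ (r : RuleName) (Js : List T.Derived) (J : T.Derived) (J' : Judg U.Alph),
    Rule r (Js.map Subtype.val) J.1 → Rule r (Js.map fun K => (toFun K).1) J' → (toFun J).1 = J'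

/-- The replacement of variables `[x_1/y_1, …, x_k/y_k]`, for lists `xs` and `ys`. -/
def replace (xs ys : List ℕ) (v : ℕ) : ℕ := ((ys.zip xs).lookup v).getD v

namespace WGAT

variable (T : WGAT.{u})

/-- For contexts `x_1 : S_1, …` and `y_1 : T_1, …`: they have equal lengths and for each `i` the
judgement `x_1 : S_1, …, x_{i-1} : S_{i-1} ⊢ S_i = T_i[x_1/y_1, …, x_{i-1}/y_{i-1}] type` is
derivable. -/
def CtxCong : Ctx T.Alph → Ctx T.Alph → Prop
  | [], [] => True
  | (_, S) :: Γ, (_, R) :: Δ =>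
    CtxCong Γ Δ ∧ T.Der ⟨Γ, .tyEq S (R.rename (replace (Ctx.vars Γ) (Ctx.vars Δ)))⟩
  | _, _ => False

/-- Derived type judgements of degree `n + 1`. -/
structure TyJ (n : ℕ) : Type u where
  ctx : Ctx T.Alph
  type : Exp T.Alph
  length_eq : ctx.length = n
  der : T.Der ⟨ctx, .ty type⟩

/-- Derived term judgements of degree `n + 1`. -/
structure TmJ (n : ℕ) : Type u where
  ctx : Ctx T.Alph
  term : Exp T.Alph
  type : Exp T.Alph
  length_eq : ctx.length = n
  der : T.Der ⟨ctx, .tm term type⟩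

end WGAT

/-! ## Elementary facts on derivations -/

section Lemmas

variable {W : Type u}

theorem Ctx.vars_rename (f : ℕ → ℕ) (Γ : Ctx W) :
    Ctx.vars (Ctx.rename f Γ) = (Ctx.vars Γ).map f := by
  simp [Ctx.vars, Ctx.rename, Function.comp_def]

theorem Ctx.vars_append (Γ Δ : Ctx W) : Ctx.vars (Δ ++ Γ) = Ctx.vars Δ ++ Ctx.vars Γ := by
  simp [Ctx.vars]

theorem Ctx.rename_append (f : ℕ → ℕ) (Γ Δ : Ctx W) :
    Ctx.rename f (Δ ++ Γ) = Ctx.rename f Δ ++ Ctx.rename f Γ := by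
  simp [Ctx.rename]

theorem Ctx.mem_vars_fv {Γ : Ctx W} {y : ℕ} (h : y ∈ Ctx.vars Γ) : y ∈ Ctx.fv Γ := by
  simp only [Ctx.vars, List.mem_map] at h
  obtain ⟨p, hp, rfl⟩ := h
  exact ⟨p, hp, Or.inl rfl⟩

theorem Judg.boundary_rename (f : ℕ → ℕ) (J : Judg W) :
    (J.rename f).boundary = J.boundary.map (Judg.rename f) := by
  obtain ⟨Γ, B⟩ := J
  cases B <;> cases Γ <;> simp [Judg.rename, Judg.boundary, Body.rename, Ctx.rename]

theorem Derivable.of_boundary {Λ : Set (Judg W)} {J : Judg W} (hJ : Derivable Λ J) :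
    ∀ K ∈ J.boundary, Derivable Λ K := by
  induction hJ with
  | basic J hJ h _ => exact h
  | rule r Js J hr h ih =>
    cases hr with
    | tmRefl Γ t T => simpa [Judg.boundary] using h
    | tmSymm Γ t₁ t₂ T =>
      simp [Judg.boundary] at ih ⊢
      exact ⟨ih.2, ih.1⟩
    | tmTrans Γ t₁ t₂ t₃ T =>
      simp [Judg.boundary] at ih ⊢
      exact ⟨ih.1.1, ih.2.2⟩
    | tyRefl Γ T => simpa [Judg.boundary] using h
    | tySymm Γ T₁ T₂ =>
      simp [Judg.boundary] at ih ⊢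
      exact ⟨ih.2, ih.1⟩
    | tyTrans Γ T₁ T₂ T₃ =>
      simp [Judg.boundary] at ih ⊢
      exact ⟨ih.1.1, ih.2.2⟩
    | tmConv Γ t T₁ T₂ =>
      simp [Judg.boundary] at ih ⊢
      exact ih.1.2
    | tmEqConv Γ t₁ t₂ T₁ T₂ =>
      simp [Judg.boundary] at ih h ⊢
      refine ⟨.rule _ _ _ (.tmConv Γ t₁ T₁ T₂) ?_, .rule _ _ _ (.tmConv Γ t₂ T₁ T₂) ?_⟩
      · simpa using ⟨h.1, ih.2.1⟩
      · simpa using ⟨h.1, ih.2.2⟩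
    | ctxConv Γ Δ x T₁ T₂ B =>
      have key : ∀ (E : Ctx W) (C : Body W), Derivable Λ ⟨E ++ (x, T₁) :: Γ, C⟩ →
          Derivable Λ ⟨E ++ (x, T₂) :: Γ, C⟩ := by
        intro E C hC
        refine .rule _ _ _ (.ctxConv Γ E x T₁ T₂ C) ?_
        simp only [List.mem_cons, forall_eq_or_imp] at h ⊢
        simpa using ⟨h.1, hC⟩
      cases B with
      | ty R =>
        cases Δ with
        | nil =>
          simp [Judg.boundary] at ih ⊢
          exact ih.1.2
        | cons p Δ =>
          simp [Judg.boundary] at ih ⊢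
          exact key _ _ ih.2
      | tm t R =>
        simp [Judg.boundary] at ih ⊢
        exact key _ _ ih.2
      | tyEq R R' =>
        simp [Judg.boundary] at ih ⊢
        exact ⟨key _ _ ih.2.1, key _ _ ih.2.2⟩
      | tmEq t t' R =>
        simp [Judg.boundary] at ih ⊢
        exact ⟨key _ _ ih.2.1, key _ _ ih.2.2⟩
    | alpha σ J =>
      intro K hK
      rw [Judg.boundary_rename] at hK
      obtain ⟨K', hK', rfl⟩ := List.mem_map.1 hK
      refine .rule _ _ _ (.alpha σ K') ?_
      simpa using ih J (by simp) K' hK'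
    | weaken y Γ Δ T B hΓ hΔ =>
      have key : ∀ (E : Ctx W) (C : Body W), y ∉ Ctx.fv E → Derivable Λ ⟨E ++ Γ, C⟩ →
          Derivable Λ ⟨E ++ (y, T) :: Γ, C⟩ := by
        intro E C hE hC
        refine .rule _ _ _ (.weaken y Γ E T C hΓ hE) ?_
        simp only [List.mem_cons, forall_eq_or_imp] at h ⊢
        simpa using ⟨h.1, hC⟩
      cases B with
      | ty R =>
        cases Δ with
        | nil =>
          simp [Judg.boundary] at h ⊢
          exact h.1
        | cons p Δ =>
          simp [Judg.boundary] at ih ⊢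
          refine key _ _ (fun hc => hΔ ?_) ih.2
          obtain ⟨q, hq, hc⟩ := hc
          exact ⟨q, List.mem_cons_of_mem _ hq, hc⟩
      | tm t R =>
        simp [Judg.boundary] at ih ⊢
        exact key _ _ hΔ ih.2
      | tyEq R R' =>
        simp [Judg.boundary] at ih ⊢
        exact ⟨key _ _ hΔ ih.2.1, key _ _ hΔ ih.2.2⟩
      | tmEq t t' R =>
        simp [Judg.boundary] at ih ⊢
        exact ⟨key _ _ hΔ ih.2.1, key _ _ hΔ ih.2.2⟩

theorem Derivable.alpha {Λ : Set (Judg W)} {J : Judg W} (hJ : Derivable Λ J)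
    (σ : Equiv.Perm ℕ) : Derivable Λ (J.rename σ) :=
  .rule _ _ _ (.alpha σ J) (by simpa using hJ)

/-- Contexts of distinct variables in which each type uses earlier variables only. -/
def Ctx.Scoped : Ctx W → Prop
  | [] => True
  | (x, S) :: Γ => x ∉ Ctx.vars Γ ∧ (∀ v ∈ S.fv, v ∈ Ctx.vars Γ) ∧ Ctx.Scoped Γ

/-- All free variables of a body are in a given list. -/
def Body.Scoped (l : List ℕ) : Body W → Prop
  | ty T => ∀ v ∈ T.fv, v ∈ l
  | tm t T => (∀ v ∈ t.fv, v ∈ l) ∧ ∀ v ∈ T.fv, v ∈ l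
  | tyEq T T' => (∀ v ∈ T.fv, v ∈ l) ∧ ∀ v ∈ T'.fv, v ∈ l
  | tmEq t t' T => (∀ v ∈ t.fv, v ∈ l) ∧ (∀ v ∈ t'.fv, v ∈ l) ∧ ∀ v ∈ T.fv, v ∈ l

theorem Body.Scoped.mono {l l' : List ℕ} (h : ∀ v ∈ l, v ∈ l') {B : Body W}
    (hB : B.Scoped l) : B.Scoped l' := by
  cases B <;> simp only [Body.Scoped] at hB ⊢ <;> grind

theorem Body.Scoped.rename (f : ℕ → ℕ) {l : List ℕ} {B : Body W}
    (hB : B.Scoped l) : (B.rename f).Scoped (l.map f) := by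
  have key : ∀ e : Exp W, (∀ v ∈ e.fv, v ∈ l) → ∀ v ∈ (e.rename f).fv, v ∈ l.map f := by
    intro e he v hv
    rw [Exp.fv_rename] at hv
    obtain ⟨w, hw, rfl⟩ := hv
    exact List.mem_map_of_mem (he w hw)
  cases B <;> simp only [Body.Scoped, Body.rename] at hB ⊢ <;> grind

theorem Ctx.Scoped.rename (f : ℕ → ℕ) (hf : Function.Injective f) :
    ∀ {Γ : Ctx W}, Ctx.Scoped Γ → Ctx.Scoped (Ctx.rename f Γ)
  | [], _ => trivial
  | (x, S) :: Γ, h => by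
    obtain ⟨h1, h2, h3⟩ := h
    refine ⟨?_, ?_, Ctx.Scoped.rename f hf h3⟩
    · change f x ∉ Ctx.vars (Ctx.rename f Γ)
      rw [Ctx.vars_rename]
      intro h
      obtain ⟨y, hy, hxy⟩ := List.mem_map.1 h
      exact h1 (hf hxy ▸ hy)
    · have := Body.Scoped.rename f (B := .ty S) (l := Ctx.vars Γ) h2
      change ∀ v ∈ (S.rename f).fv, v ∈ Ctx.vars (Ctx.rename f Γ)
      rwa [Ctx.vars_rename]

theorem Ctx.Scoped.tail : ∀ {Δ Γ : Ctx W}, Ctx.Scoped (Δ ++ Γ) → Ctx.Scoped Γ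
  | [], _, h => h
  | _ :: _, _, h => Ctx.Scoped.tail h.2.2

theorem Ctx.Scoped.conv {Γ : Ctx W} {x : ℕ} {T₁ T₂ : Exp W}
    (hT : ∀ v ∈ T₂.fv, v ∈ Ctx.vars Γ) :
    ∀ {Δ : Ctx W}, Ctx.Scoped (Δ ++ (x, T₁) :: Γ) → Ctx.Scoped (Δ ++ (x, T₂) :: Γ)
  | [], h => ⟨h.1, hT, h.2.2⟩
  | p :: Δ, h => by
    obtain ⟨h1, h2, h3⟩ := h
    refine ⟨?_, ?_, Ctx.Scoped.conv hT h3⟩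
    · simpa [Ctx.vars] using h1
    · simpa [Ctx.vars] using h2

theorem Ctx.Scoped.insert {Γ : Ctx W} {y : ℕ} {T : Exp W} (hy : y ∉ Ctx.vars Γ)
    (hT : ∀ v ∈ T.fv, v ∈ Ctx.vars Γ) :
    ∀ {Δ : Ctx W}, y ∉ Ctx.vars Δ → Ctx.Scoped (Δ ++ Γ) → Ctx.Scoped (Δ ++ (y, T) :: Γ)
  | [], _, h => ⟨hy, hT, h⟩
  | p :: Δ, hΔ, h => by
    obtain ⟨h1, h2, h3⟩ := h
    simp only [Ctx.vars, List.map_cons, List.mem_cons, not_or] at hΔ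
    refine ⟨?_, ?_, Ctx.Scoped.insert hy hT hΔ.2 h3⟩
    · change p.1 ∉ Ctx.vars (Δ ++ (y, T) :: Γ)
      change p.1 ∉ Ctx.vars (Δ ++ Γ) at h1
      simp only [Ctx.vars, List.map_append, List.map_cons, List.mem_append, List.mem_cons,
        not_or] at h1 ⊢
      exact ⟨h1.1, fun h => hΔ.1 h.symm, h1.2⟩
    · intro v hv
      have h4 : v ∈ Ctx.vars (Δ ++ Γ) := h2 v hv
      change v ∈ Ctx.vars (Δ ++ (y, T) :: Γ)
      simp only [Ctx.vars, List.map_append, List.map_cons, List.mem_append, List.mem_cons] at h4 ⊢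
      tauto

theorem WGAT.scoped (T : WGAT.{u}) {J : Judg T.Alph} (hJ : T.Der J) :
    Ctx.Scoped J.ctx ∧ J.body.Scoped (Ctx.vars J.ctx) := by
  induction hJ with
  | basic J hJ h ih =>
    have hn := T.isJudgement J hJ
    rcases T.cases_basics J hJ with ⟨A, Γ, rfl⟩ | ⟨f, Γ, R, rfl⟩ | hE
    · refine ⟨?_, ?_⟩
      · cases Γ with
        | nil => trivial
        | cons p Γ =>
          have := ih ⟨Γ, .ty p.2⟩ (by simp [Judg.boundary])
          simp only [Judg.IsJudgement, Ctx.vars, List.map_cons, List.nodup_cons] at hn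
          exact ⟨hn.1, this.2, this.1⟩
      · intro v hv
        rw [Exp.fv_appVars] at hv
        simpa using hv
    · have := ih ⟨Γ, .ty R⟩ (by simp [Judg.boundary])
      refine ⟨this.1, ?_, this.2⟩
      intro v hv
      rw [Exp.fv_appVars] at hv
      simpa using hv
    · obtain ⟨Γ, B⟩ := J
      rcases hE with ⟨R, R', h⟩ | ⟨t, t', R, h⟩
      · obtain rfl : B = .tyEq R R' := h
        have h1 := ih ⟨Γ, .ty R⟩ (by simp [Judg.boundary])
        have h2 := ih ⟨Γ, .ty R'⟩ (by simp [Judg.boundary])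
        exact ⟨h1.1, h1.2, h2.2⟩
      · obtain rfl : B = .tmEq t t' R := h
        have h1 := ih ⟨Γ, .tm t R⟩ (by simp [Judg.boundary])
        have h2 := ih ⟨Γ, .tm t' R⟩ (by simp [Judg.boundary])
        exact ⟨h1.1, h1.2.1, h2.2.1, h1.2.2⟩
  | rule r Js J hr h ih =>
    cases hr with
    | tmRefl Γ t R => simp [Body.Scoped] at ih ⊢; tauto
    | tmSymm Γ t₁ t₂ R => simp [Body.Scoped] at ih ⊢; tauto
    | tmTrans Γ t₁ t₂ t₃ R => simp [Body.Scoped] at ih ⊢; tauto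
    | tyRefl Γ R => simp [Body.Scoped] at ih ⊢; tauto
    | tySymm Γ T₁ T₂ => simp [Body.Scoped] at ih ⊢; tauto
    | tyTrans Γ T₁ T₂ T₃ => simp [Body.Scoped] at ih ⊢; tauto
    | tmConv Γ t T₁ T₂ => simp [Body.Scoped] at ih ⊢; tauto
    | tmEqConv Γ t₁ t₂ T₁ T₂ => simp [Body.Scoped] at ih ⊢; tauto
    | ctxConv Γ Δ x T₁ T₂ B =>
      have h1 := ih ⟨Γ, .tyEq T₁ T₂⟩ (by simp)
      have h2 := ih ⟨Δ ++ (x, T₁) :: Γ, B⟩ (by simp)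
      refine ⟨Ctx.Scoped.conv h1.2.2 h2.1, ?_⟩
      have : Ctx.vars (Δ ++ (x, T₂) :: Γ) = Ctx.vars (Δ ++ (x, T₁) :: Γ) := by simp [Ctx.vars]
      change B.Scoped (Ctx.vars (Δ ++ (x, T₂) :: Γ))
      rw [this]
      exact h2.2
    | alpha σ J =>
      have h1 := ih J (by simp)
      refine ⟨Ctx.Scoped.rename σ σ.injective h1.1, ?_⟩
      change (J.body.rename σ).Scoped (Ctx.vars (Ctx.rename σ J.ctx))
      rw [Ctx.vars_rename]
      exact h1.2.rename σ
    | weaken y Γ Δ R B hΓ hΔ =>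
      have h1 := ih ⟨Γ, .ty R⟩ (by simp)
      have h2 := ih ⟨Δ ++ Γ, B⟩ (by simp)
      refine ⟨Ctx.Scoped.insert (fun h => hΓ (Ctx.mem_vars_fv h)) h1.2
        (fun h => hΔ (Ctx.mem_vars_fv h)) h2.1, h2.2.mono ?_⟩
      intro v hv
      simp only [Ctx.vars, List.map_append, List.map_cons, List.mem_append, List.mem_cons] at hv ⊢
      tauto

theorem Ctx.Scoped.fv_subset : ∀ {Γ : Ctx W}, Ctx.Scoped Γ → ∀ v ∈ Ctx.fv Γ, v ∈ Ctx.vars Γ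
  | [], _, v, hv => by simp [Ctx.fv] at hv
  | (x, S) :: Γ, h, v, hv => by
    obtain ⟨p, hp, hv⟩ := hv
    simp only [Ctx.vars, List.map_cons, List.mem_cons] at hp ⊢
    rcases hp with rfl | hp
    · rcases hv with rfl | hv
      · exact Or.inl rfl
      · exact Or.inr (h.2.1 v hv)
    · exact Or.inr (Ctx.Scoped.fv_subset h.2.2 v ⟨p, hp, hv⟩)

theorem Ctx.Scoped.nodup : ∀ {Γ : Ctx W}, Ctx.Scoped Γ → (Ctx.vars Γ).Nodup
  | [], _ => List.nodup_nil
  | (_, _) :: _, h => List.nodup_cons.2 ⟨h.1, Ctx.Scoped.nodup h.2.2⟩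

theorem Ctx.rename_congr {f g : ℕ → ℕ} {Γ : Ctx W} (h : ∀ v ∈ Ctx.fv Γ, f v = g v) :
    Ctx.rename f Γ = Ctx.rename g Γ := by
  refine List.map_congr_left fun p hp => ?_
  rw [h p.1 ⟨p, hp, Or.inl rfl⟩, Exp.rename_congr p.2 fun v hv => h v ⟨p, hp, Or.inr hv⟩]

theorem Body.rename_congr {f g : ℕ → ℕ} {l : List ℕ} {B : Body W} (hB : B.Scoped l)
    (h : ∀ v ∈ l, f v = g v) : B.rename f = B.rename g := by
  have key : ∀ e : Exp W, (∀ v ∈ e.fv, v ∈ l) → e.rename f = e.rename g :=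
    fun e he => Exp.rename_congr e fun v hv => h v (he v hv)
  cases B <;> simp only [Body.Scoped, Body.rename] at hB ⊢ <;> grind

theorem Judg.rename_id (J : Judg W) : J.rename (fun v => v) = J := by
  obtain ⟨Γ, B⟩ := J
  have : Ctx.rename (fun v => v) Γ = Γ := by
    simp [Ctx.rename, Exp.rename_id]
  cases B <;> simp [Judg.rename, this, Body.rename, Exp.rename_id]

theorem WGAT.rename_eq_self (T : WGAT.{u}) {J : Judg T.Alph} (hJ : T.Der J) {f : ℕ → ℕ}
    (hf : ∀ v ∈ Ctx.vars J.ctx, f v = v) : J.rename f = J := by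
  obtain ⟨h1, h2⟩ := T.scoped hJ
  have : J.rename f = J.rename (fun v => v) := by
    simp only [Judg.rename]
    rw [Ctx.rename_congr fun v hv => hf v (h1.fv_subset v hv), Body.rename_congr h2 hf]
  rw [this, Judg.rename_id]

theorem exists_not_mem (l : List ℕ) : ∃ y, y ∉ l :=
  (Infinite.exists_notMem_finset l.toFinset).imp fun _ h => by simpa using h

theorem exists_perm : ∀ {xs ys : List ℕ}, xs.Nodup → ys.Nodup → xs.length = ys.length →
    ∃ σ : Equiv.Perm ℕ, ys.map σ = xs
  | [], [], _, _, _ => ⟨1, rfl⟩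
  | x :: xs, y :: ys, hx, hy, h => by
    obtain ⟨hx1, hx2⟩ := List.nodup_cons.1 hx
    obtain ⟨hy1, hy2⟩ := List.nodup_cons.1 hy
    obtain ⟨σ, rfl⟩ := exists_perm hx2 hy2 (by simpa using h)
    refine ⟨σ.trans (Equiv.swap (σ y) x), ?_⟩
    simp only [List.map_cons, Equiv.trans_apply, Equiv.swap_apply_left, List.cons.injEq, true_and]
    refine List.map_congr_left fun v hv => Equiv.swap_apply_of_ne_of_ne ?_ ?_
    · exact fun h => hy1 (σ.injective h ▸ hv)
    · exact fun h => hx1 (h ▸ List.mem_map_of_mem hv)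

theorem replace_eq (σ : ℕ → ℕ) : ∀ (ys : List ℕ) {v : ℕ}, v ∈ ys → replace (ys.map σ) ys v = σ v
  | y :: ys, v, hv => by
    by_cases hvy : v = y
    · subst hvy
      simp [replace]
    · have := replace_eq σ ys (List.mem_of_ne_of_mem hvy hv)
      have hb : (v == y) = false := by simpa using hvy
      simp only [replace, List.map_cons, List.zip_cons_cons, List.lookup_cons, hb] at this ⊢
      exact this

end Lemmas

/-! ## Boundaries and congruence -/

namespace WGAT

variable {T : WGAT.{u}}

theorem Der.of_tm {Γ : Ctx T.Alph} {t R : Exp T.Alph} (h : T.Der ⟨Γ, .tm t R⟩) :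
    T.Der ⟨Γ, .ty R⟩ :=
  Derivable.of_boundary h _ (by simp [Judg.boundary])

theorem Der.tyEq_left {Γ : Ctx T.Alph} {R R' : Exp T.Alph} (h : T.Der ⟨Γ, .tyEq R R'⟩) :
    T.Der ⟨Γ, .ty R⟩ :=
  Derivable.of_boundary h _ (by simp [Judg.boundary])

theorem Der.tyEq_right {Γ : Ctx T.Alph} {R R' : Exp T.Alph} (h : T.Der ⟨Γ, .tyEq R R'⟩) :
    T.Der ⟨Γ, .ty R'⟩ :=
  Derivable.of_boundary h _ (by simp [Judg.boundary])

theorem Der.tmEq_left {Γ : Ctx T.Alph} {t t' R : Exp T.Alph} (h : T.Der ⟨Γ, .tmEq t t' R⟩) :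
    T.Der ⟨Γ, .tm t R⟩ :=
  Derivable.of_boundary h _ (by simp [Judg.boundary])

theorem Der.tmEq_right {Γ : Ctx T.Alph} {t t' R : Exp T.Alph} (h : T.Der ⟨Γ, .tmEq t t' R⟩) :
    T.Der ⟨Γ, .tm t' R⟩ :=
  Derivable.of_boundary h _ (by simp [Judg.boundary])

theorem Der.of_cons {Γ : Ctx T.Alph} {x : ℕ} {S : Exp T.Alph} {B : Body T.Alph}
    (h : T.Der ⟨(x, S) :: Γ, B⟩) : T.Der ⟨Γ, .ty S⟩ := by
  have key : ∀ {R : Exp T.Alph}, T.Der ⟨(x, S) :: Γ, .ty R⟩ → T.Der ⟨Γ, .ty S⟩ :=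
    fun h => Derivable.of_boundary h _ (by simp [Judg.boundary])
  cases B with
  | ty R => exact key h
  | tm t R => exact key (Der.of_tm h)
  | tyEq R R' => exact key (Der.tyEq_left h)
  | tmEq t t' R => exact key (Der.of_tm (Der.tmEq_left h))

/-- The boundary of a type judgement. -/
def TyJ.bd {n : ℕ} : T.TyJ (n + 1) → T.TyJ n
  | ⟨(_, S) :: Γ, _, hl, h⟩ => ⟨Γ, S, Nat.succ.inj hl, Der.of_cons h⟩

/-- The boundary of a term judgement. -/
def TmJ.bd {n : ℕ} (J : T.TmJ n) : T.TyJ n :=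
  ⟨J.ctx, J.type, J.length_eq, Der.of_tm J.der⟩

/-- Congruence of type judgements. -/
def TyCong {n : ℕ} (J K : T.TyJ n) : Prop :=
  T.CtxCong J.ctx K.ctx ∧
    T.Der ⟨J.ctx, .tyEq J.type (K.type.rename (replace J.ctx.vars K.ctx.vars))⟩

/-- Congruence of term judgements. -/
def TmCong {n : ℕ} (J K : T.TmJ n) : Prop :=
  TyCong J.bd K.bd ∧
    T.Der ⟨J.ctx, .tmEq J.term (K.term.rename (replace J.ctx.vars K.ctx.vars)) J.type⟩

theorem TyCong.bd {n : ℕ} {J K : T.TyJ (n + 1)} (h : TyCong J K) : TyCong J.bd K.bd := by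
  obtain ⟨Γ, S, hl, hJ⟩ := J
  obtain ⟨Δ, R, hl', hK⟩ := K
  cases Γ with
  | nil => cases hl
  | cons p Γ =>
    cases Δ with
    | nil => cases hl'
    | cons q Δ => exact h.1

/-- The type-and-term structure of a theory: derived type and term judgements modulo congruence. -/
def toTTStr (T : WGAT.{u}) : TTStr.{u} :=
  TTStr.ofData (fun n => Quot (TyCong (T := T) (n := n))) (fun n => Quot (TmCong (T := T) (n := n)))
    (fun _ => Quot.map TyJ.bd fun _ _ h => h.bd) (fun _ => Quot.map TmJ.bd fun _ _ h => h.1)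

/-- The class of a type judgement. -/
def tyClass {n : ℕ} (J : T.TyJ n) : T.toTTStr.Ty n := Quot.mk _ J

/-- The class of a term judgement. -/
def tmClass {n : ℕ} (J : T.TmJ n) : T.toTTStr.Tm n := Quot.mk _ J

/-- Auxiliary: contexts with the same variables and pairwise equal types. -/
def Conv (T : WGAT.{u}) : Ctx T.Alph → Ctx T.Alph → Prop
  | [], [] => True
  | (x, S) :: Γ, (y, R) :: Δ => x = y ∧ Conv T Γ Δ ∧ T.Der ⟨Γ, .tyEq S R⟩
  | _, _ => False

theorem rename_replace {e : Exp T.Alph} {xs ys : List ℕ} {σ : ℕ → ℕ} (h : ys.map σ = xs)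
    (he : ∀ v ∈ e.fv, v ∈ ys) : e.rename (replace xs ys) = e.rename σ := by
  subst h
  exact Exp.rename_congr e fun v hv => replace_eq σ ys (he v hv)

theorem ctxCong_iff_conv (σ : ℕ → ℕ) : ∀ {Γ Δ : Ctx T.Alph}, Ctx.Scoped Δ →
    (Ctx.vars Δ).map σ = Ctx.vars Γ → (T.CtxCong Γ Δ ↔ T.Conv Γ (Ctx.rename σ Δ))
  | [], [], _, _ => Iff.rfl
  | [], _ :: _, _, h => by simp [Ctx.vars] at h
  | _ :: _, [], _, h => by simp [Ctx.vars] at h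
  | (x, S) :: Γ, (y, R) :: Δ, hs, h => by
    have h : σ y = x ∧ (Ctx.vars Δ).map σ = Ctx.vars Γ := by simpa [Ctx.vars] using h
    have ih := ctxCong_iff_conv σ hs.2.2 h.2
    change T.CtxCong Γ Δ ∧ _ ↔ x = σ y ∧ T.Conv Γ (Ctx.rename σ Δ) ∧ T.Der ⟨Γ, .tyEq S (R.rename σ)⟩
    rw [ih, rename_replace (σ := σ) h.2 hs.2.1]
    simp [h.1]

theorem CtxCong.length : ∀ {Γ Δ : Ctx T.Alph}, T.CtxCong Γ Δ → Γ.length = Δ.length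
  | [], [], _ => rfl
  | [], _ :: _, h => h.elim
  | _ :: _, [], h => h.elim
  | _ :: _, _ :: _, h => congrArg Nat.succ (CtxCong.length h.1)

end WGAT

namespace Judg

variable {W : Type u}

theorem boundary_eq_nil {J : Judg W} (h : J.boundary = []) : ∃ R, J = ⟨[], .ty R⟩ := by
  obtain ⟨Γ, B⟩ := J
  cases B <;> cases Γ <;> simp [boundary] at h ⊢

theorem boundary_eq_single {J K : Judg W} (h : J.boundary = [K]) :
    (∃ Γ x S R, J = ⟨(x, S) :: Γ, .ty R⟩ ∧ K = ⟨Γ, .ty S⟩) ∨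
      ∃ Γ t R, J = ⟨Γ, .tm t R⟩ ∧ K = ⟨Γ, .ty R⟩ := by
  obtain ⟨Γ, B⟩ := J
  cases B with
  | ty R =>
    cases Γ with
    | nil => simp [boundary] at h
    | cons p Γ =>
      simp only [boundary, List.cons.injEq, and_true] at h
      exact Or.inl ⟨Γ, p.1, p.2, R, rfl, h.symm⟩
  | tm t R =>
    have : (boundary ⟨Γ, .tm t R⟩) = [⟨Γ, .ty R⟩] := by simp [boundary]
    rw [this] at h
    simp only [List.cons.injEq, and_true] at h
    exact Or.inr ⟨Γ, t, R, rfl, h.symm⟩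
  | tyEq R R' => simp [boundary] at h
  | tmEq t t' R => simp [boundary] at h

theorem boundary_eq_ty_ty {J : Judg W} {Γ Γ' : Ctx W} {R R' : Exp W}
    (h : J.boundary = [⟨Γ, .ty R⟩, ⟨Γ', .ty R'⟩]) : Γ' = Γ ∧ J = ⟨Γ, .tyEq R R'⟩ := by
  obtain ⟨Δ, B⟩ := J
  cases B <;> cases Δ <;> simp [boundary] at h ⊢ <;> grind

theorem boundary_eq_tm_tm {J : Judg W} {Γ Γ' : Ctx W} {t t' R R' : Exp W}
    (h : J.boundary = [⟨Γ, .tm t R⟩, ⟨Γ', .tm t' R'⟩]) :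
    Γ' = Γ ∧ R' = R ∧ J = ⟨Γ, .tmEq t t' R⟩ := by
  obtain ⟨Δ, B⟩ := J
  cases B <;> cases Δ <;> simp [boundary] at h ⊢ <;> grind

end Judg

namespace Interp

variable {T U : WGAT.{u}} (I : Interp T U)

/-- The image of a derived judgement. -/
def img {J : Judg T.Alph} (h : T.Der J) : Judg U.Alph := (I.toFun ⟨J, h⟩).1

theorem img_der {J : Judg T.Alph} (h : T.Der J) : U.Der (I.img h) := (I.toFun ⟨J, h⟩).2

theorem img_congr {J K : Judg T.Alph} (h : T.Der J) (k : T.Der K) (e : J = K) :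
    I.img h = I.img k := by
  subst e; rfl

theorem img_alpha {J : Judg T.Alph} (h : T.Der J) (σ : Equiv.Perm ℕ) :
    I.img (Derivable.alpha h σ) = (I.img h).rename σ :=
  I.map_rule (.alpha σ) [⟨J, h⟩] ⟨_, Derivable.alpha h σ⟩ _ (.alpha σ J) (.alpha σ _)

/-- The image of a judgement uses no new variables. -/
theorem vars_img {J : Judg T.Alph} (h : T.Der J) {x : ℕ} (hx : x ∈ Ctx.vars (I.img h).ctx) :
    x ∈ Ctx.vars J.ctx := by
  by_contra hxJ
  obtain ⟨z, hz⟩ := exists_not_mem (x :: (Ctx.vars J.ctx ++ Ctx.vars (I.img h).ctx))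
  simp only [List.mem_cons, List.mem_append, not_or] at hz
  have h1 : J.rename (Equiv.swap x z) = J := T.rename_eq_self h fun v hv =>
    Equiv.swap_apply_of_ne_of_ne (fun e => hxJ (e ▸ hv)) (fun e => hz.2.1 (e ▸ hv))
  have h2 := I.img_alpha h (Equiv.swap x z)
  rw [I.img_congr _ h h1] at h2
  have h3 : Ctx.vars (I.img h).ctx = (Ctx.vars (I.img h).ctx).map (Equiv.swap x z) := by
    conv_lhs => rw [h2]
    exact Ctx.vars_rename _ _
  have h4 : z ∈ (Ctx.vars (I.img h).ctx).map (Equiv.swap x z) :=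
    List.mem_map.2 ⟨x, hx, Equiv.swap_apply_left x z⟩
  rw [← h3] at h4
  exact hz.2.2 h4

theorem img_ty_exists {Γ : Ctx T.Alph} {R : Exp T.Alph} (h : T.Der ⟨Γ, .ty R⟩) :
    ∃ Γ' R', I.img h = ⟨Γ', .ty R'⟩ := by
  obtain ⟨y, hy⟩ := exists_not_mem (Ctx.vars Γ)
  have hk : T.Der ⟨(y, R) :: Γ, .ty R⟩ := by
    refine .rule _ _ _ (.weaken y Γ [] R (.ty R)
      (fun hc => hy ((T.scoped h).1.fv_subset y hc)) (by simp [Ctx.fv])) ?_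
    simpa using h
  have hb := I.map_boundary ⟨_, hk⟩ [⟨_, h⟩] rfl
  rcases Judg.boundary_eq_single hb.symm with ⟨Δ, x, S, R', -, h1⟩ | ⟨Δ, t, R', -, h1⟩
  · exact ⟨_, _, h1⟩
  · exact ⟨_, _, h1⟩

theorem img_ty_nil {R : Exp T.Alph} (h : T.Der ⟨[], .ty R⟩) :
    ∃ R', I.img h = ⟨[], .ty R'⟩ :=
  Judg.boundary_eq_nil (I.map_boundary ⟨_, h⟩ [] rfl).symm

theorem img_ty_cons' {Γ : Ctx T.Alph} {x : ℕ} {S R : Exp T.Alph}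
    (h : T.Der ⟨(x, S) :: Γ, .ty R⟩) (h' : T.Der ⟨Γ, .ty S⟩) :
    ∃ Γ' x' S' R', I.img h = ⟨(x', S') :: Γ', .ty R'⟩ ∧ I.img h' = ⟨Γ', .ty S'⟩ := by
  have hb := I.map_boundary ⟨_, h⟩ [⟨_, h'⟩] rfl
  rcases Judg.boundary_eq_single hb.symm with ⟨Δ, x', S', R', h1, h2⟩ | ⟨Δ, t, R', h1, -⟩
  · exact ⟨Δ, x', S', R', h1, h2⟩
  · obtain ⟨Γ', R'', h3⟩ := I.img_ty_exists h
    have := h3.symm.trans h1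
    simp at this

theorem vars_img_ty : ∀ {Γ : Ctx T.Alph} {R : Exp T.Alph} (h : T.Der ⟨Γ, .ty R⟩),
    Ctx.vars (I.img h).ctx = Ctx.vars Γ
  | [], R, h => by
    obtain ⟨R', h1⟩ := I.img_ty_nil h
    rw [h1]
    rfl
  | (x, S) :: Γ, R, h => by
    have h' := WGAT.Der.of_cons h
    obtain ⟨Γ', x', S', R', h1, h2⟩ := I.img_ty_cons' h h'
    have ih := vars_img_ty h'
    rw [h2] at ih
    have hs := (U.scoped (I.img_der h)).1
    rw [h1] at hs
    have hx : x' ∈ Ctx.vars ((x, S) :: Γ) := I.vars_img h (by rw [h1]; simp [Ctx.vars])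
    have hx' : x' ∉ Ctx.vars Γ := by
      have := hs.1
      rwa [show Ctx.vars Γ' = Ctx.vars Γ from ih] at this
    simp only [Ctx.vars, List.map_cons, List.mem_cons] at hx hx'
    have hxx : x' = x := hx.resolve_right hx'
    rw [h1]
    simp only [Ctx.vars, List.map_cons, hxx, List.cons.injEq, true_and]
    exact ih

theorem img_ty_cons {Γ : Ctx T.Alph} {x : ℕ} {S R : Exp T.Alph}
    (h : T.Der ⟨(x, S) :: Γ, .ty R⟩) (h' : T.Der ⟨Γ, .ty S⟩) :
    ∃ Γ' S' R', I.img h = ⟨(x, S') :: Γ', .ty R'⟩ ∧ I.img h' = ⟨Γ', .ty S'⟩ := by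
  obtain ⟨Γ', x', S', R', h1, h2⟩ := I.img_ty_cons' h h'
  have hv := I.vars_img_ty h
  rw [h1] at hv
  simp only [Ctx.vars, List.map_cons, List.cons.injEq] at hv
  obtain ⟨rfl, -⟩ := hv
  exact ⟨Γ', S', R', h1, h2⟩

theorem img_tm {Γ : Ctx T.Alph} {t R : Exp T.Alph} (h : T.Der ⟨Γ, .tm t R⟩)
    (h' : T.Der ⟨Γ, .ty R⟩) :
    ∃ Γ' t' R', I.img h = ⟨Γ', .tm t' R'⟩ ∧ I.img h' = ⟨Γ', .ty R'⟩ := by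
  have hb := I.map_boundary ⟨_, h⟩ [⟨_, h'⟩] rfl
  rcases Judg.boundary_eq_single hb.symm with ⟨Δ, x, S, R', h1, h2⟩ | h3
  · exfalso
    have h1 : I.img h = ⟨(x, S) :: Δ, .ty R'⟩ := h1
    have h2 : I.img h' = ⟨Δ, .ty S⟩ := h2
    have hv := I.vars_img_ty h'
    rw [h2] at hv
    have hs := (U.scoped (I.img_der h)).1
    rw [h1] at hs
    have hx : x ∈ Ctx.vars Γ := I.vars_img h (by rw [h1]; simp [Ctx.vars])
    exact hs.1 (by rw [show Ctx.vars Δ = Ctx.vars Γ from hv]; exact hx)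
  · exact h3

theorem img_tyEq {Γ : Ctx T.Alph} {R S : Exp T.Alph} (h : T.Der ⟨Γ, .tyEq R S⟩)
    (hR : T.Der ⟨Γ, .ty R⟩) (hS : T.Der ⟨Γ, .ty S⟩) :
    ∃ Γ' R' S', I.img h = ⟨Γ', .tyEq R' S'⟩ ∧ I.img hR = ⟨Γ', .ty R'⟩ ∧
      I.img hS = ⟨Γ', .ty S'⟩ := by
  have hb : [I.img hR, I.img hS] = (I.img h).boundary := I.map_boundary ⟨_, h⟩ [⟨_, hR⟩, ⟨_, hS⟩] rfl
  obtain ⟨Γ₁, R', h1⟩ := I.img_ty_exists hR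
  obtain ⟨Γ₂, S', h2⟩ := I.img_ty_exists hS
  rw [h1, h2] at hb
  obtain ⟨rfl, h3⟩ := Judg.boundary_eq_ty_ty hb.symm
  exact ⟨_, _, _, h3, h1, h2⟩

theorem img_tmEq {Γ : Ctx T.Alph} {t s R : Exp T.Alph} (h : T.Der ⟨Γ, .tmEq t s R⟩)
    (ht : T.Der ⟨Γ, .tm t R⟩) (hs : T.Der ⟨Γ, .tm s R⟩) :
    ∃ Γ' t' s' R', I.img h = ⟨Γ', .tmEq t' s' R'⟩ ∧ I.img ht = ⟨Γ', .tm t' R'⟩ ∧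
      I.img hs = ⟨Γ', .tm s' R'⟩ := by
  have hb : [I.img ht, I.img hs] = (I.img h).boundary := I.map_boundary ⟨_, h⟩ [⟨_, ht⟩, ⟨_, hs⟩] rfl
  obtain ⟨Γ₁, t', R', h1, -⟩ := I.img_tm ht (WGAT.Der.of_tm ht)
  obtain ⟨Γ₂, s', S', h2, -⟩ := I.img_tm hs (WGAT.Der.of_tm ht)
  rw [h1, h2] at hb
  obtain ⟨rfl, rfl, h3⟩ := Judg.boundary_eq_tm_tm hb.symm
  exact ⟨_, _, _, _, h3, h1, h2⟩

/-- The context of the image depends on the context only. -/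
theorem img_ctx {Γ : Ctx T.Alph} {B : Body T.Alph} (h : T.Der ⟨Γ, B⟩) :
    ∃ (R : Exp T.Alph) (h' : T.Der ⟨Γ, .ty R⟩), (I.img h).ctx = (I.img h').ctx := by
  cases B with
  | ty R => exact ⟨R, h, rfl⟩
  | tm t R =>
    obtain ⟨Γ', t', R', h1, h2⟩ := I.img_tm h (WGAT.Der.of_tm h)
    exact ⟨R, _, by rw [h1, h2]⟩
  | tyEq R S =>
    obtain ⟨Γ', R', S', h1, h2, -⟩ := I.img_tyEq h (WGAT.Der.tyEq_left h) (WGAT.Der.tyEq_right h)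
    exact ⟨R, _, by rw [h1, h2]⟩
  | tmEq t s R =>
    obtain ⟨Γ', t', s', R', h1, h2, -⟩ :=
      I.img_tmEq h (WGAT.Der.tmEq_left h) (WGAT.Der.tmEq_right h)
    obtain ⟨Γ'', t'', R'', h3, h4⟩ := I.img_tm (WGAT.Der.tmEq_left h)
      (WGAT.Der.of_tm (WGAT.Der.tmEq_left h))
    refine ⟨R, WGAT.Der.of_tm (WGAT.Der.tmEq_left h), ?_⟩
    rw [h1, h4]
    rw [h2] at h3
    simp only [Judg.mk.injEq] at h3
    exact h3.1

theorem img_ctx_cons {Γ : Ctx T.Alph} {x : ℕ} {S : Exp T.Alph} {B : Body T.Alph}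
    (h : T.Der ⟨(x, S) :: Γ, B⟩) (h' : T.Der ⟨Γ, .ty S⟩) :
    ∃ Γ' S', (I.img h).ctx = (x, S') :: Γ' ∧ I.img h' = ⟨Γ', .ty S'⟩ := by
  obtain ⟨R, hR, h1⟩ := I.img_ctx h
  obtain ⟨Γ', S', R', h2, h3⟩ := I.img_ty_cons hR h'
  exact ⟨Γ', S', by rw [h1, h2], h3⟩

theorem img_ctx_append {Γ : Ctx T.Alph} {x : ℕ} {S : Exp T.Alph} (h' : T.Der ⟨Γ, .ty S⟩)
    {Γ' : Ctx U.Alph} {S' : Exp U.Alph} (hi : I.img h' = ⟨Γ', .ty S'⟩) :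
    ∀ {E : Ctx T.Alph} {B : Body T.Alph} (h : T.Der ⟨E ++ (x, S) :: Γ, B⟩),
      ∃ E', (I.img h).ctx = E' ++ (x, S') :: Γ'
  | [], B, h => by
    obtain ⟨Γ'', S'', h1, h2⟩ := I.img_ctx_cons h h'
    rw [hi] at h2
    simp only [Judg.mk.injEq, Body.ty.injEq] at h2
    obtain ⟨rfl, rfl⟩ := h2
    exact ⟨[], h1⟩
  | (y, R) :: E, B, h => by
    have hR : T.Der ⟨E ++ (x, S) :: Γ, .ty R⟩ := WGAT.Der.of_cons h
    obtain ⟨E', hE⟩ := img_ctx_append h' hi hR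
    obtain ⟨Δ, R', h1, h2⟩ := I.img_ctx_cons h hR
    rw [h2] at hE
    exact ⟨(y, R') :: E', by rw [h1]; simpa using hE⟩

theorem ctxConv_der {Γ E : Ctx T.Alph} {x : ℕ} {S R : Exp T.Alph} {B : Body T.Alph}
    (he : T.Der ⟨Γ, .tyEq R S⟩) (h : T.Der ⟨E ++ (x, R) :: Γ, B⟩) :
    T.Der ⟨E ++ (x, S) :: Γ, B⟩ :=
  .rule _ _ _ (.ctxConv Γ E x R S B) (by
    simp only [List.mem_cons, forall_eq_or_imp]
    exact ⟨he, h, by simp⟩)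

theorem img_ctxConv {Γ E : Ctx T.Alph} {x : ℕ} {S R : Exp T.Alph} {B : Body T.Alph}
    (he : T.Der ⟨Γ, .tyEq R S⟩) (h : T.Der ⟨E ++ (x, R) :: Γ, B⟩) :
    (I.img (ctxConv_der he h)).body = (I.img h).body := by
  obtain ⟨Γ', R', S', h1, h2, h3⟩ :=
    I.img_tyEq he (WGAT.Der.tyEq_left he) (WGAT.Der.tyEq_right he)
  obtain ⟨E', hE⟩ := I.img_ctx_append (WGAT.Der.tyEq_left he) h2 h
  have h4 : I.img h = ⟨E' ++ (x, R') :: Γ', (I.img h).body⟩ := by rw [← hE]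
  have h5 : I.img (ctxConv_der he h) = ⟨E' ++ (x, S') :: Γ', (I.img h).body⟩ := by
    refine I.map_rule .ctxConv [⟨_, he⟩, ⟨_, h⟩] ⟨_, ctxConv_der he h⟩ _
      (.ctxConv Γ E x R S B) ?_
    change Rule .ctxConv [I.img he, I.img h] _
    rw [h1]
    nth_rw 1 [h4]
    exact .ctxConv Γ' E' x R' S' _
  rw [h5]

theorem tySymm_der {Γ : Ctx T.Alph} {R S : Exp T.Alph} (h : T.Der ⟨Γ, .tyEq R S⟩) :
    T.Der ⟨Γ, .tyEq S R⟩ :=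
  .rule _ _ _ (.tySymm Γ R S) (by simpa using h)

theorem conv_img : ∀ {Γ Δ : Ctx T.Alph}, T.Conv Γ Δ → ∀ (E : Ctx T.Alph) {B : Body T.Alph}
    (h : T.Der ⟨E ++ Δ, B⟩), ∃ h' : T.Der ⟨E ++ Γ, B⟩, (I.img h').body = (I.img h).body
  | [], [], _, _, _, h => ⟨h, rfl⟩
  | [], _ :: _, hc, _, _, _ => hc.elim
  | _ :: _, [], hc, _, _, _ => hc.elim
  | (x, S) :: Γ, (y, R) :: Δ, hc, E, B, h => by
    obtain ⟨rfl, hc1, hc2⟩ := hc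
    have e : ∀ Θ : Ctx T.Alph, (⟨(E ++ [(x, R)]) ++ Θ, B⟩ : Judg T.Alph) = ⟨E ++ (x, R) :: Θ, B⟩ := by
      intro Θ; simp
    have h1 : T.Der ⟨(E ++ [(x, R)]) ++ Δ, B⟩ := (e Δ).symm ▸ h
    obtain ⟨h2, h3⟩ := conv_img hc1 (E ++ [(x, R)]) h1
    have h4 : T.Der ⟨E ++ (x, R) :: Γ, B⟩ := e Γ ▸ h2
    refine ⟨ctxConv_der (tySymm_der hc2) h4, ?_⟩
    rw [I.img_ctxConv (tySymm_der hc2) h4, I.img_congr h4 h2 (e Γ).symm, h3, I.img_congr h1 h (e Δ)]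

theorem conv_img_ctx : ∀ {Γ Δ : Ctx T.Alph}, T.Conv Γ Δ → ∀ {B C : Body T.Alph}
    (h : T.Der ⟨Γ, B⟩) (k : T.Der ⟨Δ, C⟩), U.Conv (I.img h).ctx (I.img k).ctx
  | [], [], _, B, C, h, k => by
    obtain ⟨R, hR, h1⟩ := I.img_ctx h
    obtain ⟨S, hS, h2⟩ := I.img_ctx k
    obtain ⟨R', h3⟩ := I.img_ty_nil hR
    obtain ⟨S', h4⟩ := I.img_ty_nil hS
    rw [h1, h2, h3, h4]
    trivial
  | [], _ :: _, hc, _, _, _, _ => hc.elim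
  | _ :: _, [], hc, _, _, _, _ => hc.elim
  | (x, S) :: Γ, (y, R) :: Δ, hc, B, C, h, k => by
    obtain ⟨rfl, hc1, hc2⟩ := hc
    have hS := WGAT.Der.of_cons h
    have hR := WGAT.Der.of_cons k
    obtain ⟨Γ', S', h1, h2⟩ := I.img_ctx_cons h hS
    obtain ⟨Δ', R', k1, k2⟩ := I.img_ctx_cons k hR
    have ih := conv_img_ctx hc1 hS hR
    rw [h2, k2] at ih
    obtain ⟨hR', h3⟩ := I.conv_img hc1 [] hR
    obtain ⟨Γ₁, S₁, R₁, e1, e2, e3⟩ := I.img_tyEq hc2 hS hR'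
    rw [h2] at e2
    simp only [Judg.mk.injEq, Body.ty.injEq] at e2
    obtain ⟨rfl, rfl⟩ := e2
    rw [show I.img hR' = _ from e3, k2] at h3
    simp only [Body.ty.injEq] at h3
    subst h3
    rw [h1, k1]
    exact ⟨rfl, ih, e1 ▸ I.img_der hc2⟩

theorem exists_tyJ {n : ℕ} (J : T.TyJ n) : ∃ K : U.TyJ n, I.img J.der = ⟨K.ctx, .ty K.type⟩ := by
  obtain ⟨Γ', R', h⟩ := I.img_ty_exists J.der
  refine ⟨⟨Γ', R', ?_, h ▸ I.img_der J.der⟩, h⟩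
  have := congrArg List.length (I.vars_img_ty J.der)
  rw [h] at this
  simp only [Ctx.vars, List.length_map] at this
  rw [this, J.length_eq]

theorem exists_tmJ {n : ℕ} (J : T.TmJ n) :
    ∃ K : U.TmJ n, I.img J.der = ⟨K.ctx, .tm K.term K.type⟩ := by
  obtain ⟨Γ', t', R', h, h'⟩ := I.img_tm J.der (WGAT.Der.of_tm J.der)
  refine ⟨⟨Γ', t', R', ?_, h ▸ I.img_der J.der⟩, h⟩
  have := congrArg List.length (I.vars_img_ty (WGAT.Der.of_tm J.der))
  rw [h'] at this
  simp only [Ctx.vars, List.length_map] at this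
  rw [this, J.length_eq]

/-- The action of an interpretation on type judgements. -/
noncomputable def mapTyJ {n : ℕ} (J : T.TyJ n) : U.TyJ n := (I.exists_tyJ J).choose

/-- The action of an interpretation on term judgements. -/
noncomputable def mapTmJ {n : ℕ} (J : T.TmJ n) : U.TmJ n := (I.exists_tmJ J).choose

theorem mapTyJ_spec {n : ℕ} (J : T.TyJ n) :
    I.img J.der = ⟨(I.mapTyJ J).ctx, .ty (I.mapTyJ J).type⟩ := (I.exists_tyJ J).choose_spec

theorem mapTmJ_spec {n : ℕ} (J : T.TmJ n) :
    I.img J.der = ⟨(I.mapTmJ J).ctx, .tm (I.mapTmJ J).term (I.mapTmJ J).type⟩ :=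
  (I.exists_tmJ J).choose_spec

theorem mapTyJ_bd {n : ℕ} (J : T.TyJ (n + 1)) : I.mapTyJ J.bd = (I.mapTyJ J).bd := by
  have h1 := I.mapTyJ_spec J
  have h2 := I.mapTyJ_spec J.bd
  obtain ⟨Γ, R, hl, h⟩ := J
  match Γ, hl, h, h1, h2 with
  | (x, S) :: Γ, hl, h, h1, h2 =>
    obtain ⟨Γ', S', R', h3, h4⟩ := I.img_ty_cons h (WGAT.Der.of_cons h)
    generalize I.mapTyJ _ = K at h1
    generalize I.mapTyJ _ = L at h2
    obtain ⟨Δ, R₁, hl₁, hΔ⟩ := K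
    obtain ⟨Θ, R₂, hl₂, hΘ⟩ := L
    have h5 := h3.symm.trans h1
    have h6 := h4.symm.trans h2
    simp only [Judg.mk.injEq, Body.ty.injEq] at h5 h6
    obtain ⟨rfl, rfl⟩ := h5
    obtain ⟨rfl, rfl⟩ := h6
    rfl

theorem mapTmJ_bd {n : ℕ} (J : T.TmJ n) : I.mapTyJ J.bd = (I.mapTmJ J).bd := by
  have h1 := I.mapTmJ_spec J
  have h2 := I.mapTyJ_spec J.bd
  obtain ⟨Γ', t', R', h3, h4⟩ := I.img_tm J.der (WGAT.Der.of_tm J.der)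
  generalize I.mapTmJ J = K at h1 ⊢
  generalize I.mapTyJ J.bd = L at h2 ⊢
  obtain ⟨Δ, s₁, R₁, hl₁, hΔ⟩ := K
  obtain ⟨Θ, R₂, hl₂, hΘ⟩ := L
  have h5 := h3.symm.trans h1
  have h6 := h4.symm.trans h2
  simp only [Judg.mk.injEq, Body.ty.injEq, Body.tm.injEq] at h5 h6
  obtain ⟨rfl, rfl, rfl⟩ := h5
  obtain ⟨rfl, rfl⟩ := h6
  rfl

theorem exists_perm_of_cong {Γ Δ : Ctx T.Alph} {B C : Body T.Alph} (hc : T.CtxCong Γ Δ)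
    (h : T.Der ⟨Γ, B⟩) (k : T.Der ⟨Δ, C⟩) :
    ∃ σ : Equiv.Perm ℕ, (Ctx.vars Δ).map σ = Ctx.vars Γ :=
  exists_perm (T.scoped h).1.nodup (T.scoped k).1.nodup (by simpa [Ctx.vars] using hc.length)

theorem vars_mapTyJ {n : ℕ} (J : T.TyJ n) : Ctx.vars (I.mapTyJ J).ctx = Ctx.vars J.ctx := by
  have h := I.vars_img_ty J.der
  rwa [I.mapTyJ_spec J] at h

theorem mapTyJ_cong {n : ℕ} {J K : T.TyJ n} (h : WGAT.TyCong J K) :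
    WGAT.TyCong (I.mapTyJ J) (I.mapTyJ K) := by
  obtain ⟨σ, hσ⟩ := exists_perm_of_cong h.1 J.der K.der
  have hsK := T.scoped K.der
  have hsK' := U.scoped (I.mapTyJ K).der
  have hσ' : (Ctx.vars (I.mapTyJ K).ctx).map σ = Ctx.vars (I.mapTyJ J).ctx := by
    rw [vars_mapTyJ, vars_mapTyJ, hσ]
  obtain ⟨h1, h2⟩ := h
  rw [WGAT.ctxCong_iff_conv σ hsK.1 hσ] at h1
  rw [WGAT.rename_replace (σ := σ) hσ hsK.2] at h2
  have kσ : T.Der ⟨Ctx.rename σ K.ctx, .ty (K.type.rename σ)⟩ := Derivable.alpha K.der σ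
  have e1 : I.img kσ = ⟨Ctx.rename σ (I.mapTyJ K).ctx, .ty ((I.mapTyJ K).type.rename σ)⟩ := by
    have := I.img_alpha K.der σ
    rwa [I.mapTyJ_spec K] at this
  have c1 := I.conv_img_ctx h1 J.der kσ
  rw [e1, I.mapTyJ_spec J] at c1
  refine ⟨(WGAT.ctxCong_iff_conv σ hsK'.1 hσ').2 c1, ?_⟩
  rw [WGAT.rename_replace (σ := σ) hσ' hsK'.2]
  obtain ⟨hR, h3⟩ := I.conv_img h1 [] kσ
  obtain ⟨Γ', S', R', e2, e3, e4⟩ := I.img_tyEq h2 J.der hR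
  rw [show I.img hR = _ from e4, e1] at h3
  rw [I.mapTyJ_spec J] at e3
  simp only [Judg.mk.injEq, Body.ty.injEq] at e3 h3
  rw [e3.1, e3.2, ← h3, ← e2]
  exact I.img_der h2

theorem mapTmJ_cong {n : ℕ} {J K : T.TmJ n} (h : WGAT.TmCong J K) :
    WGAT.TmCong (I.mapTmJ J) (I.mapTmJ K) := by
  have hb := I.mapTyJ_cong h.1
  rw [I.mapTmJ_bd, I.mapTmJ_bd] at hb
  refine ⟨hb, ?_⟩
  obtain ⟨⟨h1, h2⟩, h3⟩ := h
  obtain ⟨σ, hσ⟩ := exists_perm_of_cong h1 J.bd.der K.bd.der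
  have hsK := T.scoped K.der
  have hsK' := U.scoped (I.mapTmJ K).der
  have vJ : Ctx.vars (I.mapTmJ J).ctx = Ctx.vars J.ctx := by
    have := I.vars_mapTyJ J.bd
    rwa [I.mapTmJ_bd] at this
  have vK : Ctx.vars (I.mapTmJ K).ctx = Ctx.vars K.ctx := by
    have := I.vars_mapTyJ K.bd
    rwa [I.mapTmJ_bd] at this
  have hσ' : (Ctx.vars (I.mapTmJ K).ctx).map σ = Ctx.vars (I.mapTmJ J).ctx := by
    rw [vJ, vK]; exact hσ
  have hσ : (Ctx.vars K.ctx).map σ = Ctx.vars J.ctx := hσ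
  replace h1 : T.Conv J.ctx (Ctx.rename σ K.ctx) := (WGAT.ctxCong_iff_conv σ hsK.1 hσ).1 h1
  have h2 : T.Der ⟨J.ctx, .tyEq J.type (K.type.rename σ)⟩ := by
    rw [← WGAT.rename_replace (σ := σ) hσ hsK.2.2]
    exact h2
  rw [WGAT.rename_replace (σ := σ) hσ hsK.2.1] at h3
  rw [WGAT.rename_replace (σ := σ) hσ' hsK'.2.1]
  have kσ : T.Der ⟨Ctx.rename σ K.ctx, .tm (K.term.rename σ) (K.type.rename σ)⟩ :=
    Derivable.alpha K.der σ
  have e1 : I.img kσ = ⟨Ctx.rename σ (I.mapTmJ K).ctx,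
      .tm ((I.mapTmJ K).term.rename σ) ((I.mapTmJ K).type.rename σ)⟩ := by
    have := I.img_alpha K.der σ
    rwa [I.mapTmJ_spec K] at this
  obtain ⟨kΓ, h4⟩ := I.conv_img h1 [] kσ
  have kΓ : T.Der ⟨J.ctx, .tm (K.term.rename σ) (K.type.rename σ)⟩ := kΓ
  rw [e1] at h4
  have h4 : (I.img kΓ).body =
    .tm ((I.mapTmJ K).term.rename σ) ((I.mapTmJ K).type.rename σ) := h4
  obtain ⟨Γ₁, R₁, S₁, e2, e3, e4⟩ := I.img_tyEq (tySymm_der h2) (WGAT.Der.of_tm kΓ) J.bd.der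
  obtain ⟨Γ₂, t₂, R₂, e5, e6⟩ := I.img_tm kΓ (WGAT.Der.of_tm kΓ)
  rw [e5] at h4
  rw [e3] at e6
  simp only [Judg.mk.injEq, Body.ty.injEq, Body.tm.injEq] at h4 e6
  obtain ⟨rfl, rfl⟩ := e6
  have kS : T.Der ⟨J.ctx, .tm (K.term.rename σ) J.type⟩ := WGAT.Der.tmEq_right h3
  have e7 : I.img kS = ⟨Γ₁, .tm t₂ S₁⟩ := by
    refine I.map_rule .tmConv [⟨_, tySymm_der h2⟩, ⟨_, kΓ⟩] ⟨_, kS⟩ _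
      (.tmConv J.ctx (K.term.rename σ) (K.type.rename σ) J.type) ?_
    change Rule .tmConv [I.img (tySymm_der h2), I.img kΓ] _
    rw [e2, e5]
    exact .tmConv _ _ _ _
  obtain ⟨Γ₃, s₃, t₃, R₃, e8, e9, e10⟩ := I.img_tmEq h3 J.der kS
  rw [I.mapTmJ_spec J] at e9
  rw [e7] at e10
  simp only [Judg.mk.injEq, Body.tm.injEq] at e9 e10
  rw [e9.1, e9.2.1, e9.2.2, ← h4.1, e10.2.1, ← e8]
  exact I.img_der h3

end Interp

/-! ## The category of theories and the forgetful functor -/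

theorem Rule.functional {W : Type u} {r : RuleName} {Ls Ls' : List (Judg W)}
    {K K' : Judg W} (h : Rule r Ls K) (h' : Rule r Ls' K') (e : Ls = Ls') : K = K' := by
  cases h with
  | ctxConv Γ Δ x R₁ R₂ B =>
    cases h' with
    | ctxConv Γ' Δ' x' R₁' R₂' B' =>
      simp only [List.cons.injEq, Judg.mk.injEq, Body.tyEq.injEq, and_true] at e
      obtain ⟨⟨rfl, rfl, rfl⟩, e1, rfl⟩ := e
      obtain ⟨e2, e3⟩ := List.append_inj' e1 rfl
      simp only [List.cons.injEq, Prod.mk.injEq, and_true] at e3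
      obtain rfl := e3
      rw [e2]
  | weaken y Γ Δ R B hΓ hΔ =>
    cases h' with
    | weaken _ Γ' Δ' R' B' hΓ' hΔ' =>
      simp only [List.cons.injEq, Judg.mk.injEq, Body.ty.injEq, and_true] at e
      obtain ⟨⟨rfl, rfl⟩, e1, rfl⟩ := e
      rw [List.append_cancel_right e1]
  | _ => cases h'; simp_all

namespace Interp

/-- A deduction rule that is defined on some judgements is defined on their images. -/
theorem exists_rule {T U : WGAT.{u}} (I : Interp T U) {r : RuleName} (Js : List T.Derived)
    {J : Judg T.Alph} (h : Rule r (Js.map Subtype.val) J) :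
    ∃ J', Rule r (Js.map fun K => (I.toFun K).1) J' := by
  generalize hLs : Js.map Subtype.val = Ls at h
  have one : ∀ {K : Judg T.Alph}, Ls = [K] → ∃ hK : T.Der K,
      (Js.map fun K => (I.toFun K).1) = [I.img hK] := by
    rintro K rfl
    match Js, hLs with
    | [L], hLs =>
      simp only [List.map_cons, List.map_nil, List.cons.injEq, and_true] at hLs
      subst hLs
      exact ⟨L.2, rfl⟩
  have two : ∀ {K L : Judg T.Alph}, Ls = [K, L] → ∃ (hK : T.Der K) (hL : T.Der L),
      (Js.map fun K => (I.toFun K).1) = [I.img hK, I.img hL] := by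
    rintro K L rfl
    match Js, hLs with
    | [K', L'], hLs =>
      simp only [List.map_cons, List.map_nil, List.cons.injEq, and_true] at hLs
      obtain ⟨rfl, rfl⟩ := hLs
      exact ⟨K'.2, L'.2, rfl⟩
  cases h with
  | tmRefl Γ t R =>
    obtain ⟨h1, h2⟩ := one rfl
    obtain ⟨Γ', t', R', h3, -⟩ := I.img_tm h1 (WGAT.Der.of_tm h1)
    rw [h2, h3]
    exact ⟨_, .tmRefl _ _ _⟩
  | tmSymm Γ t s R =>
    obtain ⟨h1, h2⟩ := one rfl
    obtain ⟨Γ', t', s', R', h3, -⟩ :=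
      I.img_tmEq h1 (WGAT.Der.tmEq_left h1) (WGAT.Der.tmEq_right h1)
    rw [h2, h3]
    exact ⟨_, .tmSymm _ _ _ _⟩
  | tmTrans Γ t₁ t₂ t₃ R =>
    obtain ⟨h1, h1', h2⟩ := two rfl
    obtain ⟨Γ', t', s', R', h3, -, h5⟩ :=
      I.img_tmEq h1 (WGAT.Der.tmEq_left h1) (WGAT.Der.tmEq_right h1)
    obtain ⟨Γ₁, t₁', s₁', R₁', h6, h7, -⟩ :=
      I.img_tmEq h1' (WGAT.Der.tmEq_left h1') (WGAT.Der.tmEq_right h1')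
    have h8 := h5.symm.trans h7
    simp only [Judg.mk.injEq, Body.tm.injEq] at h8
    obtain ⟨rfl, rfl, rfl⟩ := h8
    rw [h2, h3, h6]
    exact ⟨_, .tmTrans _ _ _ _ _⟩
  | tyRefl Γ R =>
    obtain ⟨h1, h2⟩ := one rfl
    obtain ⟨Γ', R', h3⟩ := I.img_ty_exists h1
    rw [h2, h3]
    exact ⟨_, .tyRefl _ _⟩
  | tySymm Γ R S =>
    obtain ⟨h1, h2⟩ := one rfl
    obtain ⟨Γ', R', S', h3, -⟩ :=
      I.img_tyEq h1 (WGAT.Der.tyEq_left h1) (WGAT.Der.tyEq_right h1)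
    rw [h2, h3]
    exact ⟨_, .tySymm _ _ _⟩
  | tyTrans Γ R₁ R₂ R₃ =>
    obtain ⟨h1, h1', h2⟩ := two rfl
    obtain ⟨Γ', R', S', h3, -, h5⟩ :=
      I.img_tyEq h1 (WGAT.Der.tyEq_left h1) (WGAT.Der.tyEq_right h1)
    obtain ⟨Γ₁, R₁', S₁', h6, h7, -⟩ :=
      I.img_tyEq h1' (WGAT.Der.tyEq_left h1') (WGAT.Der.tyEq_right h1')
    have h8 := h5.symm.trans h7
    simp only [Judg.mk.injEq, Body.ty.injEq] at h8
    obtain ⟨rfl, rfl⟩ := h8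
    rw [h2, h3, h6]
    exact ⟨_, .tyTrans _ _ _ _⟩
  | tmConv Γ t R₁ R₂ =>
    obtain ⟨h1, h1', h2⟩ := two rfl
    obtain ⟨Γ', R', S', h3, h4, -⟩ :=
      I.img_tyEq h1 (WGAT.Der.tyEq_left h1) (WGAT.Der.tyEq_right h1)
    obtain ⟨Γ₁, t', R₁', h6, h7⟩ := I.img_tm h1' (WGAT.Der.of_tm h1')
    have h8 := h4.symm.trans h7
    simp only [Judg.mk.injEq, Body.ty.injEq] at h8
    obtain ⟨rfl, rfl⟩ := h8
    rw [h2, h3, h6]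
    exact ⟨_, .tmConv _ _ _ _⟩
  | tmEqConv Γ t s R₁ R₂ =>
    obtain ⟨h1, h1', h2⟩ := two rfl
    obtain ⟨Γ', R', S', h3, h4, -⟩ :=
      I.img_tyEq h1 (WGAT.Der.tyEq_left h1) (WGAT.Der.tyEq_right h1)
    obtain ⟨Γ₁, t', s', R₁', h6, h7, -⟩ :=
      I.img_tmEq h1' (WGAT.Der.tmEq_left h1') (WGAT.Der.tmEq_right h1')
    obtain ⟨Γ₂, t₂, R₂', h9, h10⟩ := I.img_tm (WGAT.Der.tmEq_left h1') (WGAT.Der.tyEq_left h1)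
    have h8 := h4.symm.trans h10
    have h11 := h7.symm.trans h9
    simp only [Judg.mk.injEq, Body.ty.injEq, Body.tm.injEq] at h8 h11
    obtain ⟨rfl, rfl⟩ := h8
    obtain ⟨rfl, rfl, rfl⟩ := h11
    rw [h2, h3, h6]
    exact ⟨_, .tmEqConv _ _ _ _ _⟩
  | ctxConv Γ Δ x R₁ R₂ B =>
    obtain ⟨h1, h1', h2⟩ := two rfl
    obtain ⟨Γ', R', S', h3, h4, -⟩ :=
      I.img_tyEq h1 (WGAT.Der.tyEq_left h1) (WGAT.Der.tyEq_right h1)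
    obtain ⟨E', hE⟩ := I.img_ctx_append (WGAT.Der.tyEq_left h1) h4 h1'
    have h6 : I.img h1' = ⟨E' ++ (x, R') :: Γ', (I.img h1').body⟩ := by rw [← hE]
    rw [h2, h3, h6]
    exact ⟨_, .ctxConv _ _ _ _ _ _⟩
  | alpha σ J =>
    obtain ⟨h1, h2⟩ := one rfl
    rw [h2]
    exact ⟨_, .alpha σ _⟩
  | weaken y Γ Δ R B hΓ hΔ =>
    obtain ⟨h1, h1', h2⟩ := two rfl
    obtain ⟨Γ', R', h3⟩ := I.img_ty_exists h1
    have hc : ∃ Δ', (I.img h1').ctx = Δ' ++ Γ' ∧ ∀ v ∈ Ctx.vars Δ', v ∈ Ctx.vars Δ := by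
      have hlen : ∀ {Γ₀ : Ctx T.Alph} {B₀ : Body T.Alph} (h₀ : T.Der ⟨Γ₀, B₀⟩),
          Ctx.vars (I.img h₀).ctx = Ctx.vars Γ₀ := by
        intro Γ₀ B₀ h₀
        obtain ⟨S, hS, e⟩ := I.img_ctx h₀
        rw [e, I.vars_img_ty hS]
      have main : ∃ Δ', (I.img h1').ctx = Δ' ++ Γ' := by
        cases Γ with
        | nil =>
          obtain ⟨R'', h4⟩ := I.img_ty_nil h1
          have h5 := h3.symm.trans h4
          simp only [Judg.mk.injEq] at h5
          exact ⟨(I.img h1').ctx, by rw [h5.1]; exact (List.append_nil _).symm⟩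
        | cons p Γ =>
          obtain ⟨Γ₁, S', R'', h4, h5⟩ := I.img_ty_cons h1 (WGAT.Der.of_cons h1)
          obtain ⟨E', hE⟩ := I.img_ctx_append (WGAT.Der.of_cons h1) h5 h1'
          have h6 := h3.symm.trans h4
          simp only [Judg.mk.injEq] at h6
          exact ⟨E', by rw [hE, h6.1]⟩
      obtain ⟨Δ', hΔ'⟩ := main
      refine ⟨Δ', hΔ', ?_⟩
      have e1 := hlen h1'
      have e2 := hlen h1
      rw [hΔ', Ctx.vars_append, Ctx.vars_append] at e1
      rw [h3] at e2
      rw [show Ctx.vars Γ' = Ctx.vars Γ from e2] at e1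
      have e3 := List.append_cancel_right e1
      rw [e3]
      exact fun _ h => h
    obtain ⟨Δ', h4, h5⟩ := hc
    have h6 : I.img h1' = ⟨Δ' ++ Γ', (I.img h1').body⟩ := by rw [← h4]
    have s1 := (U.scoped (I.img_der h1)).1
    have s2 := (U.scoped (I.img_der h1')).1
    have v1 := I.vars_img_ty h1
    rw [h3] at s1 v1
    rw [h4] at s2
    rw [h2, h3, h6]
    refine ⟨_, .weaken y Γ' Δ' R' _ ?_ ?_⟩
    · intro hy
      have := s1.fv_subset y hy
      rw [show Ctx.vars Γ' = Ctx.vars Γ from v1] at this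
      exact hΓ (Ctx.mem_vars_fv this)
    · intro hy
      have : y ∈ Ctx.vars (Δ' ++ Γ') := by
        refine s2.fv_subset y ?_
        obtain ⟨p, hp, hv⟩ := hy
        exact ⟨p, List.mem_append_left _ hp, hv⟩
      rw [Ctx.vars_append, List.mem_append, show Ctx.vars Γ' = Ctx.vars Γ from v1] at this
      rcases this with h | h
      · exact hΔ (Ctx.mem_vars_fv (h5 y h))
      · exact hΓ (Ctx.mem_vars_fv h)

/-- The identity interpretation. -/
def refl (T : WGAT.{u}) : Interp T T where
  toFun J := J
  map_boundary _ _ h := h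
  map_rule _ _ _ _ h h' := Rule.functional h h' rfl

/-- Composition of interpretations. -/
def trans {T U S : WGAT.{u}} (I : Interp T U) (I' : Interp U S) : Interp T S where
  toFun J := I'.toFun (I.toFun J)
  map_boundary J Ks h := by
    have := I'.map_boundary (I.toFun J) (Ks.map I.toFun)
      (by simpa [Function.comp_def] using I.map_boundary J Ks h)
    simpa [Function.comp_def] using this
  map_rule r Js J J' h h' := by
    obtain ⟨K, hK⟩ := I.exists_rule Js h
    have e := I.map_rule r Js J K h hK
    refine I'.map_rule r (Js.map I.toFun) (I.toFun J) J' ?_ ?_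
    · rw [e]
      simpa [Function.comp_def] using hK
    · simpa [Function.comp_def] using h'

end Interp

namespace Interp

variable {T U S : WGAT.{u}}

theorem mapTyJ_eq (I : Interp T U) {n : ℕ} {J : T.TyJ n} {K : U.TyJ n}
    (h : I.img J.der = ⟨K.ctx, .ty K.type⟩) : I.mapTyJ J = K := by
  have h1 := (I.mapTyJ_spec J).symm.trans h
  generalize I.mapTyJ J = L at h1
  obtain ⟨Δ, R₁, hl₁, hΔ⟩ := K
  obtain ⟨Θ, R₂, hl₂, hΘ⟩ := L
  simp only [Judg.mk.injEq, Body.ty.injEq] at h1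
  obtain ⟨rfl, rfl⟩ := h1
  rfl

theorem mapTmJ_eq (I : Interp T U) {n : ℕ} {J : T.TmJ n} {K : U.TmJ n}
    (h : I.img J.der = ⟨K.ctx, .tm K.term K.type⟩) : I.mapTmJ J = K := by
  have h1 := (I.mapTmJ_spec J).symm.trans h
  generalize I.mapTmJ J = L at h1
  obtain ⟨Δ, t₁, R₁, hl₁, hΔ⟩ := K
  obtain ⟨Θ, t₂, R₂, hl₂, hΘ⟩ := L
  simp only [Judg.mk.injEq, Body.tm.injEq] at h1
  obtain ⟨rfl, rfl, rfl⟩ := h1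
  rfl

theorem mapTyJ_refl {n : ℕ} (J : T.TyJ n) : (refl T).mapTyJ J = J := mapTyJ_eq _ rfl

theorem mapTmJ_refl {n : ℕ} (J : T.TmJ n) : (refl T).mapTmJ J = J := mapTmJ_eq _ rfl

theorem mapTyJ_trans (I : Interp T U) (I' : Interp U S) {n : ℕ} (J : T.TyJ n) :
    (I.trans I').mapTyJ J = I'.mapTyJ (I.mapTyJ J) := by
  refine mapTyJ_eq _ ?_
  rw [← I'.mapTyJ_spec]
  exact I'.img_congr _ _ (I.mapTyJ_spec J)

theorem mapTmJ_trans (I : Interp T U) (I' : Interp U S) {n : ℕ} (J : T.TmJ n) :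
    (I.trans I').mapTmJ J = I'.mapTmJ (I.mapTmJ J) := by
  refine mapTmJ_eq _ ?_
  rw [← I'.mapTmJ_spec]
  exact I'.img_congr _ _ (I.mapTmJ_spec J)

/-- Two interpretations are equivalent if they send each derived type or term judgement to
congruent judgements. -/
def Equivalent (I I' : Interp T U) : Prop :=
  (∀ (n : ℕ) (J : T.TyJ n), WGAT.TyCong (I.mapTyJ J) (I'.mapTyJ J)) ∧
    ∀ (n : ℕ) (J : T.TmJ n), WGAT.TmCong (I.mapTmJ J) (I'.mapTmJ J)

end Interp

/-- Theories and equivalence classes of interpretations. -/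
instance : Category.{u} WGAT.{u} where
  Hom T U := Quot (Interp.Equivalent (T := T) (U := U))
  id T := Quot.mk _ (Interp.refl T)
  comp := Quot.map₂ Interp.trans
    (fun I I' I'' h => ⟨fun n J => by
      rw [Interp.mapTyJ_trans, Interp.mapTyJ_trans]
      exact h.1 n _, fun n J => by
      rw [Interp.mapTmJ_trans, Interp.mapTmJ_trans]
      exact h.2 n _⟩)
    (fun I I' I'' h => ⟨fun n J => by
      rw [Interp.mapTyJ_trans, Interp.mapTyJ_trans]
      exact I''.mapTyJ_cong (h.1 n J), fun n J => by
      rw [Interp.mapTmJ_trans, Interp.mapTmJ_trans]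
      exact I''.mapTmJ_cong (h.2 n J)⟩)
  id_comp f := by
    induction f using Quot.ind
    rfl
  comp_id f := by
    induction f using Quot.ind
    rfl
  assoc f g h := by
    induction f using Quot.ind
    induction g using Quot.ind
    induction h using Quot.ind
    rfl

/-- The map of type-and-term structures given by an interpretation. -/
noncomputable def Interp.toHom {T U : WGAT.{u}} (I : Interp T U) : T.toTTStr ⟶ U.toTTStr :=
  TTStr.homMk (fun _ => Quot.map I.mapTyJ fun _ _ h => I.mapTyJ_cong h)
    (fun _ => Quot.map I.mapTmJ fun _ _ h => I.mapTmJ_cong h)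
    (fun n A => by
      induction A using Quot.ind with
      | mk J => exact congrArg (Quot.mk _) (I.mapTyJ_bd J))
    (fun n A => by
      induction A using Quot.ind with
      | mk J => exact congrArg (Quot.mk _) (I.mapTmJ_bd J))

/-- The forgetful functor from theories to type-and-term structures. -/
noncomputable def forget : WGAT.{u} ⥤ TTStr.{u} where
  obj T := T.toTTStr
  map := Quot.lift Interp.toHom fun I I' h => TTStr.hom_ext
    (fun n A => by
      induction A using Quot.ind with
      | mk J => exact Quot.sound (h.1 n J))
    (fun n A => by
      induction A using Quot.ind with
      | mk J => exact Quot.sound (h.2 n J))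
  map_id T := TTStr.hom_ext
    (fun n A => by
      induction A using Quot.ind with
      | mk J => exact congrArg (Quot.mk _) (Interp.mapTyJ_refl J))
    (fun n A => by
      induction A using Quot.ind with
      | mk J => exact congrArg (Quot.mk _) (Interp.mapTmJ_refl J))
  map_comp f g := by
    induction f using Quot.ind with
    | mk I =>
    induction g using Quot.ind with
    | mk I' =>
    exact TTStr.hom_ext
      (fun n A => by
        induction A using Quot.ind with
        | mk J => exact congrArg (Quot.mk _) (Interp.mapTyJ_trans I I' J))
      (fun n A => by
        induction A using Quot.ind with
        | mk J => exact congrArg (Quot.mk _) (Interp.mapTmJ_trans I I' J))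

/-! ## Free theories and the weakening monad -/

section Free

variable (X : TTStr.{u})

/-- The alphabet of the free theory on `X`: type-elements and term-elements of `X`. -/
abbrev FreeAlph : Type u := (Σ n, X.Ty n) ⊕ (Σ n, X.Tm n)

/-- The context `x_1 : A_1, …, x_n : A_n(x_1, …, x_{n-1})`, for a type-element `A` of degree `n + 1`
with successive boundaries `A_n, …, A_1`; the variable `x_{i+1}` is `i`. -/
def freeCtx : ∀ {n : ℕ}, X.Ty n → Ctx (FreeAlph X)
  | 0, _ => []
  | n + 1, A =>
    (n, .appVars (Sum.inl ⟨n, X.bd A⟩) (freeCtx (X.bd A)).vars.reverse) :: freeCtx (X.bd A)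

/-- The basic judgement `x_1 : A_1, … ⊢ A(x_1, …, x_n) type`. -/
def freeTy {n : ℕ} (A : X.Ty n) : Judg (FreeAlph X) :=
  ⟨freeCtx X A, .ty (.appVars (Sum.inl ⟨n, A⟩) (freeCtx X A).vars.reverse)⟩

/-- The basic judgement `x_1 : A_1, … ⊢ a(x_1, …, x_n) : A(x_1, …, x_n)`, where `A` is the boundary
of `a`. -/
def freeTm {n : ℕ} (a : X.Tm n) : Judg (FreeAlph X) :=
  ⟨freeCtx X (X.bdTm a), .tm (.appVars (Sum.inr ⟨n, a⟩) (freeCtx X (X.bdTm a)).vars.reverse)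
    (.appVars (Sum.inl ⟨n, X.bdTm a⟩) (freeCtx X (X.bdTm a)).vars.reverse)⟩

/-- The basic judgements of the free theory. -/
def freeBasics : Set (Judg (FreeAlph X)) :=
  {J | (∃ (n : ℕ) (A : X.Ty n), J = freeTy X A) ∨ ∃ (n : ℕ) (a : X.Tm n), J = freeTm X a}

theorem vars_freeCtx : ∀ {n : ℕ} (A : X.Ty n),
    Ctx.vars (freeCtx X A) = (List.range n).reverse
  | 0, _ => rfl
  | n + 1, A => by
    have ih := vars_freeCtx (X.bd A)
    change n :: Ctx.vars (freeCtx X (X.bd A)) = _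
    rw [ih, List.range_succ]
    simp

theorem length_freeCtx {n : ℕ} (A : X.Ty n) : (freeCtx X A).length = n := by
  have := congrArg List.length (vars_freeCtx X A)
  simpa [Ctx.vars] using this

theorem freeTy_derivable : ∀ {n : ℕ} (A : X.Ty n), Derivable (freeBasics X) (freeTy X A)
  | 0, A => .basic _ (Or.inl ⟨0, A, rfl⟩) fun K hK => by cases hK
  | n + 1, A => .basic _ (Or.inl ⟨n + 1, A, rfl⟩) fun K hK => by
    obtain rfl : K = freeTy X (X.bd A) := List.mem_singleton.1 hK
    exact freeTy_derivable (X.bd A)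

theorem freeTm_derivable {n : ℕ} (a : X.Tm n) : Derivable (freeBasics X) (freeTm X a) :=
  .basic _ (Or.inr ⟨n, a, rfl⟩) fun K hK => by
    obtain rfl : K = freeTy X (X.bdTm a) := List.mem_singleton.1 hK
    exact freeTy_derivable X (X.bdTm a)

/-- The free theory on a type-and-term structure. -/
def free : WGAT.{u} where
  TyConst := Σ n, X.Ty n
  TmConst := Σ n, X.Tm n
  basics := freeBasics X
  isJudgement := by
    have key : ∀ {n : ℕ} (A : X.Ty n), (Ctx.vars (freeCtx X A)).Nodup := fun A => by
      rw [vars_freeCtx]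
      exact List.nodup_reverse.2 List.nodup_range
    rintro J (⟨n, A, rfl⟩ | ⟨n, a, rfl⟩)
    · exact key A
    · exact key _
  tyIntro := by
    rintro ⟨n, A⟩
    refine ⟨freeTy X A, ⟨Or.inl ⟨n, A, rfl⟩, _, rfl⟩, ?_⟩
    rintro J ⟨⟨m, B, rfl⟩ | ⟨m, b, rfl⟩, Γ, h⟩
    · simp only [freeTy, Judg.mk.injEq, Body.ty.injEq, Exp.appVars, Exp.app.injEq,
        Sum.inl.injEq, Sigma.mk.injEq] at h
      obtain ⟨-, ⟨rfl, h⟩, -⟩ := h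
      rw [eq_of_heq h]
    · simp [freeTm] at h
  tmIntro := by
    rintro ⟨n, a⟩
    refine ⟨freeTm X a, ⟨Or.inr ⟨n, a, rfl⟩, _, _, rfl⟩, ?_⟩
    rintro J ⟨⟨m, B, rfl⟩ | ⟨m, b, rfl⟩, Γ, R, h⟩
    · simp [freeTy] at h
    · simp only [freeTm, Judg.mk.injEq, Body.tm.injEq, Exp.appVars, Exp.app.injEq,
        Sum.inr.injEq, Sigma.mk.injEq] at h
      obtain ⟨-, ⟨⟨rfl, h⟩, -⟩, -⟩ := h
      rw [eq_of_heq h]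
  cases_basics := by
    rintro J (⟨n, A, rfl⟩ | ⟨n, a, rfl⟩)
    · exact Or.inl ⟨⟨n, A⟩, _, rfl⟩
    · exact Or.inr (Or.inl ⟨⟨n, a⟩, _, _, rfl⟩)
  derivable_basics := by
    rintro J (⟨n, A, rfl⟩ | ⟨n, a, rfl⟩)
    · exact freeTy_derivable X A
    · exact freeTm_derivable X a

/-- The two sides of a body that is an equality coincide. -/
def Body.IsRefl {W : Type u} : Body W → Prop
  | .tyEq R S => R = S
  | .tmEq t s _ => t = s
  | _ => True

/-- All derivable equalities of a free theory are reflexive; in particular its conversion rules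
have no effect. -/
theorem free_isRefl {J : Judg (free X).Alph} (hJ : (free X).Der J) : J.body.IsRefl := by
  induction hJ with
  | basic J hJ h ih =>
    rcases hJ with ⟨n, A, rfl⟩ | ⟨n, a, rfl⟩
    · trivial
    · trivial
  | rule r Js J hr h ih =>
    cases hr with
    | alpha σ J =>
      have h1 := ih J (by simp)
      obtain ⟨Γ, B⟩ := J
      cases B with
      | tyEq R S => exact congrArg (Exp.rename σ) h1
      | tmEq t s R => exact congrArg (Exp.rename σ) h1
      | _ => trivial
    | _ => simp_all [Body.IsRefl]

/-- The type judgement of the free theory given by a type-element. -/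
def freeTyJ {n : ℕ} (A : X.Ty n) : (free X).TyJ n :=
  ⟨freeCtx X A, _, length_freeCtx X A, freeTy_derivable X A⟩

/-- The term judgement of the free theory given by a term-element. -/
def freeTmJ {n : ℕ} (a : X.Tm n) : (free X).TmJ n :=
  ⟨freeCtx X (X.bdTm a), _, _, length_freeCtx X (X.bdTm a), freeTm_derivable X a⟩

/-- The map from `X` to the free theory that sends each element to the class of its basic
judgement. -/
noncomputable def freeUnit : X ⟶ forget.obj (free X) :=
  TTStr.homMk (fun _ A => WGAT.tyClass (freeTyJ X A)) (fun _ a => WGAT.tmClass (freeTmJ X a))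
    (fun _ _ => rfl) (fun _ _ => rfl)

end Free

/-- The universal property of the free theories. -/
def FreeUniversal : Prop :=
  ∀ (X : TTStr.{u}) (T : WGAT.{u}) (f : X ⟶ forget.obj T),
    ∃! g : free X ⟶ T, freeUnit X ≫ forget.map g = f

namespace FreeUniversal

variable (h : FreeUniversal.{u})

/-- The bijection of hom-sets given by composition with `freeUnit`. -/
noncomputable def homEquiv (X : TTStr.{u}) (T : WGAT.{u}) :
    (free X ⟶ T) ≃ (X ⟶ forget.obj T) :=
  Equiv.ofBijective (fun g => freeUnit X ≫ forget.map g)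
    ((Function.bijective_iff_existsUnique _).2 fun f => h X T f)

theorem homEquiv_comp (X : TTStr.{u}) (T U : WGAT.{u}) (g : T ⟶ U) (k : free X ⟶ T) :
    homEquiv h X U (k ≫ g) = homEquiv h X T k ≫ forget.map g := by
  change freeUnit X ≫ forget.map (k ≫ g) = (freeUnit X ≫ forget.map k) ≫ forget.map g
  rw [Functor.map_comp, Category.assoc]

/-- The free functor, with value `free X` at `X`. -/
noncomputable def freeFunctor : TTStr.{u} ⥤ WGAT.{u} :=
  Adjunction.leftAdjointOfEquiv (homEquiv h) (homEquiv_comp h)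

/-- The free-forgetful adjunction, with unit `freeUnit`. -/
noncomputable def adjunction : freeFunctor h ⊣ forget.{u} :=
  Adjunction.adjunctionOfEquivLeft (homEquiv h) (homEquiv_comp h)

/-- The weakening monad: the monad induced by the free-forgetful adjunction. -/
noncomputable def weakeningMonad : Monad TTStr.{u} := (adjunction h).toMonad

end FreeUniversal

/-! ## Min-heaps -/

/-- Min-heaps of size `n`. -/
@[ext]
structure Heap (n : ℕ) : Type where
  toFun : Fin (n + 1) → Fin (n + 1)
  map_zero : toFun 0 = 0
  map_lt : ∀ i, i ≠ 0 → toFun i < i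

namespace Heap

/-- The depth of `i ≠ 0` is the number of elements of `{φ(i), φ(φ(i)), …}`. -/
noncomputable def depth {n : ℕ} (φ : Heap n) (i : Fin (n + 1)) : ℕ :=
  Set.ncard {j | ∃ k : ℕ, j = φ.toFun^[k + 1] i}

/-- The partial order of a heap, as a relation on natural numbers that holds only between elements
of `{1, …, n}`: `i` is an iterated image of `j`. -/
def Le {n : ℕ} (φ : Heap n) (i j : ℕ) : Prop :=
  ∃ i' j' : Fin (n + 1), i' ≠ 0 ∧ (i' : ℕ) = i ∧ (j' : ℕ) = j ∧ ∃ k : ℕ, i' = φ.toFun^[k] j'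

theorem iterate_zero {n : ℕ} (φ : Heap n) (k : ℕ) : φ.toFun^[k] 0 = 0 :=
  Function.iterate_fixed φ.map_zero k

theorem map_le {n : ℕ} (φ : Heap n) (i : Fin (n + 1)) : φ.toFun i ≤ i := by
  by_cases h : i = 0
  · rw [h, φ.map_zero]
  · exact (φ.map_lt i h).le

theorem iterate_le {n : ℕ} (φ : Heap n) (i : Fin (n + 1)) (k : ℕ) : φ.toFun^[k] i ≤ i := by
  induction k with
  | zero => exact le_refl _
  | succ k ih =>
    rw [Function.iterate_succ_apply']
    exact (φ.map_le _).trans ih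

theorem depth_set {n : ℕ} (φ : Heap n) (i : Fin (n + 1)) :
    {j | ∃ k : ℕ, j = φ.toFun^[k + 1] i} =
      insert (φ.toFun i) {j | ∃ k : ℕ, j = φ.toFun^[k + 1] (φ.toFun i)} := by
  ext j
  simp only [Set.mem_ofPred_eq, Set.mem_insert_iff]
  constructor
  · rintro ⟨k, rfl⟩
    cases k with
    | zero => exact Or.inl rfl
    | succ k => exact Or.inr ⟨k, Function.iterate_succ_apply _ _ _⟩
  · rintro (rfl | ⟨k, rfl⟩)
    · exact ⟨0, rfl⟩
    · exact ⟨k + 1, (Function.iterate_succ_apply _ _ _).symm⟩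

theorem depth_eq_one {n : ℕ} (φ : Heap n) {i : Fin (n + 1)} (h : φ.toFun i = 0) :
    φ.depth i = 1 := by
  have : {j | ∃ k : ℕ, j = φ.toFun^[k + 1] i} = {0} := by
    ext j
    simp only [Set.mem_ofPred_eq, Set.mem_singleton_iff]
    constructor
    · rintro ⟨k, rfl⟩
      rw [Function.iterate_succ_apply, h, iterate_zero]
    · rintro rfl
      exact ⟨0, h.symm⟩
  rw [depth, this, Set.ncard_singleton]

theorem depth_eq_succ {n : ℕ} (φ : Heap n) {i : Fin (n + 1)} (h : φ.toFun i ≠ 0) :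
    φ.depth i = φ.depth (φ.toFun i) + 1 := by
  rw [depth, depth_set, Set.ncard_insert_of_notMem]
  · rfl
  · rintro ⟨k, hk⟩
    rw [Function.iterate_succ_apply] at hk
    have h1 := φ.iterate_le (φ.toFun (φ.toFun i)) k
    rw [← hk] at h1
    exact absurd (φ.map_lt _ h) (not_lt.2 h1)

theorem depth_pos {n : ℕ} (φ : Heap n) (i : Fin (n + 1)) : 0 < φ.depth i := by
  by_cases h : φ.toFun i = 0
  · rw [φ.depth_eq_one h]; exact one_pos
  · rw [φ.depth_eq_succ h]; exact Nat.succ_pos _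

/-- The restriction of a heap of size `n + 1` to size `n`. -/
def bd {n : ℕ} (φ : Heap (n + 1)) : Heap n where
  toFun i := (φ.toFun i.castSucc).castLT
    (lt_of_le_of_lt (Fin.le_def.1 (φ.map_le i.castSucc)) i.isLt)
  map_zero := by
    apply Fin.ext
    simp [φ.map_zero]
  map_lt i hi := by
    have := φ.map_lt i.castSucc (by simpa using hi)
    simpa [Fin.lt_def] using this

theorem bd_toFun {n : ℕ} (φ : Heap (n + 1)) (i : Fin (n + 1)) :
    (φ.bd.toFun i).castSucc = φ.toFun i.castSucc := rfl

theorem bd_iterate {n : ℕ} (φ : Heap (n + 1)) (i : Fin (n + 1)) (k : ℕ) :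
    (φ.bd.toFun^[k] i).castSucc = φ.toFun^[k] i.castSucc := by
  induction k with
  | zero => rfl
  | succ k ih => rw [Function.iterate_succ_apply', Function.iterate_succ_apply', bd_toFun, ih]

theorem bd_depth {n : ℕ} (φ : Heap (n + 1)) (i : Fin (n + 1)) :
    φ.bd.depth i = φ.depth i.castSucc := by
  rw [depth, depth, ← Set.ncard_image_of_injective _ (Fin.castSucc_injective (n + 1))]
  congr 1
  ext j
  simp only [Set.mem_image, Set.mem_ofPred_eq]
  constructor
  · rintro ⟨_, ⟨k, rfl⟩, rfl⟩
    exact ⟨k, bd_iterate φ i (k + 1)⟩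
  · rintro ⟨k, rfl⟩
    exact ⟨_, ⟨k, rfl⟩, bd_iterate φ i (k + 1)⟩

/-- The type-and-term structure `[φ]`: its type-elements of degree `m + 1` are the `i ∈ {1, …, n}`
of depth `m + 1`, with boundary `φ(i)`, and it has no term-elements. -/
noncomputable def shape {n : ℕ} (φ : Heap n) : TTStr.{u} :=
  TTStr.ofData (fun m => ULift.{u} {i : Fin (n + 1) // i ≠ 0 ∧ φ.depth i = m + 1})
    (fun _ => PEmpty.{u + 1})
    (fun m i => ⟨φ.toFun i.down.1, by
      have h0 : φ.toFun i.down.1 ≠ 0 := fun h => by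
        have := i.down.2.2
        rw [φ.depth_eq_one h] at this
        omega
      refine ⟨h0, ?_⟩
      have := i.down.2.2
      rw [φ.depth_eq_succ h0] at this
      omega⟩)
    (fun _ a => a.elim)

/-- The type-element `i` of `[φ]`. -/
def shapeElt {n : ℕ} (φ : Heap n) (i : Fin (n + 1)) (hi : i ≠ 0) {m : ℕ}
    (hm : φ.depth i = m + 1) : (shape.{u} φ).Ty m :=
  ULift.up ⟨i, hi, hm⟩

/-- The inclusion of `[∂φ]` in `[φ]`. -/
noncomputable def incl {n : ℕ} (φ : Heap (n + 1)) : shape.{u} φ.bd ⟶ shape.{u} φ :=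
  TTStr.homMk
    (fun _ i => ULift.up ⟨i.down.1.castSucc, by simpa using i.down.2.1, by
      rw [← bd_depth]; exact i.down.2.2⟩)
    (fun _ a => PEmpty.elim a)
    (fun _ _ => rfl)
    (fun _ a => PEmpty.elim a)

end Heap

/-! ## The endofunctor given by decorated heaps -/

section Wk

/-- Pairs of a heap `φ` of size `n + 1` and a map `h : [φ] ⟶ X`. -/
def WkTy (X : TTStr.{u}) (n : ℕ) : Type u := Σ φ : Heap (n + 1), (Heap.shape.{u} φ ⟶ X)

variable {X : TTStr.{u}}

namespace WkTy

/-- The type-element `h(i)` of `X`, together with its degree: `⟨d, A⟩` is a type-element `A` of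
degree `d + 1`, which is the depth of `i`. -/
noncomputable def label {n : ℕ} (w : WkTy X n) (i : Fin (n + 2)) (hi : i ≠ 0) : Σ d, X.Ty d :=
  ⟨w.1.depth i - 1,
    TTStr.mapTy w.2 (w.1.shapeElt i hi (Nat.succ_pred_eq_of_pos (w.1.depth_pos i)).symm)⟩

/-- The boundary `(∂φ, ∂h)`. -/
noncomputable def bd {n : ℕ} (w : WkTy X (n + 1)) : WkTy X n := ⟨w.1.bd, w.1.incl ≫ w.2⟩

end WkTy

/-- The label `h(n + 1)` of the greatest element of a heap of size `n + 1`. -/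
noncomputable def WkTy.top {n : ℕ} (w : WkTy X n) : Σ d, X.Ty d :=
  w.label (Fin.last (n + 1)) (Fin.last_pos.ne')

/-- Pairs of `w = (φ, h)` and a term-element of `X` with boundary `h(n + 1)`. -/
def WkTm (X : TTStr.{u}) (n : ℕ) : Type u :=
  Σ w : WkTy X n, {a : X.Tm w.top.1 // X.bdTm a = w.top.2}

/-- The underlying term-element of `X`, together with its degree. -/
noncomputable def WkTm.term {n : ℕ} (t : WkTm X n) : Σ d, X.Tm d := ⟨t.1.top.1, t.2.1⟩

/-- The type-and-term structure of heaps decorated by a type-and-term structure. -/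
noncomputable def wkObj (X : TTStr.{u}) : TTStr.{u} :=
  TTStr.ofData (WkTy X) (WkTm X) (fun _ => WkTy.bd) (fun _ => Sigma.fst)

/-- The endofunctor of decorated heaps, acting on maps by composition. -/
noncomputable def wk : TTStr.{u} ⥤ TTStr.{u} where
  obj := wkObj
  map {X Y} f := TTStr.homMk (X := wkObj X) (Y := wkObj Y)
    (fun n (w : WkTy X n) => (⟨w.1, w.2 ≫ f⟩ : WkTy Y n))
    (fun n (t : WkTm X n) => (⟨⟨t.1.1, t.1.2 ≫ f⟩, TTStr.mapTm f t.2.1, 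
      (TTStr.mapTy_bdTm f t.2.1).symm.trans (congrArg (TTStr.mapTy f) t.2.2)⟩ : WkTm Y n))
    (fun _ _ => rfl) (fun _ _ => rfl)
  map_id _ := TTStr.hom_ext (fun _ _ => rfl) (fun _ _ => rfl)
  map_comp _ _ := TTStr.hom_ext (fun _ _ => rfl) (fun _ _ => rfl)

/-- An element of `wk.obj X`, as a decorated heap. -/
def asWkTy {n : ℕ} (w : (wk.obj X).Ty n) : WkTy X n := w

/-- A term-element of `wk.obj X`, as a decorated heap with a term-element. -/
def asWkTm {n : ℕ} (t : (wk.obj X).Tm n) : WkTm X n := t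

namespace WkTy

/-- The variables `x_{j_1}, …, x_{j_{k-1}}`, where `k` is the depth of `i` and
`j_l = φ^{k - l}(i)`; the variable `x_i` is `i`. -/
noncomputable def args {n : ℕ} (w : WkTy X n) (i : Fin (n + 2)) : List ℕ :=
  (List.range (w.1.depth i - 1)).map fun l => (w.1.toFun^[w.1.depth i - 1 - l] i : Fin (n + 2)).val

/-- The type `T_i = h(i)(x_{j_1}, …, x_{j_{k-1}})`. -/
noncomputable def typeExp {n : ℕ} (w : WkTy X n) (i : Fin (n + 2)) (hi : i ≠ 0) :
    Exp (free X).Alph :=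
  .appVars (Sum.inl (w.label i hi)) (w.args i)

/-- The context `x_1 : T_1, …, x_n : T_n`. -/
noncomputable def ctx {n : ℕ} (w : WkTy X n) : Ctx (free X).Alph :=
  (List.finRange n).reverse.map fun (i : Fin n) =>
    ((i : ℕ) + 1, w.typeExp (Fin.castSucc (Fin.succ i)) (Fin.castSucc_ne_zero_of_lt (Fin.succ_pos i)))

/-- The type `T_{n + 1}`. -/
noncomputable def topExp {n : ℕ} (w : WkTy X n) : Exp (free X).Alph :=
  w.typeExp (Fin.last (n + 1)) (Fin.last_pos.ne')

theorem length_ctx {n : ℕ} (w : WkTy X n) : w.ctx.length = n := by simp [ctx]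

end WkTy

/-- The term `a(x_{j_1}, …, x_{j_{k-1}})`, whose arguments are those of `T_{n + 1}`. -/
noncomputable def WkTm.termExp {n : ℕ} (t : WkTm X n) : Exp (free X).Alph :=
  .appVars (Sum.inr t.term) (t.1.args (Fin.last (n + 1)))

end Wk

/-- A natural isomorphism `θ` from decorated heaps to the weakening monad identifies `(φ, h)` with
the class of the judgement `x_1 : T_1, …, x_n : T_n ⊢ T_{n + 1} type`, and a term-element `a` with
the class of `x_1 : T_1, …, x_n : T_n ⊢ a(x_{j_1}, …, x_{j_{k-1}}) : T_{n + 1}`. -/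
def SendsToJudgements (h : FreeUniversal.{u})
    (θ : wk.{u} ≅ (FreeUniversal.weakeningMonad h).toFunctor) : Prop :=
  ∀ (X : TTStr.{u}) (n : ℕ),
    (∀ w : WkTy X n, ∃ d : (free X).Der ⟨w.ctx, .ty w.topExp⟩,
      TTStr.mapTy (θ.hom.app X) (n := n) w =
        WGAT.tyClass (T := free X) ⟨w.ctx, w.topExp, w.length_ctx, d⟩) ∧
    ∀ t : WkTm X n, ∃ d : (free X).Der ⟨t.1.ctx, .tm t.termExp t.1.topExp⟩,
      TTStr.mapTm (θ.hom.app X) (n := n) t =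
        WGAT.tmClass (T := free X) ⟨t.1.ctx, t.termExp, t.1.topExp, t.1.length_ctx, d⟩

/-- The multiplication of a monad, transported along an isomorphism of its underlying functor. -/
def transportedMul {C : Type*} [Category* C] (M : Monad C) {F : C ⥤ C} (θ : F ≅ M.toFunctor)
    (X : C) : F.obj (F.obj X) ⟶ F.obj X :=
  F.map (θ.hom.app X) ≫ θ.hom.app (M.obj X) ≫ M.μ.app X ≫ θ.inv.app X

end TypeDep

open TypeDep

namespace TypeDep

namespace WGAT

variable {T : WGAT.{u}}

/-! ## Congruence is an equivalence relation -/

/-! The multiplication of the monad induced by `G ⊣ V` is `V` applied to the counit at `GX`. A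
constant of `G(VGX)` is the class of a judgement of `GX`, and the counit unfolds it. The theorem
computes this unfolding syntactically and reads the result as a heap.

The first ingredient is a normal form for `GX`. Every derivable equality of a free theory is
reflexive (`free_isRefl`), so the conversion rules do nothing. By induction on derivations, each
type has the form `A(ys)`, where `ys` is empty for `A` of degree 1 and otherwise ends with a
variable declared of type `(∂A)(zs)`, with `zs` the other arguments (`free_ok`). Conversely such
judgements are derivable (`TyOK.der`, `TyOK.der_tm`): the declarations of `ys` alone form a renamed
copy of the basic context of `A` (`CtxOK.filter_eq`), and the remaining declarations come from
weakening. Congruence of judgements is derivable equality up to a permutation of variables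
(`tyCong_iff`, `tmCong_iff`), so in a free theory, once the context variables agree, congruence is
equality of syntax (`free_tyClass_eq`, `free_tmClass_eq`).

The second ingredient is freeness. A choice of judgements of `T` for the elements of `X` that
strictly preserves boundaries (`Model`) extends to an interpretation, because expressions of `GX`
are a constant applied to variables and can be translated by renaming. Such a choice exists for
every map `X ⟶ VT`, since representatives can be lifted along boundaries one degree at a time
(`WGAT.TyJ.exists_lift`). Interpretations that agree on basic judgements agree everywhere
(`Interp.jEq_img_free`). This gives `freeUniversal`.

The third ingredient matches heaps with normal forms over the variables `1, …, n`: the parent of `i`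
is the last argument of `T_i`, or `0` if there are no arguments, and the label of `i` is its head
constant (`WkTy.ext_texp`, `WkTy.exists_of_ctxOK`). Hence the natural isomorphism `theta`.

For the multiplication, the counit at `GX` is given by the model `evalModel`, which interprets a
class by the judgement of its heap (`counit_app`). For `(ψ, (φ, h))`, the `i`-th type is `(φ_i,
h_i)` applied to the ancestors of `i` in `ψ`. Evaluation turns it into `h_i(#i)` applied to those
ancestors whose depth is an ancestor of `#i` in `φ_i` (`exp_innerTy`, `mul_spec`). This is the
formula for `ψ ⋆ h`. Since the ancestor of depth `m` stands at position `m - 1` of the argument list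
(`WkTy.depth_of_getElem`), it is also the formula for `ψ ⋆ φ` (`le_mul_iff`). Comparing head
constants of terms settles the term-elements (`term_mul`). -/

theorem Der.tyRefl {Γ : Ctx T.Alph} {R : Exp T.Alph} (h : T.Der ⟨Γ, .ty R⟩) :
    T.Der ⟨Γ, .tyEq R R⟩ :=
  .rule _ _ _ (.tyRefl Γ R) (by simpa using h)

theorem Der.tySymm {Γ : Ctx T.Alph} {R S : Exp T.Alph} (h : T.Der ⟨Γ, .tyEq R S⟩) :
    T.Der ⟨Γ, .tyEq S R⟩ :=
  .rule _ _ _ (.tySymm Γ R S) (by simpa using h)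

theorem Der.tyTrans {Γ : Ctx T.Alph} {R S S' : Exp T.Alph} (h : T.Der ⟨Γ, .tyEq R S⟩)
    (h' : T.Der ⟨Γ, .tyEq S S'⟩) : T.Der ⟨Γ, .tyEq R S'⟩ :=
  .rule _ _ _ (.tyTrans Γ R S S') (by simpa using ⟨h, h'⟩)

theorem Der.tmRefl {Γ : Ctx T.Alph} {t R : Exp T.Alph} (h : T.Der ⟨Γ, .tm t R⟩) :
    T.Der ⟨Γ, .tmEq t t R⟩ :=
  .rule _ _ _ (.tmRefl Γ t R) (by simpa using h)

theorem Der.tmSymm {Γ : Ctx T.Alph} {t s R : Exp T.Alph} (h : T.Der ⟨Γ, .tmEq t s R⟩) :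
    T.Der ⟨Γ, .tmEq s t R⟩ :=
  .rule _ _ _ (.tmSymm Γ t s R) (by simpa using h)

theorem Der.tmTrans {Γ : Ctx T.Alph} {t s r R : Exp T.Alph} (h : T.Der ⟨Γ, .tmEq t s R⟩)
    (h' : T.Der ⟨Γ, .tmEq s r R⟩) : T.Der ⟨Γ, .tmEq t r R⟩ :=
  .rule _ _ _ (.tmTrans Γ t s r R) (by simpa using ⟨h, h'⟩)

theorem Der.tmConv {Γ : Ctx T.Alph} {t R S : Exp T.Alph} (h : T.Der ⟨Γ, .tyEq R S⟩)
    (h' : T.Der ⟨Γ, .tm t R⟩) : T.Der ⟨Γ, .tm t S⟩ :=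
  .rule _ _ _ (.tmConv Γ t R S) (by simpa using ⟨h, h'⟩)

theorem Der.tmEqConv {Γ : Ctx T.Alph} {t s R S : Exp T.Alph} (h : T.Der ⟨Γ, .tyEq R S⟩)
    (h' : T.Der ⟨Γ, .tmEq t s R⟩) : T.Der ⟨Γ, .tmEq t s S⟩ :=
  .rule _ _ _ (.tmEqConv Γ t s R S) (by simpa using ⟨h, h'⟩)

/-- Derivable contexts are scoped, so every variable that occurs is declared. Freshness therefore
needs to be checked on declared variables only. -/
theorem Der.weaken {Γ Δ : Ctx T.Alph} {y : ℕ} {R : Exp T.Alph} {B : Body T.Alph}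
    (hR : T.Der ⟨Γ, .ty R⟩) (hB : T.Der ⟨Δ ++ Γ, B⟩) (hy : y ∉ Ctx.vars (Δ ++ Γ)) :
    T.Der ⟨Δ ++ (y, R) :: Γ, B⟩ := by
  have hs := (T.scoped hB).1
  refine .rule _ _ _ (.weaken y Γ Δ R B (fun h => hy ?_) (fun h => hy ?_))
    (by simpa using ⟨hR, hB⟩)
  · exact hs.fv_subset y (by obtain ⟨p, hp, h⟩ := h; exact ⟨p, List.mem_append_right _ hp, h⟩)
  · exact hs.fv_subset y (by obtain ⟨p, hp, h⟩ := h; exact ⟨p, List.mem_append_left _ hp, h⟩)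

/-- Iterated context conversion, one declaration at a time; `Interp.conv_img` carries out this
iteration and is used here for the identity interpretation. -/
theorem Conv.der {Γ Δ : Ctx T.Alph} (hc : T.Conv Γ Δ) {B : Body T.Alph} (h : T.Der ⟨Δ, B⟩) :
    T.Der ⟨Γ, B⟩ :=
  ((Interp.refl T).conv_img hc [] h).1

theorem Conv.vars_eq : ∀ {Γ Δ : Ctx T.Alph}, T.Conv Γ Δ → Ctx.vars Γ = Ctx.vars Δ
  | [], [], _ => rfl
  | [], _ :: _, h => h.elim
  | _ :: _, [], h => h.elim
  | (x, S) :: Γ, (y, R) :: Δ, h => by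
    simp only [Ctx.vars, List.map_cons, List.cons.injEq]
    exact ⟨h.1, Conv.vars_eq h.2.1⟩

theorem Conv.symm : ∀ {Γ Δ : Ctx T.Alph}, T.Conv Γ Δ → T.Conv Δ Γ
  | [], [], _ => trivial
  | [], _ :: _, h => h.elim
  | _ :: _, [], h => h.elim
  | (_, _) :: _, (_, _) :: _, h =>
    -- The relation records each equality of types over the left-hand context, so reversing it
    -- requires moving the equality to the other context.
    ⟨h.1.symm, Conv.symm h.2.1, (Conv.symm h.2.1).der (Der.tySymm h.2.2)⟩

theorem Conv.trans : ∀ {Γ Δ Θ : Ctx T.Alph}, T.Conv Γ Δ → T.Conv Δ Θ → T.Conv Γ Θ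
  | [], [], [], _, _ => trivial
  | [], _ :: _, _, h, _ => h.elim
  | _ :: _, [], _, h, _ => h.elim
  | _, [], _ :: _, _, h => h.elim
  | _, _ :: _, [], _, h => h.elim
  | (_, _) :: _, (_, _) :: _, (_, _) :: _, h, h' =>
    ⟨h.1.trans h'.1, Conv.trans h.2.1 h'.2.1, Der.tyTrans h.2.2 (Conv.der h.2.1 h'.2.2)⟩

theorem Conv.refl : ∀ {Γ : Ctx T.Alph} {B : Body T.Alph}, T.Der ⟨Γ, B⟩ → T.Conv Γ Γ
  | [], _, _ => trivial
  | (_, _) :: _, _, h => ⟨rfl, Conv.refl (Der.of_cons h), Der.tyRefl (Der.of_cons h)⟩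

theorem Conv.rename (σ : Equiv.Perm ℕ) : ∀ {Γ Δ : Ctx T.Alph}, T.Conv Γ Δ →
    T.Conv (Ctx.rename σ Γ) (Ctx.rename σ Δ)
  | [], [], _ => trivial
  | [], _ :: _, h => h.elim
  | _ :: _, [], h => h.elim
  | (_, _) :: _, (_, _) :: _, h =>
    ⟨congrArg σ h.1, Conv.rename σ h.2.1, Derivable.alpha h.2.2 σ⟩

/-! ### Derivable equality of judgements, strictly and up to renaming. -/

/-- Derivable equality of bodies over a given context; no condition on equalities. -/
def BodyEq (T : WGAT.{u}) (Γ : Ctx T.Alph) : Body T.Alph → Body T.Alph → Prop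
  | .ty R, .ty R' => T.Der ⟨Γ, .tyEq R R'⟩
  | .tm t R, .tm t' R' => T.Der ⟨Γ, .tyEq R R'⟩ ∧ T.Der ⟨Γ, .tmEq t t' R⟩
  | .tyEq _ _, .tyEq _ _ => True
  | .tmEq _ _ _, .tmEq _ _ _ => True
  | _, _ => False

theorem BodyEq.map {Γ Δ : Ctx T.Alph} (h : ∀ C, T.Der ⟨Γ, C⟩ → T.Der ⟨Δ, C⟩) {B B' : Body T.Alph}
    (hB : T.BodyEq Γ B B') : T.BodyEq Δ B B' := by
  cases B <;> cases B' <;> simp only [BodyEq] at hB ⊢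
  · exact h _ hB
  · exact ⟨h _ hB.1, h _ hB.2⟩

theorem BodyEq.refl {Γ : Ctx T.Alph} {B : Body T.Alph} (h : T.Der ⟨Γ, B⟩) : T.BodyEq Γ B B := by
  cases B with
  | ty R => exact Der.tyRefl h
  | tm t R => exact ⟨Der.tyRefl (Der.of_tm h), Der.tmRefl h⟩
  | _ => trivial

theorem BodyEq.symm {Γ : Ctx T.Alph} {B B' : Body T.Alph} (h : T.BodyEq Γ B B') :
    T.BodyEq Γ B' B := by
  cases B <;> cases B' <;> simp only [BodyEq] at h ⊢
  · exact Der.tySymm h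
  -- The equality of terms is stated at the left-hand type and has to be converted to the other one.
  · exact ⟨Der.tySymm h.1, Der.tmEqConv h.1 (Der.tmSymm h.2)⟩

theorem BodyEq.trans {Γ : Ctx T.Alph} {B B' B'' : Body T.Alph} (h : T.BodyEq Γ B B')
    (h' : T.BodyEq Γ B' B'') : T.BodyEq Γ B B'' := by
  cases B <;> cases B' <;> simp only [BodyEq] at h <;> cases B'' <;> simp only [BodyEq] at h' ⊢
  · exact Der.tyTrans h h'
  · exact ⟨Der.tyTrans h.1 h'.1, Der.tmTrans h.2 (Der.tmEqConv (Der.tySymm h.1) h'.2)⟩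

theorem BodyEq.rename (σ : Equiv.Perm ℕ) {Γ : Ctx T.Alph} {B B' : Body T.Alph}
    (h : T.BodyEq Γ B B') : T.BodyEq (Ctx.rename σ Γ) (B.rename σ) (B'.rename σ) := by
  cases B <;> cases B' <;> simp only [BodyEq] at h <;> simp only [Body.rename, BodyEq]
  · exact Derivable.alpha h σ
  · exact ⟨Derivable.alpha h.1 σ, Derivable.alpha h.2 σ⟩

/-- Derivable equality of judgements with the same variables. -/
def JEq (T : WGAT.{u}) (J K : Judg T.Alph) : Prop :=
  T.Conv J.ctx K.ctx ∧ T.BodyEq J.ctx J.body K.body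

theorem JEq.refl {J : Judg T.Alph} (h : T.Der J) : T.JEq J J := ⟨Conv.refl h, BodyEq.refl h⟩

theorem JEq.symm {J K : Judg T.Alph} (h : T.JEq J K) : T.JEq K J :=
  ⟨h.1.symm, BodyEq.map (fun _ => h.1.symm.der) h.2.symm⟩

theorem JEq.trans {J K L : Judg T.Alph} (h : T.JEq J K) (h' : T.JEq K L) : T.JEq J L :=
  ⟨h.1.trans h'.1, h.2.trans (BodyEq.map (fun _ => h.1.der) h'.2)⟩

theorem JEq.rename (σ : Equiv.Perm ℕ) {J K : Judg T.Alph} (h : T.JEq J K) :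
    T.JEq (J.rename σ) (K.rename σ) :=
  ⟨h.1.rename σ, h.2.rename σ⟩

theorem _root_.TypeDep.Judg.rename_rename {W : Type u} (f g : ℕ → ℕ) (J : Judg W) :
    (J.rename f).rename g = J.rename (fun v => g (f v)) := by
  obtain ⟨Γ, B⟩ := J
  have : Ctx.rename g (Ctx.rename f Γ) = Ctx.rename (fun v => g (f v)) Γ := by
    simp [Ctx.rename, Exp.rename_rename]
  cases B <;> simp [Judg.rename, this, Body.rename, Exp.rename_rename]

/-- The underlying judgement. -/
def TyJ.judg {n : ℕ} (J : T.TyJ n) : Judg T.Alph := ⟨J.ctx, .ty J.type⟩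

/-- The underlying judgement. -/
def TmJ.judg {n : ℕ} (J : T.TmJ n) : Judg T.Alph := ⟨J.ctx, .tm J.term J.type⟩

theorem TyJ.ext_judg {n : ℕ} {J K : T.TyJ n} (h : J.judg = K.judg) : J = K := by
  cases J; cases K
  simp_all [TyJ.judg]

theorem TmJ.ext_judg {n : ℕ} {J K : T.TmJ n} (h : J.judg = K.judg) : J = K := by
  cases J; cases K
  simp_all [TmJ.judg]

/-- Derivable equality up to a permutation of the variables. -/
def AlphaEq (T : WGAT.{u}) (J K : Judg T.Alph) : Prop :=
  ∃ σ : Equiv.Perm ℕ, T.JEq J (K.rename σ)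

theorem AlphaEq.refl {J : Judg T.Alph} (h : T.Der J) : T.AlphaEq J J :=
  ⟨1, by
    have : J.rename ((1 : Equiv.Perm ℕ)) = J := Judg.rename_id J
    rw [this]
    exact JEq.refl h⟩

theorem AlphaEq.symm {J K : Judg T.Alph} (h : T.AlphaEq J K) : T.AlphaEq K J := by
  obtain ⟨σ, h⟩ := h
  refine ⟨σ.symm, JEq.symm ?_⟩
  have := h.rename σ.symm
  rw [Judg.rename_rename] at this
  simpa [Judg.rename_id] using this

theorem AlphaEq.trans {J K L : Judg T.Alph} (h : T.AlphaEq J K) (h' : T.AlphaEq K L) :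
    T.AlphaEq J L := by
  obtain ⟨σ, h⟩ := h
  obtain ⟨τ, h'⟩ := h'
  refine ⟨τ.trans σ, h.trans ?_⟩
  have := h'.rename σ
  rwa [Judg.rename_rename] at this

/-- Both contexts consist of distinct variables, so the replacement in the definition of congruence
agrees with a permutation on all variables that occur. Conversely, a permutation that relates two
judgements must match their declared variables in order, and so agrees with the replacement. -/
theorem tyCong_iff {n : ℕ} {J K : T.TyJ n} : TyCong J K ↔ T.AlphaEq J.judg K.judg := by
  have hs := T.scoped K.der
  have key : ∀ σ : Equiv.Perm ℕ, (Ctx.vars K.ctx).map σ = Ctx.vars J.ctx →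
      (TyCong J K ↔ T.JEq J.judg (K.judg.rename σ)) := by
    intro σ hσ
    rw [TyCong, ctxCong_iff_conv σ hs.1 hσ, rename_replace hσ hs.2]
    rfl
  constructor
  · intro h
    obtain ⟨σ, hσ⟩ := Interp.exists_perm_of_cong h.1 J.der K.der
    exact ⟨σ, (key σ hσ).1 h⟩
  · rintro ⟨σ, h⟩
    refine (key σ ?_).2 h
    rw [← Ctx.vars_rename]
    exact h.1.vars_eq.symm

theorem tmCong_iff {n : ℕ} {J K : T.TmJ n} : TmCong J K ↔ T.AlphaEq J.judg K.judg := by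
  have hs := T.scoped K.der
  have key : ∀ σ : Equiv.Perm ℕ, (Ctx.vars K.ctx).map σ = Ctx.vars J.ctx →
      (TmCong J K ↔ T.JEq J.judg (K.judg.rename σ)) := by
    intro σ hσ
    rw [TmCong, TyCong, rename_replace hσ hs.2.1]
    change ((T.CtxCong J.ctx K.ctx ∧
      T.Der ⟨J.ctx, .tyEq J.type (K.type.rename (replace J.ctx.vars K.ctx.vars))⟩) ∧ _) ↔ _
    rw [ctxCong_iff_conv σ hs.1 hσ, rename_replace hσ hs.2.2, and_assoc]
    rfl
  constructor
  · intro h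
    obtain ⟨σ, hσ⟩ := Interp.exists_perm_of_cong h.1.1 J.der K.der
    exact ⟨σ, (key σ hσ).1 h⟩
  · rintro ⟨σ, h⟩
    refine (key σ ?_).2 h
    rw [← Ctx.vars_rename]
    exact h.1.vars_eq.symm

/-- Equality in `Quot` is the equivalence relation generated by congruence. Congruence is itself an
equivalence relation, because derivable equality up to permutation is one. -/
theorem tyClass_eq_iff {n : ℕ} {J K : T.TyJ n} :
    tyClass J = tyClass K ↔ T.AlphaEq J.judg K.judg := by
  have he : Equivalence (TyCong (T := T) (n := n)) :=
    ⟨fun J => tyCong_iff.2 (AlphaEq.refl J.der), fun h => tyCong_iff.2 (tyCong_iff.1 h).symm,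
      fun h h' => tyCong_iff.2 ((tyCong_iff.1 h).trans (tyCong_iff.1 h'))⟩
  rw [← tyCong_iff]
  exact ⟨fun h => he.eqvGen_iff.1 (Quot.eqvGen_exact h), fun h => Quot.sound h⟩

theorem tmClass_eq_iff {n : ℕ} {J K : T.TmJ n} :
    tmClass J = tmClass K ↔ T.AlphaEq J.judg K.judg := by
  have he : Equivalence (TmCong (T := T) (n := n)) :=
    ⟨fun J => tmCong_iff.2 (AlphaEq.refl J.der), fun h => tmCong_iff.2 (tmCong_iff.1 h).symm,
      fun h h' => tmCong_iff.2 ((tmCong_iff.1 h).trans (tmCong_iff.1 h'))⟩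
  rw [← tmCong_iff]
  exact ⟨fun h => he.eqvGen_iff.1 (Quot.eqvGen_exact h), fun h => Quot.sound h⟩

/-! ### Renaming along injective maps, and weakening by several declarations. -/

/-- Renaming of a derived judgement along a map that is injective on its variables. -/
theorem exists_perm_rename {J : Judg T.Alph} (h : T.Der J) {f : ℕ → ℕ}
    (hf : ((Ctx.vars J.ctx).map f).Nodup) : ∃ σ : Equiv.Perm ℕ, J.rename f = J.rename σ := by
  have hs := T.scoped h
  obtain ⟨σ, hσ⟩ := exists_perm hf hs.1.nodup (by simp)
  have hv : ∀ v ∈ Ctx.vars J.ctx, f v = σ v := fun v hv => (List.map_inj_left.1 hσ v hv).symm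
  refine ⟨σ, ?_⟩
  simp only [Judg.rename]
  rw [Ctx.rename_congr fun v h => hv v (hs.1.fv_subset v h), Body.rename_congr hs.2 hv]

theorem Der.rename {J : Judg T.Alph} (h : T.Der J) {f : ℕ → ℕ}
    (hf : ((Ctx.vars J.ctx).map f).Nodup) : T.Der (J.rename f) := by
  obtain ⟨σ, hσ⟩ := exists_perm_rename h hf
  rw [hσ]
  exact Derivable.alpha h σ

theorem AlphaEq.of_rename {J : Judg T.Alph} (h : T.Der J) {f : ℕ → ℕ}
    (hf : ((Ctx.vars J.ctx).map f).Nodup) : T.AlphaEq (J.rename f) J := by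
  obtain ⟨σ, hσ⟩ := exists_perm_rename h hf
  rw [hσ]
  exact ⟨σ, JEq.refl (Derivable.alpha h σ)⟩

/-- Weakening by all the declarations of a context that do not satisfy `p`. -/
theorem Der.weaken_filter (p : ℕ × Exp T.Alph → Bool) {B : Body T.Alph} :
    ∀ (Γ Δ : Ctx T.Alph), (Ctx.vars (Δ ++ Γ)).Nodup →
      (∀ (x : ℕ) (S : Exp T.Alph) (Θ : Ctx T.Alph), (x, S) :: Θ <:+ Γ → T.Der ⟨Θ, .ty S⟩) →
      T.Der ⟨Δ ++ Γ.filter p, B⟩ → T.Der ⟨Δ ++ Γ, B⟩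
  | [], _, _, _, h => h
  | (x, S) :: Γ, Δ, hn, hΓ, h => by
    have hΓ' : ∀ (y : ℕ) (R : Exp T.Alph) (Θ : Ctx T.Alph), (y, R) :: Θ <:+ Γ →
        T.Der ⟨Θ, .ty R⟩ := fun y R Θ hs => hΓ y R Θ (hs.trans (List.suffix_cons _ _))
    -- A declaration that satisfies `p` is moved into the part `Δ` that is kept; one that does not
    -- is restored by a single weakening after the older declarations have been restored.
    by_cases hp : p (x, S)
    · rw [List.filter_cons_of_pos hp, List.append_cons] at h
      rw [List.append_cons] at hn ⊢
      exact weaken_filter p Γ _ hn hΓ' h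
    · rw [List.filter_cons_of_neg hp] at h
      have hn' : (Ctx.vars (Δ ++ Γ)).Nodup ∧ x ∉ Ctx.vars (Δ ++ Γ) := by
        simp only [Ctx.vars, List.map_append, List.map_cons] at hn ⊢
        rw [List.nodup_middle, List.nodup_cons] at hn
        exact hn.symm
      exact Der.weaken (hΓ x S Γ (List.suffix_refl _)) (weaken_filter p Γ Δ hn'.1 hΓ' h) hn'.2

end WGAT

end TypeDep

namespace TypeDep

namespace Exp

variable {W : Type u}

theorem appVars_inj {w w' : W} {xs ys : List ℕ} :
    appVars w xs = appVars w' ys ↔ w = w' ∧ xs = ys := by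
  refine ⟨fun h => ?_, fun h => by rw [h.1, h.2]⟩
  simp only [appVars, app.injEq] at h
  obtain ⟨hw, hl, h⟩ := h
  refine ⟨hw, List.ext_get hl fun i h1 h2 => ?_⟩
  have := congr_heq (f := fun i => var (W := W) (xs.get i)) (g := fun i => var (ys.get i))
    (x := ⟨i, h1⟩) (y := ⟨i, h2⟩) h ((Fin.heq_ext_iff hl).2 rfl)
  simpa using this

theorem appVars_rename (w : W) (xs : List ℕ) (f : ℕ → ℕ) :
    (appVars w xs).rename f = appVars w (xs.map f) := by
  simp only [appVars, rename, app.injEq, true_and, List.length_map]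
  refine Function.hfunext (by simp) fun i j hij => ?_
  have : (i : ℕ) = j := (Fin.heq_ext_iff (by simp)).1 hij
  simp [this]

end Exp

/-! ## Normal forms of derived judgements of a free theory -/

section Normal

variable {X : TTStr.{u}}

/-- The derived judgements of a free theory. -/
abbrev FreeDer (J : Judg (FreeAlph X)) : Prop := Derivable (freeBasics X) J

/-- The expression `A(ys)` is a type over `Γ`: the list `ys` is empty if `A` is of degree `1`, and
otherwise its last element is declared in `Γ` to be of type `(∂A)(…)`, with the other elements
of `ys` as arguments. -/
def TyOK (Γ : Ctx (FreeAlph X)) : (Σ n, X.Ty n) → List ℕ → Prop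
  | ⟨0, _⟩, ys => ys = []
  | ⟨d + 1, A⟩, ys => ∃ zs y, ys = zs ++ [y] ∧ (y, .appVars (Sum.inl ⟨d, X.bd A⟩) zs) ∈ Γ

/-- Contexts of distinct variables all of whose types satisfy `TyOK` over the earlier part. -/
def CtxOK : Ctx (FreeAlph X) → Prop
  | [] => True
  | (x, S) :: Γ => CtxOK Γ ∧ x ∉ Ctx.vars Γ ∧ ∃ A ys, S = .appVars (Sum.inl A) ys ∧ TyOK Γ A ys

/-- The analogous condition for bodies; no condition on equalities. -/
def BodyOK (Γ : Ctx (FreeAlph X)) : Body (FreeAlph X) → Prop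
  | .ty R => ∃ A ys, R = .appVars (Sum.inl A) ys ∧ TyOK Γ A ys
  | .tm t R => ∃ (d : ℕ) (a : X.Tm d) (ys : List ℕ), t = .appVars (Sum.inr ⟨d, a⟩) ys ∧
      R = .appVars (Sum.inl ⟨d, X.bdTm a⟩) ys ∧ TyOK Γ ⟨d, X.bdTm a⟩ ys
  | _ => True

theorem TyOK.mono {Γ Δ : Ctx (FreeAlph X)} (h : ∀ p ∈ Γ, p ∈ Δ) {A : Σ n, X.Ty n} {ys : List ℕ}
    (hA : TyOK Γ A ys) : TyOK Δ A ys := by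
  obtain ⟨_ | d, A⟩ := A
  · exact hA
  · obtain ⟨zs, y, h1, h2⟩ := hA
    exact ⟨zs, y, h1, h _ h2⟩

theorem BodyOK.mono {Γ Δ : Ctx (FreeAlph X)} (h : ∀ p ∈ Γ, p ∈ Δ) {B : Body (FreeAlph X)}
    (hB : BodyOK Γ B) : BodyOK Δ B := by
  cases B with
  | ty R => obtain ⟨A, ys, h1, h2⟩ := hB; exact ⟨A, ys, h1, h2.mono h⟩
  | tm t R => obtain ⟨d, a, ys, h1, h2, h3⟩ := hB; exact ⟨d, a, ys, h1, h2, h3.mono h⟩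
  | _ => trivial

theorem TyOK.rename (f : ℕ → ℕ) {Γ : Ctx (FreeAlph X)} {A : Σ n, X.Ty n} {ys : List ℕ}
    (hA : TyOK Γ A ys) : TyOK (Ctx.rename f Γ) A (ys.map f) := by
  obtain ⟨_ | d, A⟩ := A
  · obtain rfl : ys = [] := hA
    rfl
  · obtain ⟨zs, y, rfl, h2⟩ := hA
    refine ⟨zs.map f, f y, by simp, ?_⟩
    rw [← Exp.appVars_rename]
    exact List.mem_map_of_mem (f := fun p : ℕ × Exp (FreeAlph X) => (f p.1, p.2.rename f)) h2

theorem BodyOK.rename (f : ℕ → ℕ) {Γ : Ctx (FreeAlph X)} {B : Body (FreeAlph X)}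
    (hB : BodyOK Γ B) : BodyOK (Ctx.rename f Γ) (B.rename f) := by
  cases B with
  | ty R =>
    obtain ⟨A, ys, rfl, h2⟩ := hB
    exact ⟨A, ys.map f, Exp.appVars_rename .., h2.rename f⟩
  | tm t R =>
    obtain ⟨d, a, ys, rfl, rfl, h3⟩ := hB
    exact ⟨d, a, ys.map f, Exp.appVars_rename .., Exp.appVars_rename .., h3.rename f⟩
  | _ => trivial

theorem CtxOK.rename {f : ℕ → ℕ} (hf : Function.Injective f) :
    ∀ {Γ : Ctx (FreeAlph X)}, CtxOK Γ → CtxOK (Ctx.rename f Γ)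
  | [], _ => trivial
  | (x, S) :: Γ, h => by
    refine ⟨h.1.rename hf, ?_, BodyOK.rename (B := .ty S) f h.2.2⟩
    change f x ∉ Ctx.vars (Ctx.rename f Γ)
    rw [Ctx.vars_rename, List.mem_map_of_injective hf]
    exact h.2.1

theorem CtxOK.insert {Γ : Ctx (FreeAlph X)} {y : ℕ} {S : Exp (FreeAlph X)}
    (hS : BodyOK Γ (.ty S)) : ∀ {Δ : Ctx (FreeAlph X)}, y ∉ Ctx.vars (Δ ++ Γ) → CtxOK (Δ ++ Γ) →
      CtxOK (Δ ++ (y, S) :: Γ)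
  | [], hy, h => ⟨h, hy, hS⟩
  | (x, R) :: Δ, hy, h => by
    have hy' : y ≠ x ∧ y ∉ Ctx.vars (Δ ++ Γ) := by simpa [Ctx.vars] using hy
    refine ⟨CtxOK.insert hS hy'.2 h.1, ?_, BodyOK.mono (B := .ty R) ?_ h.2.2⟩
    · have : x ∉ Ctx.vars (Δ ++ Γ) := h.2.1
      change x ∉ Ctx.vars (Δ ++ (y, S) :: Γ)
      simp only [Ctx.vars, List.map_append, List.map_cons, List.mem_append, List.mem_cons,
        not_or] at this ⊢
      exact ⟨this.1, hy'.1.symm, this.2⟩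
    · intro p hp
      change p ∈ Δ ++ (y, S) :: Γ
      have hp : p ∈ Δ ++ Γ := hp
      simp only [List.mem_append, List.mem_cons] at hp ⊢
      tauto

theorem tyOK_freeCtx : ∀ {n : ℕ} (A : X.Ty n),
    TyOK (freeCtx X A) ⟨n, A⟩ (Ctx.vars (freeCtx X A)).reverse
  | 0, _ => rfl
  | n + 1, A => ⟨(Ctx.vars (freeCtx X (X.bd A))).reverse, n, List.reverse_cons,
      List.mem_cons_self⟩

theorem ctxOK_freeCtx : ∀ {n : ℕ} (A : X.Ty n), CtxOK (freeCtx X A)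
  | 0, _ => trivial
  | n + 1, A => ⟨ctxOK_freeCtx _, by rw [vars_freeCtx]; simp, _, _, rfl, tyOK_freeCtx _⟩

/-- Derived judgements of a free theory are in normal form. -/
theorem free_ok {J : Judg (FreeAlph X)} (hJ : FreeDer J) :
    CtxOK J.ctx ∧ BodyOK J.ctx J.body := by
  induction hJ with
  | basic J hJ h ih =>
    rcases hJ with ⟨n, A, rfl⟩ | ⟨n, a, rfl⟩
    · exact ⟨ctxOK_freeCtx A, _, _, rfl, tyOK_freeCtx A⟩
    · exact ⟨ctxOK_freeCtx _, _, _, _, rfl, rfl, tyOK_freeCtx _⟩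
  | rule r Js J hr h ih =>
    cases hr with
    | tmConv Γ t R S =>
      -- The equality used for conversion is reflexive, so conclusion and second premiss coincide.
      obtain rfl : R = S := free_isRefl X (h ⟨Γ, .tyEq R S⟩ (by simp))
      exact ih ⟨Γ, .tm t R⟩ (by simp)
    | ctxConv Γ Δ x R S B =>
      obtain rfl : R = S := free_isRefl X (h ⟨Γ, .tyEq R S⟩ (by simp))
      exact ih ⟨Δ ++ (x, R) :: Γ, B⟩ (by simp)
    | alpha σ J =>
      have h1 := ih J (by simp)
      exact ⟨h1.1.rename σ.injective, h1.2.rename σ⟩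
    | weaken y Γ Δ R B hΓ hΔ =>
      have h1 := ih ⟨Γ, .ty R⟩ (by simp)
      have h2 := ih ⟨Δ ++ Γ, B⟩ (by simp)
      refine ⟨CtxOK.insert h1.2 ?_ h2.1, h2.2.mono ?_⟩
      · rw [Ctx.vars_append, List.mem_append, not_or]
        exact ⟨fun h => hΔ (Ctx.mem_vars_fv h), fun h => hΓ (Ctx.mem_vars_fv h)⟩
      · simp only [List.mem_append, List.mem_cons]
        tauto
    | tmRefl Γ t R => exact ⟨(ih ⟨Γ, .tm t R⟩ (by simp)).1, trivial⟩
    | tmSymm Γ t s R => exact ⟨(ih ⟨Γ, .tmEq t s R⟩ (by simp)).1, trivial⟩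
    | tmTrans Γ t s r R => exact ⟨(ih ⟨Γ, .tmEq t s R⟩ (by simp)).1, trivial⟩
    | tyRefl Γ R => exact ⟨(ih ⟨Γ, .ty R⟩ (by simp)).1, trivial⟩
    | tySymm Γ R S => exact ⟨(ih ⟨Γ, .tyEq R S⟩ (by simp)).1, trivial⟩
    | tyTrans Γ R S S' => exact ⟨(ih ⟨Γ, .tyEq R S⟩ (by simp)).1, trivial⟩
    | tmEqConv Γ t s R S => exact ⟨(ih ⟨Γ, .tyEq R S⟩ (by simp)).1, trivial⟩

theorem CtxOK.nodup : ∀ {Γ : Ctx (FreeAlph X)}, CtxOK Γ → (Ctx.vars Γ).Nodup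
  | [], _ => List.nodup_nil
  | (_, _) :: _, h => List.nodup_cons.2 ⟨h.2.1, h.1.nodup⟩

/-- The types in a context satisfy `TyOK` over the whole context. -/
theorem CtxOK.tyOK_of_mem : ∀ {Γ : Ctx (FreeAlph X)}, CtxOK Γ → ∀ {x : ℕ} {A : Σ n, X.Ty n}
    {ys : List ℕ}, (x, .appVars (Sum.inl A) ys) ∈ Γ → TyOK Γ A ys
  | (y, S) :: Γ, h, x, A, ys, hx => by
    have hm : ∀ p ∈ Γ, p ∈ (y, S) :: Γ := fun _ => List.mem_cons_of_mem _
    rcases List.mem_cons.1 hx with hx | hx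
    · obtain ⟨-, -, B, zs, hS, hB⟩ := h
      simp only [Prod.mk.injEq] at hx
      rw [← hx.2, Exp.appVars_inj, Sum.inl.injEq] at hS
      obtain ⟨rfl, rfl⟩ := hS
      exact hB.mono hm
    · exact (h.1.tyOK_of_mem hx).mono hm

/-- Following last arguments through the context passes through the successive boundaries of `A`,
one argument for each degree below that of `A`. -/
theorem TyOK.length : ∀ {d : ℕ} {Γ : Ctx (FreeAlph X)} (_ : CtxOK Γ) {A : X.Ty d} {ys : List ℕ}
    (_ : TyOK Γ ⟨d, A⟩ ys), ys.length = d
  | 0, Γ, _, A, ys, h => by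
    obtain rfl : ys = [] := h
    rfl
  | d + 1, Γ, hΓ, A, ys, h => by
    obtain ⟨zs, y, rfl, hy⟩ := h
    have := TyOK.length hΓ (hΓ.tyOK_of_mem hy)
    simpa using this

theorem TyOK.mem_vars : ∀ {d : ℕ} {Γ : Ctx (FreeAlph X)} (_ : CtxOK Γ) {A : X.Ty d} {ys : List ℕ}
    (_ : TyOK Γ ⟨d, A⟩ ys) {y : ℕ}, y ∈ ys → y ∈ Ctx.vars Γ
  | 0, Γ, _, A, ys, h, y, hy => by
    obtain rfl : ys = [] := h
    cases hy
  | d + 1, Γ, hΓ, A, ys, h, y, hy => by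
    obtain ⟨zs, z, rfl, hz⟩ := h
    rcases List.mem_append.1 hy with hy | hy
    · exact TyOK.mem_vars hΓ (hΓ.tyOK_of_mem hz) hy
    · rw [List.mem_singleton.1 hy]
      exact List.mem_map_of_mem (f := Prod.fst) hz

/-! ### Derivability of judgements in normal form. -/

/-- The part of the context that declares the arguments of a type is a free context. -/
theorem CtxOK.filter_eq : ∀ {Γ : Ctx (FreeAlph X)}, CtxOK Γ → ∀ {d : ℕ} {A : X.Ty d}
    {ys : List ℕ}, TyOK Γ ⟨d, A⟩ ys →
      Γ.filter (fun p => p.1 ∈ ys) = Ctx.rename (fun i => ys.getD i 0) (freeCtx X A)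
  | [], _, 0, A, ys, hA => rfl
  | [], _, d + 1, A, ys, hA => by
    obtain ⟨zs, y, -, h⟩ := hA
    cases h
  | (x, S) :: Γ, hΓ, 0, A, ys, hA => by
    obtain rfl : ys = [] := hA
    simp [freeCtx, Ctx.rename]
  | (x, S) :: Γ, hΓ, d + 1, A, ys, hA => by
    obtain ⟨zs, y, rfl, hy⟩ := hA
    -- Either the last argument is the newest declaration, and the remaining arguments belong to its
    -- type, or all arguments are already declared in the older context.
    rcases List.mem_cons.1 hy with hy | hy
    · simp only [Prod.mk.injEq] at hy
      obtain ⟨rfl, rfl⟩ := hy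
      obtain ⟨hΓ, hx, B, ws, hS, hB⟩ := hΓ
      rw [Exp.appVars_inj, Sum.inl.injEq] at hS
      obtain ⟨rfl, rfl⟩ := hS
      have hl := TyOK.length hΓ hB
      have ih := filter_eq hΓ hB
      -- The context of `∂A` mentions only positions below `zs.length`, where the lists `zs` and `zs
      -- ++ [y]` agree.
      have hg : ∀ v ∈ Ctx.vars (freeCtx X (X.bd A)), zs.getD v 0 = (zs ++ [y]).getD v 0 := by
        intro v hv
        rw [vars_freeCtx, List.mem_reverse, List.mem_range, ← hl] at hv
        rw [List.getD_append _ _ _ _ hv]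
      have hsc : Ctx.Scoped (freeCtx X (X.bd A)) := ((free X).scoped (freeTy_derivable X (X.bd A))).1
      have hf : Γ.filter (fun p => p.1 ∈ zs ++ [y]) = Γ.filter (fun p => p.1 ∈ zs) := by
        refine List.filter_congr fun p hp => ?_
        have : p.1 ≠ y := fun h => hx (h ▸ List.mem_map_of_mem (f := Prod.fst) hp)
        simp [this]
      rw [List.filter_cons_of_pos (by simp), hf, ih,
        Ctx.rename_congr fun v hv => hg v (hsc.fv_subset v hv)]
      simp only [freeCtx, Ctx.rename, List.map_cons, Exp.appVars_rename, List.cons.injEq,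
        Prod.mk.injEq, and_true, Exp.appVars_inj, true_and]
      constructor
      · rw [List.getD_append_right _ _ _ _ hl.le, hl]; simp
      · rw [vars_freeCtx, List.reverse_reverse]
        refine List.ext_getElem (by simp [hl]) fun i h1 h2 => ?_
        simp [List.getElem?_append_left h1, List.getElem?_eq_getElem h1]
    · have hA : TyOK Γ ⟨d + 1, A⟩ (zs ++ [y]) := ⟨zs, y, rfl, hy⟩
      have hx : x ∉ zs ++ [y] := fun h => hΓ.2.1 (TyOK.mem_vars hΓ.1 hA h)
      rw [List.filter_cons_of_neg (by simpa using hx)]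
      exact filter_eq hΓ.1 hA

theorem map_getD_range {ys : List ℕ} {d : ℕ} (h : ys.length = d) :
    (List.range d).map (fun i => ys.getD i 0) = ys := by
  subst h
  refine List.ext_getElem (by simp) fun i h1 h2 => ?_
  simp [List.getElem?_eq_getElem h2]

theorem TyOK.vars_filter {Γ : Ctx (FreeAlph X)} (hΓ : CtxOK Γ) {d : ℕ} {A : X.Ty d}
    {ys : List ℕ} (hA : TyOK Γ ⟨d, A⟩ ys) :
    Ctx.vars (Γ.filter (fun p => p.1 ∈ ys)) = ys.reverse := by
  rw [hΓ.filter_eq hA, Ctx.vars_rename, vars_freeCtx, List.map_reverse,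
    map_getD_range (hA.length hΓ)]

theorem TyOK.nodup {Γ : Ctx (FreeAlph X)} (hΓ : CtxOK Γ) {d : ℕ} {A : X.Ty d} {ys : List ℕ}
    (hA : TyOK Γ ⟨d, A⟩ ys) : ys.Nodup := by
  rw [← List.nodup_reverse, ← hA.vars_filter hΓ]
  exact (List.filter_sublist.map Prod.fst).nodup hΓ.nodup

/-- The judgement over the basic context of `A` is renamed to the declarations of `ys` and then
weakened by all the others. Derivability of the declared types is a separate hypothesis because it
is itself obtained from this lemma, applied to shorter contexts. -/
theorem der_of_filter {Γ : Ctx (FreeAlph X)} (hΓ : CtxOK Γ)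
    (hs : ∀ (x : ℕ) (S : Exp (FreeAlph X)) (Θ : Ctx (FreeAlph X)), (x, S) :: Θ <:+ Γ →
      FreeDer ⟨Θ, .ty S⟩) {d : ℕ} {A : X.Ty d} {ys : List ℕ} (hA : TyOK Γ ⟨d, A⟩ ys)
    {B : Body (FreeAlph X)} (hB : FreeDer ⟨freeCtx X A, B⟩) :
    FreeDer ⟨Γ, B.rename (fun i => ys.getD i 0)⟩ := by
  refine WGAT.Der.weaken_filter (T := free X) (fun p => p.1 ∈ ys) Γ [] hΓ.nodup hs ?_
  change FreeDer ⟨Γ.filter (fun p => p.1 ∈ ys), _⟩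
  rw [hΓ.filter_eq hA]
  refine WGAT.Der.rename (T := free X) hB ?_
  change (List.map _ (Ctx.vars (freeCtx X A))).Nodup
  rw [← Ctx.vars_rename, ← hΓ.filter_eq hA, hA.vars_filter hΓ]
  exact List.nodup_reverse.2 (hA.nodup hΓ)

theorem TyOK.der_of_suffix {Γ : Ctx (FreeAlph X)} (hΓ : CtxOK Γ)
    (hs : ∀ (x : ℕ) (S : Exp (FreeAlph X)) (Θ : Ctx (FreeAlph X)), (x, S) :: Θ <:+ Γ →
      FreeDer ⟨Θ, .ty S⟩) {A : Σ n, X.Ty n} {ys : List ℕ} (hA : TyOK Γ A ys) :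
    FreeDer ⟨Γ, .ty (.appVars (Sum.inl A) ys)⟩ := by
  obtain ⟨d, A⟩ := A
  have := der_of_filter hΓ hs hA (freeTy_derivable X A)
  rwa [Body.rename, Exp.appVars_rename, vars_freeCtx, List.reverse_reverse,
    map_getD_range (hA.length hΓ)] at this

/-- Recursion on the context removes the circularity: the newest type is derivable over the older
context, whose own types are derivable by the recursive call. -/
theorem CtxOK.der_of_suffix : ∀ {Γ : Ctx (FreeAlph X)}, CtxOK Γ → ∀ (x : ℕ)
    (S : Exp (FreeAlph X)) (Θ : Ctx (FreeAlph X)), (x, S) :: Θ <:+ Γ → FreeDer ⟨Θ, .ty S⟩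
  | [], _, _, _, _, h => by simp at h
  | (y, R) :: Γ, hΓ, x, S, Θ, h => by
    rcases List.suffix_cons_iff.1 h with h | h
    · simp only [List.cons.injEq, Prod.mk.injEq] at h
      obtain ⟨⟨rfl, rfl⟩, rfl⟩ := h
      obtain ⟨hΓ, -, A, ys, rfl, hA⟩ := hΓ
      exact hA.der_of_suffix hΓ hΓ.der_of_suffix
    · exact hΓ.1.der_of_suffix x S Θ h

/-- Type judgements in normal form are derivable. -/
theorem TyOK.der {Γ : Ctx (FreeAlph X)} (hΓ : CtxOK Γ) {A : Σ n, X.Ty n} {ys : List ℕ}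
    (hA : TyOK Γ A ys) : FreeDer ⟨Γ, .ty (.appVars (Sum.inl A) ys)⟩ :=
  hA.der_of_suffix hΓ hΓ.der_of_suffix

/-- Term judgements in normal form are derivable. -/
theorem TyOK.der_tm {Γ : Ctx (FreeAlph X)} (hΓ : CtxOK Γ) {d : ℕ} {a : X.Tm d} {ys : List ℕ}
    (hA : TyOK Γ ⟨d, X.bdTm a⟩ ys) : (free X).Der
      ⟨Γ, .tm (.appVars (Sum.inr ⟨d, a⟩) ys) (.appVars (Sum.inl ⟨d, X.bdTm a⟩) ys)⟩ := by
  have := der_of_filter hΓ hΓ.der_of_suffix hA (freeTm_derivable X a)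
  rwa [Body.rename, Exp.appVars_rename, Exp.appVars_rename, vars_freeCtx, List.reverse_reverse,
    map_getD_range (hA.length hΓ)] at this

end Normal

end TypeDep

namespace TypeDep

/-! ## Models of a type-and-term structure in a theory -/

section Flat

variable {X : TTStr.{u}}

/-- The number of arguments of a constant of a free theory. -/
def arity : FreeAlph X → ℕ
  | .inl A => A.1
  | .inr a => a.1

/-- Expressions `w(ys)`, for a constant `w` and the right number of variables. -/
def FlatExp (e : Exp (FreeAlph X)) : Prop := ∃ w ys, e = .appVars w ys ∧ ys.length = arity w

/-- Bodies all of whose expressions are flat. -/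
def FlatBody : Body (FreeAlph X) → Prop
  | .ty R => FlatExp R
  | .tm t R => FlatExp t ∧ FlatExp R
  | .tyEq R S => FlatExp R ∧ FlatExp S
  | .tmEq t s R => FlatExp t ∧ FlatExp s ∧ FlatExp R

theorem CtxOK.flat : ∀ {Γ : Ctx (FreeAlph X)}, CtxOK Γ → ∀ p ∈ Γ, FlatExp p.2
  | (x, S) :: Γ, h, p, hp => by
    obtain ⟨hΓ, -, A, ys, rfl, hA⟩ := h
    rcases List.mem_cons.1 hp with rfl | hp
    · exact ⟨_, _, rfl, hA.length hΓ⟩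
    · exact hΓ.flat p hp

/-- The normal form says nothing about equality bodies; their two sides are flat because they occur
in the judgements of the boundary, which are derived as well. -/
theorem flat_of_freeDer {J : Judg (FreeAlph X)} (hJ : FreeDer J) :
    (∀ p ∈ J.ctx, FlatExp p.2) ∧ FlatBody J.body := by
  refine ⟨(free_ok hJ).1.flat, ?_⟩
  have ty : ∀ {Γ : Ctx (FreeAlph X)} {R}, FreeDer ⟨Γ, .ty R⟩ → FlatExp R := by
    intro Γ R h
    obtain ⟨hΓ, A, ys, rfl, hA⟩ := free_ok h
    exact ⟨_, _, rfl, hA.length hΓ⟩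
  have tm : ∀ {Γ : Ctx (FreeAlph X)} {t R}, FreeDer ⟨Γ, .tm t R⟩ → FlatExp t ∧ FlatExp R := by
    intro Γ t R h
    obtain ⟨hΓ, d, a, ys, rfl, rfl, hA⟩ := free_ok h
    exact ⟨⟨_, _, rfl, hA.length hΓ⟩, ⟨_, _, rfl, hA.length hΓ⟩⟩
  obtain ⟨Γ, B⟩ := J
  cases B with
  | ty R => exact ty hJ
  | tm t R => exact tm hJ
  | tyEq R S =>
    exact ⟨ty (WGAT.Der.tyEq_left (T := free X) hJ), ty (WGAT.Der.tyEq_right (T := free X) hJ)⟩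
  | tmEq t s R =>
    exact ⟨(tm (WGAT.Der.tmEq_left (T := free X) hJ)).1,
      tm (WGAT.Der.tmEq_right (T := free X) hJ)⟩

end Flat

section Model

variable {X : TTStr.{u}} {T : WGAT.{u}}

/-- The context `x_1 : ty A_1, …, x_n : ty A_n`, for a type-element of degree `n + 1` with
successive boundaries `A_n, …, A_1`; the variable `x_{i+1}` is `i`. -/
def modelCtx (ty : ∀ n, X.Ty n → Exp T.Alph) : ∀ {n : ℕ}, X.Ty n → Ctx T.Alph
  | 0, _ => []
  | n + 1, A => (n, ty n (X.bd A)) :: modelCtx ty (X.bd A)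

theorem vars_modelCtx (ty : ∀ n, X.Ty n → Exp T.Alph) : ∀ {n : ℕ} (A : X.Ty n),
    Ctx.vars (modelCtx ty A) = (List.range n).reverse
  | 0, _ => rfl
  | n + 1, A => by
    have ih := vars_modelCtx ty (X.bd A)
    change n :: Ctx.vars (modelCtx ty (X.bd A)) = _
    rw [ih, List.range_succ]
    simp

variable (X T) in
/-- A choice of derived judgements of `T` for the elements of `X` that strictly preserves
boundaries. -/
structure Model where
  /-- the type of the judgement chosen for a type-element -/
  ty : ∀ n, X.Ty n → Exp T.Alph
  /-- the term of the judgement chosen for a term-element -/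
  tm : ∀ n, X.Tm n → Exp T.Alph
  der_ty : ∀ {n : ℕ} (A : X.Ty n), T.Der ⟨modelCtx ty A, .ty (ty n A)⟩
  der_tm : ∀ {n : ℕ} (a : X.Tm n),
    T.Der ⟨modelCtx ty (X.bdTm a), .tm (tm n a) (ty n (X.bdTm a))⟩

namespace Model

variable (M : Model X T)

/-- The expression chosen for a constant. -/
def const : FreeAlph X → Exp T.Alph
  | .inl A => M.ty A.1 A.2
  | .inr a => M.tm a.1 a.2

/-- The translation of expressions; it matters for flat expressions only. -/
def exp : Exp (FreeAlph X) → Exp T.Alph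
  | .var x => .var x
  | .app w n args => (M.const w).rename fun v => if h : v < n then
      match args ⟨v, h⟩ with
        | .var x => x
        | .app _ _ _ => 0
      else 0

theorem exp_appVars (w : FreeAlph X) (ys : List ℕ) :
    M.exp (.appVars w ys) = (M.const w).rename fun v => ys.getD v 0 := by
  simp only [Exp.appVars, exp]
  congr 1
  funext v
  split_ifs with h
  · simp [List.getElem?_eq_getElem h]
  · simp [List.getElem?_eq_none (not_lt.1 h)]

/-- The translation of contexts. -/
def ctx (Γ : Ctx (FreeAlph X)) : Ctx T.Alph := Γ.map fun p => (p.1, M.exp p.2)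

/-- The translation of bodies. -/
def body : Body (FreeAlph X) → Body T.Alph
  | .ty R => .ty (M.exp R)
  | .tm t R => .tm (M.exp t) (M.exp R)
  | .tyEq R S => .tyEq (M.exp R) (M.exp S)
  | .tmEq t s R => .tmEq (M.exp t) (M.exp s) (M.exp R)

/-- The translation of judgements. -/
def judg (J : Judg (FreeAlph X)) : Judg T.Alph := ⟨M.ctx J.ctx, M.body J.body⟩

theorem vars_ctx (Γ : Ctx (FreeAlph X)) : Ctx.vars (M.ctx Γ) = Ctx.vars Γ := by
  simp [ctx, Ctx.vars]

theorem ctx_append (Γ Δ : Ctx (FreeAlph X)) : M.ctx (Δ ++ Γ) = M.ctx Δ ++ M.ctx Γ := by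
  simp [ctx]

theorem boundary_judg (J : Judg (FreeAlph X)) :
    (M.judg J).boundary = J.boundary.map M.judg := by
  obtain ⟨Γ, B⟩ := J
  cases B <;> cases Γ <;> simp [judg, Judg.boundary, body, ctx]

/-- The chosen judgement is scoped over a context with variables `0, …, n - 1`. This bound makes the
default value in the translation harmless. -/
theorem lt_arity_of_mem_fv {w : FreeAlph X} {v : ℕ} (hv : v ∈ (M.const w).fv) : v < arity w := by
  rcases w with ⟨n, A⟩ | ⟨n, a⟩
  · have := (T.scoped (M.der_ty A)).2 v hv
    rw [vars_modelCtx] at this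
    simpa [arity] using this
  · have := (T.scoped (M.der_tm a)).2.1 v hv
    rw [vars_modelCtx] at this
    simpa [arity] using this

/-- Flatness is essential: `f` need not fix the default value `0`, but with enough arguments that
value is never used. -/
theorem exp_rename {e : Exp (FreeAlph X)} (he : FlatExp e) (f : ℕ → ℕ) :
    M.exp (e.rename f) = (M.exp e).rename f := by
  obtain ⟨w, ys, rfl, hl⟩ := he
  rw [Exp.appVars_rename, exp_appVars, exp_appVars, Exp.rename_rename]
  refine Exp.rename_congr _ fun v hv => ?_
  have : v < ys.length := hl ▸ M.lt_arity_of_mem_fv hv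
  simp [List.getElem?_eq_getElem this]

theorem judg_rename {J : Judg (FreeAlph X)} (hJ : FreeDer J) (f : ℕ → ℕ) :
    M.judg (J.rename f) = (M.judg J).rename f := by
  obtain ⟨h1, h2⟩ := flat_of_freeDer hJ
  obtain ⟨Γ, B⟩ := J
  simp only [judg, Judg.rename, Judg.mk.injEq]
  refine ⟨?_, ?_⟩
  · simp only [ctx, Ctx.rename, List.map_map]
    refine List.map_congr_left fun p hp => ?_
    simp [M.exp_rename (h1 p hp)]
  · cases B with
    | ty R => simp [body, Body.rename, M.exp_rename h2]
    | tm t R => simp [body, Body.rename, M.exp_rename h2.1, M.exp_rename h2.2]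
    | tyEq R S => simp [body, Body.rename, M.exp_rename h2.1, M.exp_rename h2.2]
    | tmEq t s R =>
      simp [body, Body.rename, M.exp_rename h2.1, M.exp_rename h2.2.1, M.exp_rename h2.2.2]

/-- The translation preserves the deduction rules. -/
theorem rule {r : RuleName} {Js : List (Judg (FreeAlph X))} {J : Judg (FreeAlph X)}
    (hr : Rule r Js J) (h : ∀ K ∈ Js, FreeDer K) (h' : ∀ K ∈ Js, T.Der (M.judg K)) :
    Rule r (Js.map M.judg) (M.judg J) := by
  cases hr with
  | tmRefl Γ t R => exact .tmRefl _ _ _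
  | tmSymm Γ t s R => exact .tmSymm _ _ _ _
  | tmTrans Γ t s r R => exact .tmTrans _ _ _ _ _
  | tyRefl Γ R => exact .tyRefl _ _
  | tySymm Γ R S => exact .tySymm _ _ _
  | tyTrans Γ R S S' => exact .tyTrans _ _ _ _
  | tmConv Γ t R S => exact .tmConv _ _ _ _
  | tmEqConv Γ t s R S => exact .tmEqConv _ _ _ _ _
  | ctxConv Γ Δ x R S B =>
    have := Rule.ctxConv (M.ctx Γ) (M.ctx Δ) x (M.exp R) (M.exp S) (M.body B)
    simpa [judg, ctx, body] using this
  | alpha σ J =>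
    rw [M.judg_rename (h J (by simp))]
    exact .alpha σ _
  | weaken y Γ Δ R B hΓ hΔ =>
    have s1 := (T.scoped (h' ⟨Γ, .ty R⟩ (by simp))).1
    have s2 := (T.scoped (h' ⟨Δ ++ Γ, B⟩ (by simp))).1
    simp only [judg, ctx_append] at s1 s2
    have hy : y ∉ Ctx.vars (M.ctx Γ) := by
      rw [vars_ctx]
      exact fun h => hΓ (Ctx.mem_vars_fv h)
    have := Rule.weaken y (M.ctx Γ) (M.ctx Δ) (M.exp R) (M.body B)
      (fun h => hy (s1.fv_subset y h)) (fun h => by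
        have h : y ∈ Ctx.vars (M.ctx Δ ++ M.ctx Γ) := by
          refine s2.fv_subset y ?_
          obtain ⟨p, hp, h⟩ := h
          exact ⟨p, List.mem_append_left _ hp, h⟩
        rw [Ctx.vars_append, List.mem_append] at h
        refine hΔ (Ctx.mem_vars_fv ?_)
        rw [← M.vars_ctx]
        exact h.resolve_right hy)
    simpa [judg, ctx, body] using this

theorem const_eq_exp {w : FreeAlph X} : M.exp (.appVars w (List.range (arity w))) = M.const w := by
  rw [exp_appVars, ← Exp.rename_id (M.const w), Exp.rename_rename]
  refine Exp.rename_congr _ fun v hv => ?_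
  simp [M.lt_arity_of_mem_fv hv]

theorem ctx_freeCtx : ∀ {n : ℕ} (A : X.Ty n), M.ctx (freeCtx X A) = modelCtx M.ty A
  | 0, _ => rfl
  | n + 1, A => by
    have ih := ctx_freeCtx (X.bd A)
    have h : (Ctx.vars (freeCtx X (X.bd A))).reverse =
        List.range (arity (X := X) (.inl ⟨n, X.bd A⟩)) := by
      rw [vars_freeCtx, List.reverse_reverse]; rfl
    simp only [ctx] at ih
    simp only [freeCtx, ctx, modelCtx, List.map_cons, ih, h, const_eq_exp]
    rfl

theorem judg_freeTy {n : ℕ} (A : X.Ty n) :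
    M.judg (freeTy X A) = ⟨modelCtx M.ty A, .ty (M.ty n A)⟩ := by
  have h : (Ctx.vars (freeCtx X A)).reverse = List.range (arity (X := X) (.inl ⟨n, A⟩)) := by
    rw [vars_freeCtx, List.reverse_reverse]; rfl
  simp only [judg, freeTy, ctx_freeCtx, body, h, const_eq_exp]
  rfl

theorem judg_freeTm {n : ℕ} (a : X.Tm n) : M.judg (freeTm X a) =
    ⟨modelCtx M.ty (X.bdTm a), .tm (M.tm n a) (M.ty n (X.bdTm a))⟩ := by
  have h : (Ctx.vars (freeCtx X (X.bdTm a))).reverse =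
      List.range (arity (X := X) (.inl ⟨n, X.bdTm a⟩)) := by
    rw [vars_freeCtx, List.reverse_reverse]; rfl
  have h' : (Ctx.vars (freeCtx X (X.bdTm a))).reverse =
      List.range (arity (X := X) (.inr ⟨n, a⟩)) := h
  simp only [judg, freeTm, ctx_freeCtx, body]
  rw [h', const_eq_exp, ← h', h, const_eq_exp]
  rfl

/-- The translation preserves derivability. -/
theorem der {J : Judg (FreeAlph X)} (hJ : FreeDer J) : T.Der (M.judg J) := by
  induction hJ with
  | basic J hJ h ih =>
    rcases hJ with ⟨n, A, rfl⟩ | ⟨n, a, rfl⟩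
    · rw [judg_freeTy]
      exact M.der_ty A
    · rw [judg_freeTm]
      exact M.der_tm a
  | rule r Js J hr h ih =>
    refine .rule _ _ _ (M.rule hr h ih) fun K hK => ?_
    obtain ⟨L, hL, rfl⟩ := List.mem_map.1 hK
    exact ih L hL

/-- The interpretation of the free theory given by a model. -/
def interp : Interp (free X) T where
  toFun J := ⟨M.judg J.1, M.der J.2⟩
  map_boundary J Ks h := by
    refine Eq.trans ?_ (M.boundary_judg J.1).symm
    exact (List.map_map (f := Subtype.val) (g := M.judg) (l := Ks)).symm.trans
      (congrArg (List.map M.judg) h)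
  map_rule r Js J J' h h' := by
    refine Rule.functional (M.rule h ?_ ?_) h' ?_
    · intro K hK
      obtain ⟨K, -, rfl⟩ := List.mem_map.1 hK
      exact K.2
    · intro K hK
      obtain ⟨K, -, rfl⟩ := List.mem_map.1 hK
      exact M.der K.2
    · exact List.map_map (f := Subtype.val) (g := M.judg) (l := Js)

/-- The map of theories given by a model. -/
def hom : free X ⟶ T := Quot.mk _ M.interp

/-- The translation of type judgements. -/
def tyJ {n : ℕ} (J : (free X).TyJ n) : T.TyJ n :=
  ⟨M.ctx J.ctx, M.exp J.type, (List.length_map _).trans J.length_eq, M.der J.der⟩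

/-- The translation of term judgements. -/
def tmJ {n : ℕ} (J : (free X).TmJ n) : T.TmJ n :=
  ⟨M.ctx J.ctx, M.exp J.term, M.exp J.type, (List.length_map _).trans J.length_eq, M.der J.der⟩

theorem mapTy_hom {n : ℕ} (J : (free X).TyJ n) :
    TTStr.mapTy (forget.map M.hom) (WGAT.tyClass J) = WGAT.tyClass (M.tyJ J) :=
  congrArg WGAT.tyClass (M.interp.mapTyJ_eq (K := M.tyJ J) rfl)

theorem mapTm_hom {n : ℕ} (J : (free X).TmJ n) :
    TTStr.mapTm (forget.map M.hom) (WGAT.tmClass J) = WGAT.tmClass (M.tmJ J) :=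
  congrArg WGAT.tmClass (M.interp.mapTmJ_eq (K := M.tmJ J) rfl)

/-- The judgement chosen for a type-element. -/
def repTy {n : ℕ} (A : X.Ty n) : T.TyJ n :=
  ⟨modelCtx M.ty A, M.ty n A,
    by simpa [Ctx.vars] using congrArg List.length (vars_modelCtx M.ty A), M.der_ty A⟩

/-- The judgement chosen for a term-element. -/
def repTm {n : ℕ} (a : X.Tm n) : T.TmJ n :=
  ⟨modelCtx M.ty (X.bdTm a), M.tm n a, M.ty n (X.bdTm a), (M.repTy (X.bdTm a)).length_eq,
    M.der_tm a⟩

/-- The criterion by which every map out of a free theory is identified below: the existence half of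
freeness, the action of the free functor, and the counit. -/
theorem freeUnit_hom {f : X ⟶ forget.obj T}
    (hty : ∀ (n : ℕ) (A : X.Ty n), TTStr.mapTy f A = WGAT.tyClass (M.repTy A))
    (htm : ∀ (n : ℕ) (a : X.Tm n), TTStr.mapTm f a = WGAT.tmClass (M.repTm a)) :
    freeUnit X ≫ forget.map M.hom = f := by
  refine TTStr.hom_ext (fun n A => ?_) (fun n a => ?_)
  · refine (M.mapTy_hom (freeTyJ X A)).trans (Eq.trans ?_ (hty n A).symm)
    exact congrArg WGAT.tyClass (WGAT.TyJ.ext_judg (M.judg_freeTy A))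
  · refine (M.mapTm_hom (freeTmJ X a)).trans (Eq.trans ?_ (htm n a).symm)
    exact congrArg WGAT.tmClass (WGAT.TmJ.ext_judg (M.judg_freeTm a))

end Model

end Model

end TypeDep

namespace TypeDep

/-! ## The universal property of free theories -/

section Universal

variable {X : TTStr.{u}} {T : WGAT.{u}}

namespace WGAT

/-- A type judgement can be replaced by one over a given boundary. -/
theorem TyJ.exists_lift {n : ℕ} (J : T.TyJ n) (K : T.TyJ (n + 1))
    (h : T.AlphaEq J.judg K.bd.judg) {y : ℕ} (hy : y ∉ Ctx.vars J.ctx) :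
    ∃ L : T.TyJ (n + 1), L.ctx = (y, J.type) :: J.ctx ∧ T.AlphaEq L.judg K.judg := by
  obtain ⟨Δ, R, hl, hK⟩ := K
  match Δ, hl, hK, h with
  | (z, S) :: Δ, hl, hK, h =>
    obtain ⟨σ, h1, h2⟩ := h
    -- The permutation `σ` matches the two boundaries but may send `z` anywhere outside their
    -- variables. Composing it with the transposition of `σ z` and `y` sends `z` to `y`, and leaves
    -- the values on `Δ` alone because both transposed variables are fresh there.
    have hn : ((Ctx.vars ((z, S) :: Δ)).map (σ.trans (Equiv.swap (σ z) y))) =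
        y :: Ctx.vars J.ctx := by
      have hz := (T.scoped hK).1.1
      have e : (Ctx.vars Δ).map σ = Ctx.vars J.ctx := by
        rw [← Ctx.vars_rename]
        exact h1.vars_eq.symm
      rw [← e] at hy ⊢
      simp only [Ctx.vars, List.map_cons, Equiv.trans_apply, Equiv.swap_apply_left,
        List.cons.injEq, true_and]
      refine List.map_congr_left fun v hv => Equiv.swap_apply_of_ne_of_ne ?_ ?_
      · exact fun h => hz (σ.injective h ▸ hv)
      · exact fun h => hy (h ▸ List.mem_map_of_mem hv)
    generalize hτ : σ.trans (Equiv.swap (σ z) y) = τ at hn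
    have hn : τ z = y ∧ (Ctx.vars Δ).map τ = Ctx.vars J.ctx := by
      simpa [Ctx.vars] using hn
    have hbd : T.Der ⟨Δ, .ty S⟩ := Der.of_cons hK
    have e : (⟨Δ, .ty S⟩ : Judg T.Alph).rename σ = (⟨Δ, .ty S⟩ : Judg T.Alph).rename τ := by
      have hs := T.scoped hbd
      have hv : ∀ v ∈ Ctx.vars Δ, σ v = τ v := by
        refine List.map_inj_left.1 (Eq.trans ?_ hn.2.symm)
        rw [← Ctx.vars_rename]
        exact h1.vars_eq.symm
      simp only [Judg.rename]
      rw [Ctx.rename_congr fun v h => hv v (hs.1.fv_subset v h), Body.rename_congr hs.2 hv]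
    simp only [Judg.rename, Judg.mk.injEq, Body.rename, Body.ty.injEq] at e
    have h1 : T.Conv J.ctx (Ctx.rename σ Δ) := h1
    have h2 : T.Der ⟨J.ctx, .tyEq J.type (S.rename σ)⟩ := h2
    rw [e.1] at h1
    rw [e.2] at h2
    have hc : T.Conv ((y, J.type) :: J.ctx) (Ctx.rename τ ((z, S) :: Δ)) := ⟨hn.1.symm, h1, h2⟩
    have hd := hc.der (Derivable.alpha hK τ)
    exact ⟨⟨(y, J.type) :: J.ctx, R.rename τ, by rw [List.length_cons, J.length_eq], hd⟩, rfl, τ,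
      hc, BodyEq.refl hd⟩

/-- A term judgement can be replaced by one over a given boundary. -/
theorem TmJ.exists_lift {n : ℕ} (J : T.TyJ n) (K : T.TmJ n) (h : T.AlphaEq J.judg K.bd.judg) :
    ∃ L : T.TmJ n, L.bd = J ∧ T.AlphaEq L.judg K.judg := by
  obtain ⟨σ, h1, h2⟩ := h
  have h1 : T.Conv J.ctx (Ctx.rename σ K.ctx) := h1
  have h2 : T.Der ⟨J.ctx, .tyEq J.type (K.type.rename σ)⟩ := h2
  have hd : T.Der ⟨J.ctx, .tm (K.term.rename σ) (K.type.rename σ)⟩ :=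
    h1.der (Derivable.alpha K.der σ)
  have hd' := Der.tmConv (Der.tySymm h2) hd
  exact ⟨⟨J.ctx, K.term.rename σ, J.type, J.length_eq, hd'⟩, rfl, σ, h1, h2, Der.tmRefl hd'⟩

/-- When both contexts declare the same variables in the same order, the permutation fixes each of
them, and hence fixes the whole judgement. -/
theorem AlphaEq.jEq {J K : Judg T.Alph} (h : T.AlphaEq J K) (hK : T.Der K)
    (hv : Ctx.vars J.ctx = Ctx.vars K.ctx) : T.JEq J K := by
  obtain ⟨σ, h⟩ := h
  have h1 : (Ctx.vars K.ctx).map σ = Ctx.vars K.ctx := by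
    rw [← Ctx.vars_rename, ← hv]
    exact h.1.vars_eq.symm
  rwa [T.rename_eq_self hK (List.map_inj_left.1 (h1.trans (List.map_id _).symm))] at h

theorem Conv.weaken {Γ Γ' : Ctx T.Alph} {y : ℕ} {R R' : Exp T.Alph} (hΓ : T.Conv Γ Γ')
    (hR : T.Der ⟨Γ, .tyEq R R'⟩) : ∀ {Δ Δ' : Ctx T.Alph}, y ∉ Ctx.vars (Δ ++ Γ) →
      T.Conv (Δ ++ Γ) (Δ' ++ Γ') → T.Conv (Δ ++ (y, R) :: Γ) (Δ' ++ (y, R') :: Γ')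
  | [], [], _, _ => ⟨rfl, hΓ, hR⟩
  | [], _ :: _, _, h => by
    -- Convertible contexts have equal lengths, so `Δ` and `Δ'` must have equal lengths; the
    -- mismatched cases are contradictory.
    have h1 := congrArg List.length h.vars_eq
    have h2 := congrArg List.length hΓ.vars_eq
    simp [Ctx.vars] at h1 h2
    omega
  | _ :: _, [], _, h => by
    have h1 := congrArg List.length h.vars_eq
    have h2 := congrArg List.length hΓ.vars_eq
    simp [Ctx.vars] at h1 h2
    omega
  | (x, S) :: Δ, (x', S') :: Δ', hy, h => by
    have hy' : y ∉ Ctx.vars (Δ ++ Γ) := fun h => hy (List.mem_cons_of_mem _ h)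
    exact ⟨h.1, Conv.weaken hΓ hR hy' h.2.1, Der.weaken (Der.tyEq_left hR) h.2.2 hy'⟩

end WGAT

/-! ### Uniqueness of maps out of a free theory. -/

namespace Interp

variable {U : WGAT.{u}} (I : Interp T U)

/-- An interpretation commutes with weakening: `Interp.exists_rule` says that the rule is defined on
the images, and the shape of the rule then dictates how the image contexts split. -/
theorem img_weaken {Γ Δ : Ctx T.Alph} {y : ℕ} {R : Exp T.Alph} {B : Body T.Alph}
    (hΓ : y ∉ Γ.fv) (hΔ : y ∉ Δ.fv) (hR : T.Der ⟨Γ, .ty R⟩) (hB : T.Der ⟨Δ ++ Γ, B⟩)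
    (h : T.Der ⟨Δ ++ (y, R) :: Γ, B⟩) : ∃ Γ' Δ' R' B', y ∉ Ctx.vars (Δ' ++ Γ') ∧
      I.img hR = ⟨Γ', .ty R'⟩ ∧ I.img hB = ⟨Δ' ++ Γ', B'⟩ ∧
      I.img h = ⟨Δ' ++ (y, R') :: Γ', B'⟩ := by
  have hr := Rule.weaken y Γ Δ R B hΓ hΔ
  obtain ⟨J', hJ⟩ := I.exists_rule [⟨_, hR⟩, ⟨_, hB⟩] hr
  have e : I.img h = J' := I.map_rule _ [⟨_, hR⟩, ⟨_, hB⟩] ⟨_, h⟩ J' hr hJ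
  generalize hL : List.map (fun K => (I.toFun K).1) [⟨_, hR⟩, ⟨_, hB⟩] = L at hJ
  have hs := U.scoped (I.img_der h)
  rw [e] at hs
  cases hJ with
  | weaken _ Γ' Δ' R' B' hΓ' hΔ' =>
    simp only [List.map_cons, List.map_nil, List.cons.injEq, and_true] at hL
    refine ⟨Γ', Δ', R', B', ?_, hL.1, hL.2, e⟩
    rw [Ctx.vars_append, List.mem_append, not_or]
    exact ⟨fun h => hΔ' (Ctx.mem_vars_fv h), fun h => hΓ' (Ctx.mem_vars_fv h)⟩

variable {I} {I' : Interp T U}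

/-- `JEq` compares only the contexts of equality judgements, and the context of the image is shared
with the image of the left-hand side. -/
theorem jEq_img_tyEq {Γ : Ctx T.Alph} {R S : Exp T.Alph} (h : T.Der ⟨Γ, .tyEq R S⟩)
    (hR : T.Der ⟨Γ, .ty R⟩) (e : U.JEq (I.img hR) (I'.img hR)) :
    U.JEq (I.img h) (I'.img h) := by
  obtain ⟨Γ₁, R₁, S₁, h1, h2, -⟩ := I.img_tyEq h hR (WGAT.Der.tyEq_right h)
  obtain ⟨Γ₂, R₂, S₂, h3, h4, -⟩ := I'.img_tyEq h hR (WGAT.Der.tyEq_right h)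
  rw [h2, h4] at e
  rw [h1, h3]
  exact ⟨e.1, trivial⟩

theorem jEq_img_tmEq {Γ : Ctx T.Alph} {t s R : Exp T.Alph} (h : T.Der ⟨Γ, .tmEq t s R⟩)
    (ht : T.Der ⟨Γ, .tm t R⟩) (e : U.JEq (I.img ht) (I'.img ht)) :
    U.JEq (I.img h) (I'.img h) := by
  obtain ⟨Γ₁, t₁, s₁, R₁, h1, h2, -⟩ := I.img_tmEq h ht (WGAT.Der.tmEq_right h)
  obtain ⟨Γ₂, t₂, s₂, R₂, h3, h4, -⟩ := I'.img_tmEq h ht (WGAT.Der.tmEq_right h)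
  rw [h2, h4] at e
  rw [h1, h3]
  exact ⟨e.1, trivial⟩

/-- Interpretations of a free theory that agree on its basic judgements agree. -/
theorem jEq_img_free {I I' : Interp (free X) U}
    (hty : ∀ (n : ℕ) (A : X.Ty n),
      U.JEq (I.img (freeTy_derivable X A)) (I'.img (freeTy_derivable X A)))
    (htm : ∀ (n : ℕ) (a : X.Tm n),
      U.JEq (I.img (freeTm_derivable X a)) (I'.img (freeTm_derivable X a)))
    {J : Judg (free X).Alph} (hJ : (free X).Der J) : U.JEq (I.img hJ) (I'.img hJ) := by
  induction hJ with
  | basic J hJ h ih =>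
    rcases hJ with ⟨n, A, rfl⟩ | ⟨n, a, rfl⟩
    · exact hty n A
    · exact htm n a
  | rule r Js J hr h ih =>
    cases hr with
    | tmRefl Γ t R => exact jEq_img_tmEq _ (h ⟨Γ, .tm t R⟩ (by simp)) (ih _ (by simp))
    | tyRefl Γ R => exact jEq_img_tyEq _ (h ⟨Γ, .ty R⟩ (by simp)) (ih _ (by simp))
    | tmSymm Γ t s R =>
      -- In a free theory the symmetry, transitivity and conversion rules each return one of their
      -- premisses, so these cases repeat an induction hypothesis.
      obtain rfl : t = s := free_isRefl X (h ⟨Γ, .tmEq t s R⟩ (by simp))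
      exact ih ⟨Γ, .tmEq t t R⟩ (by simp)
    | tmTrans Γ t s r R =>
      obtain rfl : s = r := free_isRefl X (h ⟨Γ, .tmEq s r R⟩ (by simp))
      exact ih ⟨Γ, .tmEq t s R⟩ (by simp)
    | tySymm Γ R S =>
      obtain rfl : R = S := free_isRefl X (h ⟨Γ, .tyEq R S⟩ (by simp))
      exact ih ⟨Γ, .tyEq R R⟩ (by simp)
    | tyTrans Γ R S S' =>
      obtain rfl : S = S' := free_isRefl X (h ⟨Γ, .tyEq S S'⟩ (by simp))
      exact ih ⟨Γ, .tyEq R S⟩ (by simp)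
    | tmConv Γ t R S =>
      obtain rfl : R = S := free_isRefl X (h ⟨Γ, .tyEq R S⟩ (by simp))
      exact ih ⟨Γ, .tm t R⟩ (by simp)
    | tmEqConv Γ t s R S =>
      obtain rfl : R = S := free_isRefl X (h ⟨Γ, .tyEq R S⟩ (by simp))
      exact ih ⟨Γ, .tmEq t s R⟩ (by simp)
    | ctxConv Γ Δ x R S B =>
      obtain rfl : R = S := free_isRefl X (h ⟨Γ, .tyEq R S⟩ (by simp))
      exact ih ⟨Δ ++ (x, R) :: Γ, B⟩ (by simp)
    | alpha σ J =>
      have h1 := h J (by simp)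
      rw [I.img_alpha h1 σ, I'.img_alpha h1 σ]
      exact (ih J (by simp)).rename σ
    | weaken y Γ Δ R B hΓ hΔ =>
      have hR := h ⟨Γ, .ty R⟩ (by simp)
      have hB := h ⟨Δ ++ Γ, B⟩ (by simp)
      have h1 := ih ⟨Γ, .ty R⟩ (by simp)
      have h2 := ih ⟨Δ ++ Γ, B⟩ (by simp)
      have h3 : (free X).Der ⟨Δ ++ (y, R) :: Γ, B⟩ :=
        .rule _ _ _ (.weaken y Γ Δ R B hΓ hΔ) h
      obtain ⟨Γ₁, Δ₁, R₁, B₁, hy, e1, e2, e3⟩ := I.img_weaken hΓ hΔ hR hB h3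
      obtain ⟨Γ₂, Δ₂, R₂, B₂, -, k1, k2, k3⟩ := I'.img_weaken hΓ hΔ hR hB h3
      have d1 := I.img_der hR
      rw [e1] at d1
      rw [e1, k1] at h1
      rw [e2, k2] at h2
      change U.JEq (I.img h3) (I'.img h3)
      rw [e3, k3]
      exact ⟨WGAT.Conv.weaken h1.1 h1.2 hy h2.1,
        WGAT.BodyEq.map (fun C hC => WGAT.Der.weaken d1 hC hy) h2.2⟩

end Interp

/-- Agreement after the unit gives equality of classes on basic judgements. Interpretations preserve
the declared variables of type and term judgements, so this is derivable equality without renaming,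
which `Interp.jEq_img_free` extends to all derived judgements. -/
theorem free_hom_ext {g g' : free X ⟶ T}
    (h : freeUnit X ≫ forget.map g = freeUnit X ≫ forget.map g') : g = g' := by
  induction g using Quot.ind with
  | mk I =>
  induction g' using Quot.ind with
  | mk I' =>
  have hty : ∀ (n : ℕ) (A : X.Ty n),
      T.JEq (I.img (freeTy_derivable X A)) (I'.img (freeTy_derivable X A)) := by
    intro n A
    have h1 := congrArg (fun f => TTStr.mapTy f A) h
    have h2 : WGAT.tyClass (I.mapTyJ (freeTyJ X A)) = WGAT.tyClass (I'.mapTyJ (freeTyJ X A)) := h1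
    have h3 := (WGAT.tyClass_eq_iff.1 h2).jEq (I'.mapTyJ (freeTyJ X A)).der
      ((I.vars_mapTyJ _).trans (I'.vars_mapTyJ _).symm)
    exact (I.mapTyJ_spec (freeTyJ X A)) ▸ (I'.mapTyJ_spec (freeTyJ X A)) ▸ h3
  have htm : ∀ (n : ℕ) (a : X.Tm n),
      T.JEq (I.img (freeTm_derivable X a)) (I'.img (freeTm_derivable X a)) := by
    intro n a
    have h1 := congrArg (fun f => TTStr.mapTm f a) h
    have h2 : WGAT.tmClass (I.mapTmJ (freeTmJ X a)) = WGAT.tmClass (I'.mapTmJ (freeTmJ X a)) := h1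
    have vars_eq : ∀ I : Interp (free X) T,
        Ctx.vars (I.mapTmJ (freeTmJ X a)).ctx = Ctx.vars (freeTmJ X a).ctx := by
      intro I
      have := I.vars_mapTyJ (freeTmJ X a).bd
      rwa [I.mapTmJ_bd] at this
    have h3 := (WGAT.tmClass_eq_iff.1 h2).jEq (I'.mapTmJ (freeTmJ X a)).der
      ((vars_eq I).trans (vars_eq I').symm)
    exact (I.mapTmJ_spec (freeTmJ X a)) ▸ (I'.mapTmJ_spec (freeTmJ X a)) ▸ h3
  refine Quot.sound ⟨fun n J => WGAT.tyCong_iff.2 ⟨1, ?_⟩, fun n J => WGAT.tmCong_iff.2 ⟨1, ?_⟩⟩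
  · have h1 := Interp.jEq_img_free hty htm J.der
    rw [I.mapTyJ_spec J, I'.mapTyJ_spec J] at h1
    exact (Judg.rename_id (I'.mapTyJ J).judg).symm ▸ h1
  · have h1 := Interp.jEq_img_free hty htm J.der
    rw [I.mapTmJ_spec J, I'.mapTmJ_spec J] at h1
    exact (Judg.rename_id (I'.mapTmJ J).judg).symm ▸ h1

/-! ### Existence of maps out of a free theory. -/

/-- The inductive step in choosing representatives: any representative of the image of `A` is
replaced by one whose context extends the representative `J` already fixed for the boundary. The new
variable is `n`, as required by `modelCtx`. -/
theorem exists_repTy_succ (f : X ⟶ forget.obj T) {n : ℕ} (A : X.Ty (n + 1)) (J : T.TyJ n)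
    (hJ : WGAT.tyClass J = TTStr.mapTy f (X.bd A)) (hv : Ctx.vars J.ctx = (List.range n).reverse) :
    ∃ K : T.TyJ (n + 1), (WGAT.tyClass K = TTStr.mapTy f A ∧
      Ctx.vars K.ctx = (List.range (n + 1)).reverse) ∧ K.ctx = (n, J.type) :: J.ctx := by
  obtain ⟨K, hK⟩ := Quot.exists_rep (TTStr.mapTy f A : T.toTTStr.Ty (n + 1))
  have h1 : WGAT.tyClass J = WGAT.tyClass K.bd := by
    rw [hJ, TTStr.mapTy_bd]
    exact (congrArg T.toTTStr.bd hK).symm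
  obtain ⟨L, h2, h3⟩ := WGAT.TyJ.exists_lift J K (WGAT.tyClass_eq_iff.1 h1) (y := n)
    (by rw [hv]; simp)
  refine ⟨L, ⟨(WGAT.tyClass_eq_iff.2 h3).trans hK, ?_⟩, h2⟩
  rw [h2, List.range_succ, List.reverse_append, ← hv]
  rfl

theorem exists_repTy_zero (f : X ⟶ forget.obj T) (A : X.Ty 0) :
    ∃ K : T.TyJ 0, WGAT.tyClass K = TTStr.mapTy f A ∧
      Ctx.vars K.ctx = (List.range 0).reverse := by
  obtain ⟨K, hK⟩ := Quot.exists_rep (TTStr.mapTy f A : T.toTTStr.Ty 0)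
  refine ⟨K, hK, ?_⟩
  rw [List.length_eq_zero_iff.1 K.length_eq]
  rfl

/-- A choice of representatives of the images of the type-elements that strictly preserves
boundaries. -/
noncomputable def chooseTy (f : X ⟶ forget.obj T) : ∀ (n : ℕ) (A : X.Ty n),
    {K : T.TyJ n // WGAT.tyClass K = TTStr.mapTy f A ∧ Ctx.vars K.ctx = (List.range n).reverse}
  | 0, A => ⟨(exists_repTy_zero f A).choose, (exists_repTy_zero f A).choose_spec⟩
  | n + 1, A =>
    let J := chooseTy f n (X.bd A)
    ⟨(exists_repTy_succ f A J.1 J.2.1 J.2.2).choose,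
      (exists_repTy_succ f A J.1 J.2.1 J.2.2).choose_spec.1⟩

theorem chooseTy_ctx (f : X ⟶ forget.obj T) : ∀ {n : ℕ} (A : X.Ty n),
    (chooseTy f n A).1.ctx = modelCtx (fun n A => (chooseTy f n A).1.type) A
  | 0, A => List.length_eq_zero_iff.1 (chooseTy f 0 A).1.length_eq
  | n + 1, A => by
    let J := chooseTy f n (X.bd A)
    refine (exists_repTy_succ f A J.1 J.2.1 J.2.2).choose_spec.2.trans ?_
    rw [modelCtx, ← chooseTy_ctx f (X.bd A)]

/-- Term-elements need no induction: a representative is converted to the context and type already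
chosen for the boundary. -/
theorem exists_chooseTm (f : X ⟶ forget.obj T) {n : ℕ} (a : X.Tm n) :
    ∃ K : T.TmJ n, WGAT.tmClass K = TTStr.mapTm f a ∧ K.bd = (chooseTy f n (X.bdTm a)).1 := by
  obtain ⟨K, hK⟩ := Quot.exists_rep (TTStr.mapTm f a : T.toTTStr.Tm n)
  have h1 : WGAT.tyClass (chooseTy f n (X.bdTm a)).1 = WGAT.tyClass K.bd := by
    rw [(chooseTy f n (X.bdTm a)).2.1, TTStr.mapTy_bdTm]
    exact (congrArg T.toTTStr.bdTm hK).symm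
  obtain ⟨L, h2, h3⟩ := WGAT.TmJ.exists_lift _ K (WGAT.tyClass_eq_iff.1 h1)
  exact ⟨L, (WGAT.tmClass_eq_iff.2 h3).trans hK, h2⟩

theorem chooseTm_judg (f : X ⟶ forget.obj T) {n : ℕ} (a : X.Tm n) :
    (exists_chooseTm f a).choose.judg =
      ⟨modelCtx (fun n A => (chooseTy f n A).1.type) (X.bdTm a),
        .tm (exists_chooseTm f a).choose.term (chooseTy f n (X.bdTm a)).1.type⟩ := by
  have h := congrArg WGAT.TyJ.judg (exists_chooseTm f a).choose_spec.2
  simp only [WGAT.TyJ.judg, WGAT.TmJ.bd, Judg.mk.injEq, Body.ty.injEq, chooseTy_ctx] at h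
  exact congrArg₂ (fun Γ R => (⟨Γ, .tm _ R⟩ : Judg T.Alph)) h.1 h.2

/-- The model given by a map from `X` to the type-and-term structure of `T`. -/
noncomputable def chooseModel (f : X ⟶ forget.obj T) : Model X T where
  ty n A := (chooseTy f n A).1.type
  tm n a := (exists_chooseTm f a).choose.term
  der_ty A := by
    rw [← chooseTy_ctx]
    exact (chooseTy f _ A).1.der
  der_tm a := by
    rw [← chooseTm_judg]
    exact (exists_chooseTm f a).choose.der

theorem freeUnit_chooseModel (f : X ⟶ forget.obj T) :
    freeUnit X ≫ forget.map (chooseModel f).hom = f := by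
  refine (chooseModel f).freeUnit_hom (fun n A => ?_) (fun n a => ?_)
  · rw [← (chooseTy f n A).2.1]
    refine congrArg WGAT.tyClass (WGAT.TyJ.ext_judg ?_)
    simp only [WGAT.TyJ.judg, chooseTy_ctx]
    rfl
  · rw [← (exists_chooseTm f a).choose_spec.1]
    exact congrArg WGAT.tmClass (WGAT.TmJ.ext_judg (chooseTm_judg f a))

theorem freeUniversal : FreeUniversal.{u} := fun _ _ f =>
  ⟨(chooseModel f).hom, freeUnit_chooseModel f,
    fun _ hg => free_hom_ext (hg.trans (freeUnit_chooseModel f).symm)⟩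

end Universal

end TypeDep

namespace TypeDep

/-! ## Decorated heaps and normal forms -/

section Decorated

variable {X : TTStr.{u}}

namespace WkTy

variable {n : ℕ} (w : WkTy X n)

theorem label_eq (i : Fin (n + 2)) (hi : i ≠ 0) {m : ℕ} (hm : w.1.depth i = m + 1) :
    w.label i hi = ⟨m, TTStr.mapTy w.2 (w.1.shapeElt i hi hm)⟩ := by
  obtain rfl : m = w.1.depth i - 1 := by omega
  rfl

theorem label_fst (i : Fin (n + 2)) (hi : i ≠ 0) : (w.label i hi).1 = w.1.depth i - 1 := rfl

theorem label_of_ne_zero (i : Fin (n + 2)) (hi : i ≠ 0) (h : w.1.toFun i ≠ 0) :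
    ∃ (d : ℕ) (A : X.Ty (d + 1)), w.label i hi = ⟨d + 1, A⟩ ∧
      w.label (w.1.toFun i) h = ⟨d, X.bd A⟩ := by
  obtain ⟨d, hd⟩ := Nat.exists_eq_succ_of_ne_zero (w.1.depth_pos (w.1.toFun i)).ne'
  have hd' : w.1.depth i = d + 1 + 1 := by rw [w.1.depth_eq_succ h, hd]
  refine ⟨d, _, w.label_eq i hi hd', (w.label_eq _ h hd).trans ?_⟩
  rw [← TTStr.mapTy_bd]
  rfl

theorem length_args (i : Fin (n + 2)) : (w.args i).length = w.1.depth i - 1 := by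
  simp [args]

theorem args_of_eq_zero (i : Fin (n + 2)) (h : w.1.toFun i = 0) : w.args i = [] := by
  rw [← List.length_eq_zero_iff, length_args, w.1.depth_eq_one h]

/-- The recursion along parents through which all later arguments handle argument lists: ancestors
are listed from the root downwards, with the parent last. -/
theorem args_of_ne_zero (i : Fin (n + 2)) (h : w.1.toFun i ≠ 0) :
    w.args i = w.args (w.1.toFun i) ++ [(w.1.toFun i : ℕ)] := by
  obtain ⟨d, hd⟩ := Nat.exists_eq_succ_of_ne_zero (w.1.depth_pos (w.1.toFun i)).ne'
  have hd' : w.1.depth i = d + 1 + 1 := by rw [w.1.depth_eq_succ h, hd]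
  simp only [args, hd, hd', Nat.succ_eq_add_one, Nat.add_sub_cancel, List.range_succ,
    List.map_append, List.map_cons, List.map_nil, Nat.add_sub_cancel_left, Function.iterate_one]
  congr 1
  refine List.map_congr_left fun l hl => ?_
  rw [List.mem_range] at hl
  rw [show d + 1 - l = (d - l) + 1 by omega, Function.iterate_succ_apply]

theorem ext_label {w w' : WkTy X n} (h1 : w.1 = w'.1)
    (h2 : ∀ i hi, w.label i hi = w'.label i hi) : w = w' := by
  obtain ⟨φ, h⟩ := w
  obtain ⟨φ', h'⟩ := w'
  obtain rfl : φ = φ' := h1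
  congr 1
  refine TTStr.hom_ext (fun m A => ?_) (fun m a => PEmpty.elim a)
  obtain ⟨⟨i, hi, hm⟩⟩ := A
  have e := (label_eq ⟨φ, h⟩ i hi hm).symm.trans ((h2 i hi).trans (label_eq ⟨φ, h'⟩ i hi hm))
  exact eq_of_heq (Sigma.mk.inj e).2

/-- Compatible labels define a decorated heap. -/
theorem exists_of_label (φ : Heap (n + 1)) (lab : ∀ i : Fin (n + 2), i ≠ 0 → Σ d, X.Ty d)
    (h0 : ∀ i hi, φ.toFun i = 0 → (lab i hi).1 = 0)
    (hs : ∀ i hi (h : φ.toFun i ≠ 0), ∃ (d : ℕ) (A : X.Ty (d + 1)), lab i hi = ⟨d + 1, A⟩ ∧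
      lab (φ.toFun i) h = ⟨d, X.bd A⟩) :
    ∃ w : WkTy X n, w.1 = φ ∧ ∀ i hi, w.label i hi = lab i hi := by
  -- Compatibility forces the degree of each label to be the depth of its vertex, by induction from
  -- the roots. Each label therefore lies in the component where a map out of `[φ]` needs it.
  have hd : ∀ i hi, φ.depth i = (lab i hi).1 + 1 := by
    have ind : ∀ (m : ℕ) (i : Fin (n + 2)) (hi : i ≠ 0), (i : ℕ) = m →
        φ.depth i = (lab i hi).1 + 1 := by
      intro m
      induction m using Nat.strong_induction_on with
      | _ m ih =>
        intro i hi him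
        by_cases h : φ.toFun i = 0
        · rw [φ.depth_eq_one h, h0 i hi h]
        · obtain ⟨d, A, e1, e2⟩ := hs i hi h
          rw [φ.depth_eq_succ h, ih _ (him ▸ φ.map_lt i hi) _ h rfl, e1, e2]
    exact fun i hi => ind i i hi rfl
  have key : ∀ i hi (m : ℕ), φ.depth i = m + 1 → ∃ A : X.Ty m, lab i hi = ⟨m, A⟩ := by
    intro i hi m hm
    obtain rfl : m = (lab i hi).1 := by have := hd i hi; omega
    exact ⟨_, rfl⟩
  choose c hc using key
  refine ⟨⟨φ, TTStr.homMk (X := φ.shape)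
    (fun m i => c i.down.1 i.down.2.1 m i.down.2.2) (fun _ a => PEmpty.elim a) ?_
    (fun _ a => PEmpty.elim a)⟩, rfl, fun i hi => ?_⟩
  · rintro m ⟨⟨i, hi, hm⟩⟩
    have h : φ.toFun i ≠ 0 := fun h => by
      rw [φ.depth_eq_one h] at hm
      omega
    have hm' : φ.depth (φ.toFun i) = m + 1 := by
      rw [φ.depth_eq_succ h] at hm
      omega
    obtain ⟨d, A, e1, e2⟩ := hs i hi h
    rw [hc i hi _ hm] at e1
    rw [hc _ h _ hm'] at e2
    obtain rfl : m = d := by simpa using congrArg Sigma.fst e2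
    simp only [Sigma.mk.injEq, heq_eq_eq, true_and] at e1 e2
    refine Eq.trans e2 ?_
    rw [← e1]
  · obtain ⟨m, hm⟩ := Nat.exists_eq_succ_of_ne_zero (φ.depth_pos i).ne'
    exact (label_eq _ i hi hm).trans (hc i hi m hm).symm

end WkTy

/-! ### Contexts on the variables `1, …, k`. -/

/-- The context `x_1 : g 0, …, x_k : g (k - 1)`, where the variable `x_i` is `i`. -/
def ctxOf {W : Type u} (g : ℕ → Exp W) : ℕ → Ctx W
  | 0 => []
  | k + 1 => (k + 1, g k) :: ctxOf g k

section CtxOf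

variable {W : Type u}

theorem mem_ctxOf {g : ℕ → Exp W} {k : ℕ} {p : ℕ × Exp W} :
    p ∈ ctxOf g k ↔ ∃ i < k, p = (i + 1, g i) := by
  induction k with
  | zero => simp [ctxOf]
  | succ k ih =>
    simp only [ctxOf, List.mem_cons, ih]
    constructor
    · rintro (h | ⟨i, hi, h⟩)
      · exact ⟨k, k.lt_succ_self, h⟩
      · exact ⟨i, by omega, h⟩
    · rintro ⟨i, hi, h⟩
      rcases Nat.lt_succ_iff_lt_or_eq.1 hi with hi | rfl
      · exact Or.inr ⟨i, hi, h⟩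
      · exact Or.inl h

theorem vars_ctxOf (g : ℕ → Exp W) (k : ℕ) :
    Ctx.vars (ctxOf g k) = ((List.range k).map Nat.succ).reverse := by
  induction k with
  | zero => rfl
  | succ k ih =>
    change (k + 1) :: Ctx.vars (ctxOf g k) = _
    rw [ih, List.range_succ]
    simp

theorem ctxOf_congr {g g' : ℕ → Exp W} : ∀ {k : ℕ}, ctxOf g k = ctxOf g' k ↔ ∀ i < k, g i = g' i
  | 0 => by simp [ctxOf]
  | k + 1 => by
    simp only [ctxOf, List.cons.injEq, Prod.mk.injEq, true_and, ctxOf_congr (k := k)]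
    constructor
    · rintro ⟨h1, h2⟩ i hi
      rcases Nat.lt_succ_iff_lt_or_eq.1 hi with hi | rfl
      · exact h2 i hi
      · exact h1
    · exact fun h => ⟨h k k.lt_succ_self, fun i hi => h i (by omega)⟩

/-- The type `e` to the right of the turnstile is stored as `g k`, so that a type judgement and its
context become a single function, corresponding to a heap with one element more than the context. -/
theorem exists_ctxOf (e : Exp W) : ∀ {k : ℕ} {Γ : Ctx W},
    Ctx.vars Γ = ((List.range k).map Nat.succ).reverse → ∃ g, Γ = ctxOf g k ∧ g k = e
  | 0, Γ, h => ⟨fun _ => e, by simpa [Ctx.vars, ctxOf] using h, rfl⟩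
  | k + 1, [], h => by simp [Ctx.vars] at h
  | k + 1, (x, S) :: Γ, h => by
    rw [List.range_succ] at h
    simp only [Ctx.vars, List.map_cons, List.map_append, List.map_nil, List.reverse_append,
      List.reverse_cons, List.reverse_nil, List.nil_append, List.cons_append,
      List.cons.injEq] at h
    obtain ⟨g, hg, hk⟩ := exists_ctxOf S (k := k) (Γ := Γ) h.2
    refine ⟨fun i => if i = k + 1 then e else g i, ?_, by simp⟩
    have : ctxOf (fun i => if i = k + 1 then e else g i) k = Γ := by
      rw [hg, ctxOf_congr]
      intro i hi
      rw [if_neg (by omega)]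
    simp [ctxOf, this, h.1, hk]

end CtxOf

theorem ctxOK_ctxOf {g : ℕ → Exp (FreeAlph X)} : ∀ {k : ℕ},
    CtxOK (ctxOf g k) ↔ ∀ i < k, BodyOK (ctxOf g i) (.ty (g i))
  | 0 => by simp [ctxOf, CtxOK]
  | k + 1 => by
    have hv : k + 1 ∉ Ctx.vars (ctxOf g k) := by
      rw [vars_ctxOf]
      simp
    change (CtxOK (ctxOf g k) ∧ k + 1 ∉ Ctx.vars (ctxOf g k) ∧ BodyOK (ctxOf g k) (.ty (g k))) ↔ _
    rw [ctxOK_ctxOf]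
    constructor
    · rintro ⟨h1, -, h2⟩ i hi
      rcases Nat.lt_succ_iff_lt_or_eq.1 hi with hi | rfl
      · exact h1 i hi
      · exact h2
    · exact fun h => ⟨fun i hi => h i (by omega), hv, h k k.lt_succ_self⟩

namespace WkTy

variable {n : ℕ} (w : WkTy X n)

/-- The type `T_{k + 1}`, for `k ≤ n`. -/
noncomputable def texp (k : ℕ) : Exp (FreeAlph X) :=
  if h : k + 1 < n + 2 then w.typeExp ⟨k + 1, h⟩ (by simp [Fin.ext_iff]) else .var 0

theorem texp_eq (i : Fin (n + 2)) (hi : i ≠ 0) {k : ℕ} (hk : (i : ℕ) = k + 1) :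
    w.texp k = .appVars (Sum.inl (w.label i hi)) (w.args i) := by
  obtain ⟨i, hlt⟩ := i
  obtain rfl : i = k + 1 := hk
  exact dif_pos hlt

theorem topExp_eq : w.topExp = w.texp n := (w.texp_eq (Fin.last (n + 1)) _ rfl).symm

theorem ctx_eq : w.ctx = ctxOf w.texp n := by
  have : ∀ k (hk : k ≤ n), ctxOf w.texp k = (List.finRange k).reverse.map fun (i : Fin k) =>
      ((i : ℕ) + 1, w.texp i) := by
    intro k
    induction k with
    | zero => intro; rfl
    | succ k ih =>
      intro hk
      rw [ctxOf, ih (by omega), List.finRange_succ_last]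
      simp [Function.comp_def]
  rw [this n le_rfl, ctx]
  refine List.map_congr_left fun i _ => ?_
  congr 1
  exact (w.texp_eq _ _ rfl).symm

/-- The last argument of `T_i` is the parent of `i`, which is declared earlier because the heap
decreases, and whose label is the boundary of the label of `i`. -/
theorem tyOK (i : Fin (n + 2)) (hi : i ≠ 0) {k : ℕ} (hk : (i : ℕ) = k + 1) :
    TyOK (ctxOf w.texp k) (w.label i hi) (w.args i) := by
  by_cases h : w.1.toFun i = 0
  · have h1 : (w.label i hi).1 = 0 := by rw [label_fst, w.1.depth_eq_one h]
    rw [w.args_of_eq_zero i h]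
    generalize w.label i hi = s at h1
    obtain ⟨_ | d, A⟩ := s
    · rfl
    · cases h1
  · obtain ⟨d, A, h1, h2⟩ := w.label_of_ne_zero i hi h
    rw [h1, w.args_of_ne_zero i h]
    refine ⟨_, _, rfl, mem_ctxOf.2 ?_⟩
    obtain ⟨j, hj⟩ := Nat.exists_eq_succ_of_ne_zero (Fin.val_ne_zero_iff.2 h)
    have hlt : (w.1.toFun i : ℕ) < i := w.1.map_lt i hi
    refine ⟨j, by omega, ?_⟩
    rw [w.texp_eq (w.1.toFun i) h hj, h2, hj]

theorem ctxOK : CtxOK (ctxOf w.texp (n + 1)) :=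
  ctxOK_ctxOf.2 fun k hk => ⟨_, _, w.texp_eq ⟨k + 1, by omega⟩ (by simp [Fin.ext_iff]) rfl,
    w.tyOK _ _ rfl⟩

/-- Each type expression determines its head constant and its arguments. The constant is the label,
and the last argument is the parent, which is `0` exactly when there are no arguments. -/
theorem ext_texp {w w' : WkTy X n} (h : ctxOf w.texp (n + 1) = ctxOf w'.texp (n + 1)) :
    w = w' := by
  rw [ctxOf_congr] at h
  have key : ∀ i hi, w.label i hi = w'.label i hi ∧ w.args i = w'.args i := by
    intro i hi
    obtain ⟨k, hk⟩ := Nat.exists_eq_succ_of_ne_zero (Fin.val_ne_zero_iff.2 hi)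
    have := h k (by have := i.isLt; omega)
    rw [w.texp_eq i hi hk, w'.texp_eq i hi hk, Exp.appVars_inj, Sum.inl.injEq] at this
    exact this
  refine ext_label (Heap.ext (funext fun i => ?_)) fun i hi => (key i hi).1
  by_cases hi : i = 0
  · rw [hi, w.1.map_zero, w'.1.map_zero]
  · have e := (key i hi).2
    by_cases h1 : w.1.toFun i = 0 <;> by_cases h2 : w'.1.toFun i = 0
    · rw [h1, h2]
    · rw [w.args_of_eq_zero i h1, w'.args_of_ne_zero i h2] at e
      simp at e
    · rw [w.args_of_ne_zero i h1, w'.args_of_eq_zero i h2] at e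
      simp at e
    · rw [w.args_of_ne_zero i h1, w'.args_of_ne_zero i h2] at e
      have := List.append_inj_right' e rfl
      exact Fin.ext (by simpa using this)

/-- Every context in normal form comes from a decorated heap. -/
theorem exists_of_ctxOK {g : ℕ → Exp (FreeAlph X)} (hg : CtxOK (ctxOf g (n + 1))) :
    ∃ w : WkTy X n, ctxOf w.texp (n + 1) = ctxOf g (n + 1) := by
  rw [ctxOK_ctxOf] at hg
  choose A ys hA hys using hg
  -- The number `p` will be the parent of the vertex `k + 1`: it is `0` for a constant of degree 1,
  -- and otherwise the last argument `j + 1`, with `j < k` because that variable is declared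
  -- earlier.
  have hP : ∀ k hk, ∃ p ≤ k, (p = 0 ∧ (A k hk).1 = 0 ∧ ys k hk = []) ∨
      ∃ (j : ℕ) (hj : j < k) (d : ℕ) (B : X.Ty (d + 1)), p = j + 1 ∧ A k hk = ⟨d + 1, B⟩ ∧
        A j (hj.trans hk) = ⟨d, X.bd B⟩ ∧ ys k hk = ys j (hj.trans hk) ++ [j + 1] := by
    intro k hk
    have h1 := hys k hk
    generalize A k hk = s at h1
    obtain ⟨_ | d, B⟩ := s
    · exact ⟨0, k.zero_le, Or.inl ⟨rfl, rfl, h1⟩⟩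
    · obtain ⟨zs, y, h1, h2⟩ := h1
      obtain ⟨j, hj, h3⟩ := mem_ctxOf.1 h2
      simp only [Prod.mk.injEq] at h3
      rw [hA j (hj.trans hk), Exp.appVars_inj, Sum.inl.injEq] at h3
      obtain ⟨rfl, h3, rfl⟩ := h3
      exact ⟨j + 1, hj, Or.inr ⟨j, hj, d, B, rfl, rfl, h3.symm, h1⟩⟩
  choose p hpk hp using hP
  have hlt : ∀ i : Fin (n + 2), i ≠ 0 → (i : ℕ) - 1 < n + 1 := fun i hi => by
    have := i.isLt
    have := Fin.val_ne_zero_iff.2 hi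
    omega
  let φ : Heap (n + 1) :=
    { toFun i := if hi : i = 0 then 0 else ⟨p (i - 1) (hlt i hi), by
        have := hpk (i - 1) (hlt i hi); have := i.isLt; omega⟩
      map_zero := dif_pos rfl
      map_lt i hi := by
        rw [dif_neg hi, Fin.lt_def]
        have := hpk (i - 1) (hlt i hi)
        have := Fin.val_ne_zero_iff.2 hi
        change p (i - 1) (hlt i hi) < i
        omega }
  have hφ : ∀ i hi, (φ.toFun i : ℕ) = p (i - 1) (hlt i hi) := fun i hi => by
    change ((if hi : i = 0 then 0 else _ : Fin (n + 2)) : ℕ) = _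
    rw [dif_neg hi]
  have hcase : ∀ i hi, (φ.toFun i = 0 ∧ (A (i - 1) (hlt i hi)).1 = 0 ∧ ys (i - 1) (hlt i hi) = []) ∨
      ∃ (h : φ.toFun i ≠ 0) (d : ℕ) (B : X.Ty (d + 1)), A (i - 1) (hlt i hi) = ⟨d + 1, B⟩ ∧
        A (φ.toFun i - 1) (hlt _ h) = ⟨d, X.bd B⟩ ∧
        ys (i - 1) (hlt i hi) = ys (φ.toFun i - 1) (hlt _ h) ++ [(φ.toFun i : ℕ)] := by
    intro i hi
    rcases hp (i - 1) (hlt i hi) with ⟨h1, h2⟩ | ⟨j, hj, d, B, h1, h2, h3, h4⟩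
    · exact Or.inl ⟨Fin.ext ((hφ i hi).trans h1), h2⟩
    · have e : (φ.toFun i : ℕ) = j + 1 := (hφ i hi).trans h1
      refine Or.inr ⟨fun h => by rw [h] at e; simp at e, d, B, h2, ?_, ?_⟩
      · simpa only [e, Nat.add_sub_cancel] using h3
      · simpa only [e, Nat.add_sub_cancel] using h4
  obtain ⟨w, hw, hlab⟩ := exists_of_label φ (fun i hi => A (i - 1) (hlt i hi))
    (fun i hi h => by
      rcases hcase i hi with ⟨-, h, -⟩ | ⟨h', -⟩
      · exact h
      · exact absurd h h')
    (fun i hi h => by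
      rcases hcase i hi with ⟨h', -⟩ | ⟨h', d, B, h1, h2, -⟩
      · exact absurd h' h
      · exact ⟨d, B, h1, h2⟩)
  -- From here on, the case analysis `hcase` is all that is needed about the constructed heap.
  clear_value φ
  subst hw
  -- Only the last arguments were used to build the heap. The whole lists agree because they satisfy
  -- the same recursion along parents.
  have hargs : ∀ (m : ℕ) (i : Fin (n + 2)) (hi : i ≠ 0), (i : ℕ) = m →
      w.args i = ys (i - 1) (hlt i hi) := by
    intro m
    induction m using Nat.strong_induction_on with
    | _ m ih =>
      intro i hi him
      rcases hcase i hi with ⟨h1, -, h2⟩ | ⟨h, d, B, -, -, h2⟩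
      · rw [w.args_of_eq_zero i h1, h2]
      · rw [w.args_of_ne_zero i h, h2, ih _ (him ▸ w.1.map_lt i hi) _ h rfl]
  refine ⟨w, ctxOf_congr.2 fun k hk => ?_⟩
  have h0 : (⟨k + 1, by omega⟩ : Fin (n + 2)) ≠ 0 := by simp [Fin.ext_iff]
  rw [w.texp_eq ⟨k + 1, by omega⟩ h0 rfl, hlab, hargs _ _ h0 rfl, hA k hk]
  rfl

theorem bd_label (w : WkTy X (n + 1)) (i : Fin (n + 2)) (hi : i ≠ 0) :
    w.bd.label i hi = w.label i.castSucc (by simpa using hi) := by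
  obtain ⟨m, hm⟩ := Nat.exists_eq_succ_of_ne_zero (w.bd.1.depth_pos i).ne'
  rw [w.bd.label_eq i hi hm, w.label_eq i.castSucc _ ((w.1.bd_depth i).symm.trans hm)]
  rfl

theorem bd_args (w : WkTy X (n + 1)) (i : Fin (n + 2)) : w.bd.args i = w.args i.castSucc := by
  have hd : w.bd.1.depth i = w.1.depth i.castSucc := w.1.bd_depth i
  rw [args, args, hd]
  refine List.map_congr_left fun l _ => ?_
  exact congrArg Fin.val (w.1.bd_iterate i (w.1.depth i.castSucc - 1 - l))

theorem bd_texp (w : WkTy X (n + 1)) {k : ℕ} (hk : k < n + 1) : w.bd.texp k = w.texp k := by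
  have h0 : (⟨k + 1, by omega⟩ : Fin (n + 2)) ≠ 0 := by simp [Fin.ext_iff]
  rw [w.bd.texp_eq ⟨k + 1, by omega⟩ h0 rfl, bd_label, bd_args]
  exact (w.texp_eq _ _ rfl).symm

end WkTy

end Decorated

end TypeDep

namespace TypeDep

/-! ## The description of the weakening monad -/

theorem Judg.ty_congr {W : Type u} {Γ Γ' : Ctx W} {R R' : Exp W} (h1 : Γ = Γ') (h2 : R = R') :
    (⟨Γ, .ty R⟩ : Judg W) = ⟨Γ', .ty R'⟩ := by
  rw [h1, h2]

theorem Judg.tm_congr {W : Type u} {Γ Γ' : Ctx W} {t t' R R' : Exp W} (h1 : Γ = Γ')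
    (h2 : t = t') (h3 : R = R') : (⟨Γ, .tm t R⟩ : Judg W) = ⟨Γ', .tm t' R'⟩ := by
  rw [h1, h2, h3]

section Theta

variable {X : TTStr.{u}}

theorem free_conv_eq : ∀ {Γ Δ : Ctx (free X).Alph}, (free X).Conv Γ Δ → Γ = Δ
  | [], [], _ => rfl
  | [], _ :: _, h => h.elim
  | _ :: _, [], h => h.elim
  | (_, _) :: _, (_, _) :: _, h => by
    rw [h.1, free_conv_eq h.2.1, show _ = _ from free_isRefl X h.2.2]

/-- Equal variables remove the renaming, and reflexivity of equalities in a free theory removes the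
conversions, so equal classes have the same syntax. -/
theorem free_tyClass_eq {n : ℕ} {J K : (free X).TyJ n}
    (h : WGAT.tyClass J = WGAT.tyClass K) (hv : Ctx.vars J.ctx = Ctx.vars K.ctx) :
    J.ctx = K.ctx ∧ J.type = K.type := by
  have h1 := (WGAT.tyClass_eq_iff.1 h).jEq K.der hv
  exact ⟨free_conv_eq h1.1, free_isRefl X h1.2⟩

theorem free_tmClass_eq {n : ℕ} {J K : (free X).TmJ n}
    (h : WGAT.tmClass J = WGAT.tmClass K) (hv : Ctx.vars J.ctx = Ctx.vars K.ctx) :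
    J.ctx = K.ctx ∧ J.term = K.term ∧ J.type = K.type := by
  have h1 := (WGAT.tmClass_eq_iff.1 h).jEq K.der hv
  exact ⟨free_conv_eq h1.1, free_isRefl X h1.2.2, free_isRefl X h1.2.1⟩

/-- Up to renaming, a judgement has the context variables `1, …, n`. -/
theorem exists_perm_vars {Γ : Ctx (FreeAlph X)} (h : (Ctx.vars Γ).Nodup) {n : ℕ}
    (hn : Γ.length = n) : ∃ σ : Equiv.Perm ℕ,
      Ctx.vars (Ctx.rename σ Γ) = ((List.range n).map Nat.succ).reverse := by
  obtain ⟨σ, hσ⟩ := exists_perm (xs := ((List.range n).map Nat.succ).reverse)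
    (ys := Ctx.vars Γ)
    (List.nodup_reverse.2 (List.nodup_range.map Nat.succ_injective)) h (by simp [Ctx.vars, hn])
  exact ⟨σ, by rw [Ctx.vars_rename, hσ]⟩

namespace WkTy

variable {n : ℕ} (w : WkTy X n)

theorem tyOK_last : TyOK (ctxOf w.texp n) w.top (w.args (Fin.last (n + 1))) := w.tyOK _ _ rfl

theorem texp_last : w.texp n = .appVars (Sum.inl w.top) (w.args (Fin.last (n + 1))) :=
  w.texp_eq (Fin.last (n + 1)) _ rfl

theorem der : FreeDer ⟨ctxOf w.texp n, .ty (w.texp n)⟩ := by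
  rw [texp_last]
  exact w.tyOK_last.der w.ctxOK.1

theorem length_ctxOf : (ctxOf w.texp n).length = n := by
  simpa [Ctx.vars] using congrArg List.length (vars_ctxOf w.texp n)

/-- The type judgement of a decorated heap. -/
noncomputable def tyJ : (free X).TyJ n := ⟨ctxOf w.texp n, w.texp n, w.length_ctxOf, w.der⟩

theorem eq_of_ctxOf_eq {w w' : WkTy X n} (h1 : ctxOf w.texp n = ctxOf w'.texp n)
    (h2 : w.texp n = w'.texp n) : w = w' := by
  refine ext_texp ?_
  rw [ctxOf, ctxOf, h1, h2]

theorem tyClass_injective : Function.Injective fun w : WkTy X n => WGAT.tyClass w.tyJ := by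
  intro w w' h
  obtain ⟨h1, h2⟩ := free_tyClass_eq h ((vars_ctxOf w.texp n).trans (vars_ctxOf w'.texp n).symm)
  exact eq_of_ctxOf_eq h1 h2

theorem exists_of_der {Γ : Ctx (FreeAlph X)} {R : Exp (FreeAlph X)} (h : FreeDer ⟨Γ, .ty R⟩)
    (hv : Ctx.vars Γ = ((List.range n).map Nat.succ).reverse) :
    ∃ w : WkTy X n, ctxOf w.texp n = Γ ∧ w.texp n = R := by
  obtain ⟨g, rfl, rfl⟩ := exists_ctxOf R hv
  obtain ⟨h1, h2⟩ := free_ok h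
  have hg : CtxOK (ctxOf g (n + 1)) := ⟨h1, by rw [vars_ctxOf]; simp, h2⟩
  obtain ⟨w, hw⟩ := exists_of_ctxOK hg
  rw [ctxOf, ctxOf] at hw
  simp only [List.cons.injEq, Prod.mk.injEq, true_and] at hw
  exact ⟨w, hw.2, hw.1⟩

/-- Any representative can be renamed to have the context variables `1, …, n`, and a derived
judgement over these variables is the judgement of a decorated heap. -/
theorem tyClass_surjective : Function.Surjective fun w : WkTy X n => WGAT.tyClass w.tyJ := by
  intro A
  obtain ⟨J, rfl⟩ := Quot.exists_rep A
  obtain ⟨σ, hσ⟩ := exists_perm_vars ((free X).scoped J.der).1.nodup J.length_eq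
  have hd : FreeDer ⟨Ctx.rename σ J.ctx, .ty (J.type.rename σ)⟩ :=
    Derivable.alpha (Λ := freeBasics X) J.der σ
  obtain ⟨w, h1, h2⟩ := exists_of_der hd hσ
  refine ⟨w, WGAT.tyClass_eq_iff.2 ⟨σ, ?_⟩⟩
  have : w.tyJ.judg = J.judg.rename σ := Judg.ty_congr h1 h2
  rw [← this]
  exact WGAT.JEq.refl w.der

theorem bd_tyJ (w : WkTy X (n + 1)) : w.bd.tyJ = w.tyJ.bd := by
  -- The last declaration of the context becomes the type of the boundary judgement.
  have e : ctxOf w.texp (n + 1) = (n + 1, w.bd.texp n) :: ctxOf w.bd.texp n :=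
    (ctxOf_congr (k := n + 1).2 fun k hk => w.bd_texp hk).symm
  have : ∀ {J : (free X).TyJ (n + 1)} {K : (free X).TyJ n} {x : ℕ},
      J.ctx = (x, K.type) :: K.ctx → K = J.bd := by
    rintro ⟨Γ, R, hl, h⟩ ⟨Δ, S, hl', h'⟩ x e
    subst e
    rfl
  exact this e

end WkTy

namespace WkTm

variable {n : ℕ} (t : WkTm X n)

/-- The term `a(x_{j_1}, …, x_{j_{k-1}})`. -/
noncomputable def texp : Exp (FreeAlph X) :=
  .appVars (Sum.inr t.term) (t.1.args (Fin.last (n + 1)))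

theorem der : FreeDer ⟨ctxOf t.1.texp n, .tm t.texp (t.1.texp n)⟩ := by
  have h := t.1.tyOK_last
  have e : t.1.top = ⟨t.1.top.1, X.bdTm t.2.1⟩ := by rw [t.2.2]
  rw [e] at h
  have := h.der_tm t.1.ctxOK.1
  rw [← e] at this
  rw [WkTy.texp_last]
  exact this

/-- The term judgement of a decorated heap with a term-element. -/
noncomputable def tmJ : (free X).TmJ n :=
  ⟨ctxOf t.1.texp n, t.texp, t.1.texp n, t.1.length_ctxOf, t.der⟩

theorem ext_term {t t' : WkTm X n} (h1 : t.1 = t'.1) (h2 : t.term = t'.term) : t = t' := by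
  obtain ⟨w, a, ha⟩ := t
  obtain ⟨w', a', ha'⟩ := t'
  obtain rfl : w = w' := h1
  obtain rfl : a = a' := eq_of_heq (Sigma.mk.inj h2).2
  rfl

/-- The type `WkTm` asks for a term-element in the degree `w.top.1`, while normal forms supply one
in a degree that is only provably equal. Replacing `w.top` by a variable allows substitution. -/
theorem exists_of_top_eq (w : WkTy X n) {d : ℕ} {a : X.Tm d} (h : w.top = ⟨d, X.bdTm a⟩) :
    ∃ t : WkTm X n, t.1 = w ∧ t.term = ⟨d, a⟩ := by
  have key : ∀ s : Σ d, X.Ty d, s = ⟨d, X.bdTm a⟩ →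
      ∃ b : {b : X.Tm s.1 // X.bdTm b = s.2}, (⟨s.1, b.1⟩ : Σ d, X.Tm d) = ⟨d, a⟩ := by
    rintro s rfl
    exact ⟨⟨a, rfl⟩, rfl⟩
  obtain ⟨b, hb⟩ := key _ h
  exact ⟨⟨w, b⟩, rfl, hb⟩

theorem texp_inj {t t' : WkTm X n} (h : t.texp = t'.texp) : t.term = t'.term := by
  rw [texp, texp, Exp.appVars_inj, Sum.inr.injEq] at h
  exact h.1

theorem tmClass_injective : Function.Injective fun t : WkTm X n => WGAT.tmClass t.tmJ := by
  intro t t' h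
  obtain ⟨h1, h2, h3⟩ :=
    free_tmClass_eq h ((vars_ctxOf t.1.texp n).trans (vars_ctxOf t'.1.texp n).symm)
  exact ext_term (WkTy.eq_of_ctxOf_eq h1 h3) (texp_inj h2)

theorem tmClass_surjective : Function.Surjective fun t : WkTm X n => WGAT.tmClass t.tmJ := by
  intro A
  obtain ⟨J, rfl⟩ := Quot.exists_rep A
  obtain ⟨σ, hσ⟩ := exists_perm_vars ((free X).scoped J.der).1.nodup J.length_eq
  have hd : FreeDer ⟨Ctx.rename σ J.ctx, .tm (J.term.rename σ) (J.type.rename σ)⟩ :=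
    Derivable.alpha (Λ := freeBasics X) J.der σ
  obtain ⟨w, h1, h2⟩ := WkTy.exists_of_der (WGAT.Der.of_tm (T := free X) hd) hσ
  obtain ⟨-, d, a, ys, h3, h4, -⟩ := free_ok hd
  have h5 := h2.trans h4
  rw [WkTy.texp_last, Exp.appVars_inj, Sum.inl.injEq] at h5
  obtain ⟨t, rfl, ht⟩ := exists_of_top_eq w h5.1
  refine ⟨t, WGAT.tmClass_eq_iff.2 ⟨σ, ?_⟩⟩
  have h6 : t.texp = J.term.rename σ := by
    rw [texp, ht, h5.2]
    exact h3.symm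
  have : t.tmJ.judg = J.judg.rename σ := Judg.tm_congr h1 h6 h2
  rw [← this]
  exact WGAT.JEq.refl t.der

end WkTm

variable (X) in
/-- The map that sends a decorated heap to the class of its judgement. -/
noncomputable def thetaHom : wk.obj X ⟶ forget.obj (free X) :=
  TTStr.homMk (X := wkObj X) (Y := (free X).toTTStr)
    (fun n (w : WkTy X n) => WGAT.tyClass w.tyJ) (fun n (t : WkTm X n) => WGAT.tmClass t.tmJ)
    (fun n (w : WkTy X (n + 1)) => congrArg WGAT.tyClass w.bd_tyJ)
    (fun _ _ => rfl)

instance isIso_thetaHom : IsIso (thetaHom X) := by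
  rw [NatTrans.isIso_iff_isIso_app]
  intro v
  rw [isIso_iff_bijective]
  match v with
  | ⟨HVertex.ty n⟩ => exact ⟨WkTy.tyClass_injective, WkTy.tyClass_surjective⟩
  | ⟨HVertex.tm n⟩ => exact ⟨WkTm.tmClass_injective, WkTm.tmClass_surjective⟩

/-! ### Naturality of the description. -/

variable {Y : TTStr.{u}}

theorem modelCtx_mapTy (f : X ⟶ Y) : ∀ {n : ℕ} (A : X.Ty n),
    modelCtx (T := free Y) (fun n A => .appVars (Sum.inl ⟨n, TTStr.mapTy f A⟩) (List.range n)) A =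
      freeCtx Y (TTStr.mapTy f A)
  | 0, _ => rfl
  | n + 1, A => by
    rw [modelCtx, freeCtx, vars_freeCtx, List.reverse_reverse, modelCtx_mapTy f (X.bd A),
      TTStr.mapTy_bd]
    rfl

/-- The model of `X` in the free theory on `Y` given by a map from `X` to `Y`. -/
def mapModel (f : X ⟶ Y) : Model X (free Y) where
  ty n A := .appVars (Sum.inl ⟨n, TTStr.mapTy f A⟩) (List.range n)
  tm n a := .appVars (Sum.inr ⟨n, TTStr.mapTm f a⟩) (List.range n)
  der_ty A := by
    rw [modelCtx_mapTy]
    have := freeTy_derivable Y (TTStr.mapTy f A)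
    rwa [freeTy, vars_freeCtx, List.reverse_reverse] at this
  der_tm a := by
    rw [modelCtx_mapTy]
    have := freeTm_derivable Y (TTStr.mapTm f a)
    rwa [freeTm, vars_freeCtx, List.reverse_reverse, ← TTStr.mapTy_bdTm] at this

theorem freeUnit_mapModel (f : X ⟶ Y) :
    freeUnit X ≫ forget.map (mapModel f).hom = f ≫ freeUnit Y := by
  refine (mapModel f).freeUnit_hom (fun n A => ?_) (fun n a => ?_)
  · refine congrArg WGAT.tyClass (WGAT.TyJ.ext_judg ?_)
    have h : freeTy Y (TTStr.mapTy f A) = ⟨freeCtx Y (TTStr.mapTy f A),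
        .ty (.appVars (Sum.inl ⟨n, TTStr.mapTy f A⟩) (List.range n))⟩ := by
      rw [freeTy, vars_freeCtx, List.reverse_reverse]
    rw [← modelCtx_mapTy] at h
    exact h
  · refine congrArg WGAT.tmClass (WGAT.TmJ.ext_judg ?_)
    have h : freeTm Y (TTStr.mapTm f a) = ⟨freeCtx Y (TTStr.mapTy f (X.bdTm a)),
        .tm (.appVars (Sum.inr ⟨n, TTStr.mapTm f a⟩) (List.range n))
          (.appVars (Sum.inl ⟨n, TTStr.mapTy f (X.bdTm a)⟩) (List.range n))⟩ := by
      rw [freeTm, vars_freeCtx, List.reverse_reverse, TTStr.mapTy_bdTm]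
    rw [← modelCtx_mapTy] at h
    exact h

theorem homEquiv_id (h : FreeUniversal.{u}) :
    FreeUniversal.homEquiv h X (free X) (𝟙 _) = freeUnit X := by
  change freeUnit X ≫ forget.map (𝟙 _) = _
  rw [CategoryTheory.Functor.map_id]
  exact Category.comp_id _

/-- The free functor on maps is defined by inverting the hom-set bijection, so compatibility with
the units determines its value. -/
theorem freeFunctor_map (h : FreeUniversal.{u}) (f : X ⟶ Y) :
    (FreeUniversal.freeFunctor h).map f = (mapModel f).hom := by
  change (FreeUniversal.homEquiv h X (free Y)).symm
    (f ≫ FreeUniversal.homEquiv h Y (free Y) (𝟙 _)) = _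
  rw [Equiv.symm_apply_eq, homEquiv_id]
  exact (freeUnit_mapModel f).symm

theorem mapModel_appVars (f : X ⟶ Y) (w : FreeAlph X) (w' : FreeAlph Y)
    (hw : (mapModel f).const w = .appVars w' (List.range (arity w))) {ys : List ℕ}
    (hl : ys.length = arity w) : (mapModel f).exp (.appVars w ys) = .appVars w' ys := by
  rw [Model.exp_appVars, hw]
  refine (Exp.appVars_rename _ _ _).trans ?_
  rw [map_getD_range hl]

theorem Model.ctx_ctxOf {T : WGAT.{u}} (M : Model X T) (g : ℕ → Exp (FreeAlph X)) :
    ∀ k, M.ctx (ctxOf g k) = ctxOf (fun i => M.exp (g i)) k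
  | 0 => rfl
  | k + 1 => congrArg (List.cons _) (M.ctx_ctxOf g k)

theorem mapModel_texp (f : X ⟶ Y) {n : ℕ} (w : WkTy X n) {k : ℕ} (hk : k < n + 1) :
    (mapModel f).exp (w.texp k) = WkTy.texp (X := Y) ⟨w.1, w.2 ≫ f⟩ k := by
  have h0 : (⟨k + 1, by omega⟩ : Fin (n + 2)) ≠ 0 := by simp [Fin.ext_iff]
  rw [w.texp_eq ⟨k + 1, by omega⟩ h0 rfl]
  refine Eq.trans ?_ (WkTy.texp_eq (X := Y) ⟨w.1, w.2 ≫ f⟩ ⟨k + 1, by omega⟩ h0 rfl).symm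
  exact mapModel_appVars f _ _ rfl (w.length_args _)

/-- A map `f` only relabels constants, leaving contexts and argument lists unchanged. On heaps this
is composition of the decoration with `f`. -/
theorem thetaHom_naturality (h : FreeUniversal.{u}) (f : X ⟶ Y) :
    wk.map f ≫ thetaHom Y = thetaHom X ≫ forget.map ((FreeUniversal.freeFunctor h).map f) := by
  rw [freeFunctor_map]
  refine TTStr.hom_ext (fun n (w : WkTy X n) => ?_) (fun n (t : WkTm X n) => ?_)
  · refine Eq.trans ?_ ((mapModel f).mapTy_hom w.tyJ).symm
    refine congrArg WGAT.tyClass (WGAT.TyJ.ext_judg ?_)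
    refine Judg.ty_congr ?_ ?_
    · refine Eq.trans ?_ ((mapModel f).ctx_ctxOf w.texp n).symm
      exact (ctxOf_congr.2 fun k hk => mapModel_texp f w (by omega)).symm
    · exact (mapModel_texp f w n.lt_succ_self).symm
  · refine Eq.trans ?_ ((mapModel f).mapTm_hom t.tmJ).symm
    refine congrArg WGAT.tmClass (WGAT.TmJ.ext_judg ?_)
    have h1 : ctxOf (WkTy.texp (X := Y) ⟨t.1.1, t.1.2 ≫ f⟩) n =
        (mapModel f).ctx (ctxOf t.1.texp n) := by
      refine Eq.trans ?_ ((mapModel f).ctx_ctxOf t.1.texp n).symm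
      exact (ctxOf_congr.2 fun k hk => mapModel_texp f t.1 (by omega)).symm
    have h2 := mapModel_texp f t.1 n.lt_succ_self
    have h3 : (mapModel f).exp t.texp = .appVars (Sum.inr ⟨t.1.top.1, TTStr.mapTm f t.2.1⟩)
        (t.1.args (Fin.last (n + 1))) :=
      mapModel_appVars f _ _ rfl (t.1.length_args _)
    exact Judg.tm_congr h1 h3.symm h2.symm

variable (X) in
/-- The isomorphism that sends a decorated heap to the class of its judgement. -/
noncomputable def thetaIso : wk.obj X ≅ forget.obj (free X) := asIso (thetaHom X)

/-- Decorated heaps describe the weakening monad. -/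
noncomputable def theta (h : FreeUniversal.{u}) :
    wk.{u} ≅ (FreeUniversal.weakeningMonad h).toFunctor :=
  NatIso.ofComponents (F := wk.{u}) (G := FreeUniversal.freeFunctor h ⋙ forget.{u})
    thetaIso (fun f => thetaHom_naturality h f)

theorem sendsToJudgements_theta (h : FreeUniversal.{u}) : SendsToJudgements h (theta h) := by
  intro X n
  refine ⟨fun w => ?_, fun t => ?_⟩
  · have e : (⟨w.ctx, .ty w.topExp⟩ : Judg (FreeAlph X)) = ⟨ctxOf w.texp n, .ty (w.texp n)⟩ :=
      Judg.ty_congr w.ctx_eq w.topExp_eq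
    have d : FreeDer ⟨w.ctx, .ty w.topExp⟩ := e ▸ w.der
    exact ⟨d, congrArg WGAT.tyClass
      (WGAT.TyJ.ext_judg (J := w.tyJ) (K := ⟨w.ctx, w.topExp, w.length_ctx, d⟩) e.symm)⟩
  · have e : (⟨t.1.ctx, .tm t.termExp t.1.topExp⟩ : Judg (FreeAlph X)) =
        ⟨ctxOf t.1.texp n, .tm t.texp (t.1.texp n)⟩ :=
      congrArg₂ (fun Γ R => (⟨Γ, .tm t.texp R⟩ : Judg (FreeAlph X))) t.1.ctx_eq t.1.topExp_eq
    have d : FreeDer ⟨t.1.ctx, .tm t.termExp t.1.topExp⟩ := e ▸ t.der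
    exact ⟨d, congrArg WGAT.tmClass (WGAT.TmJ.ext_judg (J := t.tmJ)
      (K := ⟨t.1.ctx, t.termExp, t.1.topExp, t.1.length_ctx, d⟩) e.symm)⟩

end Theta

end TypeDep

namespace TypeDep

/-! ## The multiplication -/

section Mul

variable {X : TTStr.{u}}

namespace WkTy

variable {n : ℕ} (w : WkTy X n)

theorem parent_induction {P : Fin (n + 2) → Prop} (h0 : ∀ j, w.1.toFun j = 0 → P j)
    (hs : ∀ j, w.1.toFun j ≠ 0 → P (w.1.toFun j) → P j) (j : Fin (n + 2)) : P j := by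
  induction j using WellFoundedLT.induction with
  | _ j ih =>
    by_cases h : w.1.toFun j = 0
    · exact h0 j h
    · refine hs j h (ih _ (w.1.map_lt j fun hj => h ?_))
      rw [hj, w.1.map_zero]

/-- The list `w.args j` consists of the proper ancestors of `j`, so the heap order can be read from
the arguments of the type expressions. -/
theorem le_iff (j : Fin (n + 2)) (hj : j ≠ 0) (m : ℕ) :
    w.1.Le m j ↔ m = j ∨ m ∈ w.args j := by
  have h1 : ∀ j : Fin (n + 2), w.1.Le m j ↔ (j ≠ 0 ∧ m = j) ∨ w.1.Le m (w.1.toFun j) := by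
    intro j
    constructor
    · rintro ⟨i', j', hi, rfl, hj, k, hk⟩
      obtain rfl : j' = j := Fin.ext hj
      cases k with
      | zero =>
        obtain rfl : i' = j' := hk
        exact Or.inl ⟨hi, rfl⟩
      | succ k => exact Or.inr ⟨i', _, hi, rfl, rfl, k, hk⟩
    · rintro (⟨hj, rfl⟩ | ⟨i', j', hi, rfl, hj, k, hk⟩)
      · exact ⟨j, j, hj, rfl, rfl, 0, rfl⟩
      · obtain rfl : j' = w.1.toFun j := Fin.ext hj
        exact ⟨i', j, hi, rfl, rfl, k + 1, hk⟩
  have h2 : ¬ w.1.Le m (0 : Fin (n + 2)) := by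
    rintro ⟨i', j', hi, -, hj, k, hk⟩
    obtain rfl : j' = 0 := Fin.ext hj
    rw [w.1.iterate_zero] at hk
    exact hi hk
  induction j using w.parent_induction with
  | h0 j h =>
    refine (h1 j).trans ?_
    rw [h, w.args_of_eq_zero j h]
    refine or_congr (and_iff_right hj) ?_
    exact ⟨fun h' => (h2 h').elim, fun h' => by cases h'⟩
  | hs j h ih =>
    refine (h1 j).trans ((or_congr Iff.rfl (ih h)).trans ?_)
    rw [w.args_of_ne_zero j h]
    simp only [List.mem_append, List.mem_singleton, ne_eq, hj, not_false_eq_true, true_and]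
    tauto

/-- Ancestors are listed from the root, so position determines depth. This is what links positions
in an argument list with vertices of the inner heaps. -/
theorem depth_of_getElem (i j : Fin (n + 2)) (l : ℕ) (h : (w.args j)[l]? = some (i : ℕ)) :
    w.1.depth i = l + 1 := by
  revert h
  induction j using w.parent_induction with
  | h0 j h =>
    rw [w.args_of_eq_zero j h]
    simp
  | hs j h ih =>
    rw [w.args_of_ne_zero j h, List.getElem?_append]
    split_ifs with hl
    · exact ih
    · intro hi
      have hlen := w.length_args (w.1.toFun j)
      have h0 : l - (w.args (w.1.toFun j)).length = 0 := by
        by_contra h0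
        rw [List.getElem?_eq_none (by simp; omega)] at hi
        cases hi
      rw [h0] at hi
      obtain rfl : w.1.toFun j = i := Fin.ext (by simpa using hi)
      have := w.1.depth_pos (w.1.toFun j)
      omega

theorem bounds_of_mem_args {j : Fin (n + 2)} {m : ℕ} (hm : m ∈ w.args j) : 0 < m ∧ m < j := by
  revert hm
  induction j using w.parent_induction with
  | h0 j h =>
    rw [w.args_of_eq_zero j h]
    simp
  | hs j h ih =>
    rw [w.args_of_ne_zero j h, List.mem_append, List.mem_singleton]
    have h1 : (w.1.toFun j : ℕ) < j := w.1.map_lt j fun hj => h (by rw [hj, w.1.map_zero])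
    have h2 := Fin.val_ne_zero_iff.2 h
    rintro (hm | rfl)
    · have := ih hm
      omega
    · omega

end WkTy

/-! ### The counit at a free theory. -/

variable (X) in
/-- The type-and-term structure of the free theory. -/
noncomputable abbrev freeStr : TTStr.{u} := forget.obj (free X)

/-- The decorated heap that describes a type-element of the free theory. -/
noncomputable def heapTy {n : ℕ} (B : (freeStr X).Ty n) : WkTy X n :=
  asWkTy (TTStr.mapTy (inv (thetaHom X)) B)

/-- The decorated heap with a term-element that describes a term-element of the free theory. -/
noncomputable def heapTm {n : ℕ} (b : (freeStr X).Tm n) : WkTm X n :=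
  asWkTm (TTStr.mapTm (inv (thetaHom X)) b)

theorem tyClass_heapTy {n : ℕ} (B : (freeStr X).Ty n) : WGAT.tyClass (heapTy B).tyJ = B :=
  congrArg (fun f => TTStr.mapTy f B) (IsIso.inv_hom_id (thetaHom X))

theorem tmClass_heapTm {n : ℕ} (b : (freeStr X).Tm n) : WGAT.tmClass (heapTm b).tmJ = b :=
  congrArg (fun f => TTStr.mapTm f b) (IsIso.inv_hom_id (thetaHom X))

theorem heapTy_tyClass {n : ℕ} (w : WkTy X n) : heapTy (WGAT.tyClass w.tyJ) = w :=
  congrArg (fun f => TTStr.mapTy (X := wk.obj X) f (n := n) w) (IsIso.hom_inv_id (thetaHom X))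

theorem heapTm_tmClass {n : ℕ} (t : WkTm X n) : heapTm (WGAT.tmClass t.tmJ) = t :=
  congrArg (fun f => TTStr.mapTm (X := wk.obj X) f (n := n) t) (IsIso.hom_inv_id (thetaHom X))

theorem heapTy_bd {n : ℕ} (B : (freeStr X).Ty (n + 1)) :
    heapTy ((freeStr X).bd B) = (heapTy B).bd :=
  TTStr.mapTy_bd (inv (thetaHom X)) B

theorem heapTy_bdTm {n : ℕ} (b : (freeStr X).Tm n) :
    heapTy ((freeStr X).bdTm b) = (heapTm b).1 :=
  TTStr.mapTy_bdTm (inv (thetaHom X)) b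

/-- Judgements of heaps use the variables `1, …, n` and model contexts use `0, …, n - 1`, hence
`Nat.pred`. The two contexts match because `heapTy` commutes with boundaries and the types of a
restricted heap are unchanged. -/
theorem modelCtx_heapTy : ∀ {n : ℕ} (B : (freeStr X).Ty n),
    modelCtx (T := free X) (fun n B => ((heapTy B).texp n).rename Nat.pred) B =
      Ctx.rename Nat.pred (ctxOf (heapTy B).texp n)
  | 0, _ => rfl
  | n + 1, B => by
    have h1 : ∀ k < n + 1, (heapTy ((freeStr X).bd B)).texp k = (heapTy B).texp k := by
      intro k hk
      rw [heapTy_bd]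
      exact (heapTy B).bd_texp hk
    rw [modelCtx, modelCtx_heapTy ((freeStr X).bd B), h1 n n.lt_succ_self,
      ctxOf_congr.2 fun k hk => h1 k (by omega)]
    rfl

theorem nodup_map_pred_ctxOf {W : Type u} (g : ℕ → Exp W) (n : ℕ) :
    ((Ctx.vars (ctxOf g n)).map Nat.pred).Nodup := by
  rw [vars_ctxOf, List.map_reverse, List.map_map]
  exact List.nodup_reverse.2 (by simpa [Function.comp_def] using List.nodup_range)

variable (X) in
/-- The model of the type-and-term structure of a free theory in this theory, given by the
judgements of decorated heaps. -/
noncomputable def evalModel : Model (freeStr X) (free X) where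
  ty n B := ((heapTy B).texp n).rename Nat.pred
  tm n b := (heapTm b).texp.rename Nat.pred
  der_ty {n} B := by
    rw [modelCtx_heapTy]
    exact WGAT.Der.rename (T := free X) (heapTy B).der (nodup_map_pred_ctxOf _ n)
  der_tm {n} b := by
    rw [modelCtx_heapTy, heapTy_bdTm]
    exact WGAT.Der.rename (T := free X) (heapTm b).der (nodup_map_pred_ctxOf _ n)

/-- The triangle identity that characterises the counit: the judgement chosen for a class is a
renaming of the judgement of its heap, which represents that same class. -/
theorem freeUnit_evalModel : freeUnit (freeStr X) ≫ forget.map (evalModel X).hom = 𝟙 _ := by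
  refine (evalModel X).freeUnit_hom (fun n B => ?_) (fun n b => ?_)
  · refine (tyClass_heapTy B).symm.trans (WGAT.tyClass_eq_iff.2 (WGAT.AlphaEq.symm ?_))
    have h := WGAT.AlphaEq.of_rename (T := free X) (heapTy B).der (nodup_map_pred_ctxOf _ n)
    have e : ((evalModel X).repTy B).judg = (heapTy B).tyJ.judg.rename Nat.pred :=
      Judg.ty_congr (modelCtx_heapTy B) rfl
    rw [e]
    exact h
  · refine (tmClass_heapTm b).symm.trans (WGAT.tmClass_eq_iff.2 (WGAT.AlphaEq.symm ?_))
    have h := WGAT.AlphaEq.of_rename (T := free X) (heapTm b).der (nodup_map_pred_ctxOf _ n)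
    have e : ((evalModel X).repTm b).judg = (heapTm b).tmJ.judg.rename Nat.pred := by
      refine Judg.tm_congr ?_ rfl ?_
      · refine (modelCtx_heapTy _).trans ?_
        rw [heapTy_bdTm]
        rfl
      · change ((heapTy _).texp n).rename _ = _
        rw [heapTy_bdTm]
        rfl
    rw [e]
    exact h

theorem counit_app (h : FreeUniversal.{u}) :
    (FreeUniversal.adjunction h).counit.app (free X) = (evalModel X).hom := by
  have : (FreeUniversal.adjunction h).counit.app (free X) =
      (FreeUniversal.homEquiv h (freeStr X) (free X)).symm (𝟙 _) := by
    simp [FreeUniversal.adjunction]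
    rfl
  exact this.trans ((Equiv.symm_apply_eq _).2 freeUnit_evalModel.symm)

/-- After composition with `thetaHom X` the final inverse cancels. What remains is the forgetful
functor applied to the counit, preceded by the two identifications on `W²X`. -/
theorem transportedMul_comp (h : FreeUniversal.{u}) :
    transportedMul (FreeUniversal.weakeningMonad h) (theta h) X ≫ thetaHom X =
      wk.map (thetaHom X) ≫ thetaHom (freeStr X) ≫ forget.map (evalModel X).hom := by
  rw [← counit_app h]
  have key : ∀ {C : TTStr.{u}} (a : wk.obj (wk.obj X) ⟶ wk.obj (freeStr X)) (b : _ ⟶ C)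
      (c : C ⟶ freeStr X), (a ≫ b ≫ c ≫ inv (thetaHom X)) ≫ thetaHom X = a ≫ b ≫ c := by
    intro C a b c
    rw [Category.assoc, Category.assoc, Category.assoc, IsIso.inv_hom_id, Category.comp_id]
  exact key _ _ _

/-! ### Reading off the multiplication. -/

/-- The description of a decorated heap of decorated heaps as a decorated heap of type-elements of
the free theory. -/
noncomputable def innerTy {n : ℕ} (w : WkTy (wk.obj X) n) : WkTy (freeStr X) n :=
  ⟨w.1, w.2 ≫ thetaHom X⟩

/-- The `i`-th type is the class of an inner heap applied to the ancestors of `i` in the outer heap.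
Unfolding the class gives the top type of the inner heap with its variable `l` replaced by the
`l`-th ancestor, which has index `l - 1` in the list. -/
theorem exp_innerTy {n : ℕ} (w : WkTy (wk.obj X) n) (i : Fin (n + 2)) (hi : i ≠ 0) {k : ℕ}
    (hk : (i : ℕ) = k + 1) : (evalModel X).exp ((innerTy w).texp k) =
      .appVars (Sum.inl (asWkTy (w.label i hi).2).top)
        (((asWkTy (w.label i hi).2).args (Fin.last _)).map fun l => (w.args i).getD l.pred 0) := by
  have h1 : (innerTy w).label i hi =
      ⟨(w.label i hi).1, WGAT.tyClass (asWkTy (w.label i hi).2).tyJ⟩ := rfl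
  rw [(innerTy w).texp_eq i hi hk, h1, Model.exp_appVars]
  change ((((heapTy _).texp _).rename Nat.pred).rename _ : Exp (FreeAlph X)) = _
  rw [heapTy_tyClass, WkTy.texp_last, Exp.appVars_rename, Exp.appVars_rename, List.map_map]
  rfl

/-- Both sides represent the same class and have context variables `1, …, n`, so they agree as
syntax, in every declaration and in the final type. -/
theorem texp_mul (h : FreeUniversal.{u}) {n : ℕ} (w : WkTy (wk.obj X) n) (k : ℕ) (hk : k < n + 1) :
    (asWkTy (TTStr.mapTy (transportedMul (FreeUniversal.weakeningMonad h) (theta h) X)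
      (n := n) w)).texp k = (evalModel X).exp ((innerTy w).texp k) := by
  generalize hv : asWkTy (TTStr.mapTy (transportedMul (FreeUniversal.weakeningMonad h) (theta h) X)
      (n := n) w) = v
  have h1 : WGAT.tyClass v.tyJ = WGAT.tyClass ((evalModel X).tyJ (innerTy w).tyJ) := by
    rw [← hv, ← Model.mapTy_hom]
    exact congrArg (fun f => TTStr.mapTy (X := wk.obj (wk.obj X)) f (n := n) w)
      (transportedMul_comp h)
  obtain ⟨h2, h3⟩ := free_tyClass_eq h1 ((vars_ctxOf v.texp n).trans
    ((Model.vars_ctx _ _).trans (vars_ctxOf (innerTy w).texp n)).symm)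
  have h2 := h2.trans ((evalModel X).ctx_ctxOf (innerTy w).texp n)
  rcases Nat.lt_succ_iff_lt_or_eq.1 hk with hk | rfl
  · exact ctxOf_congr.1 h2 k hk
  · exact h3

theorem mul_spec (h : FreeUniversal.{u}) {n : ℕ} (w : WkTy (wk.obj X) n) (i : Fin (n + 2))
    (hi : i ≠ 0) :
    (asWkTy (TTStr.mapTy (transportedMul (FreeUniversal.weakeningMonad h) (theta h) X)
      (n := n) w)).label i hi = (asWkTy (w.label i hi).2).top ∧
    (asWkTy (TTStr.mapTy (transportedMul (FreeUniversal.weakeningMonad h) (theta h) X)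
      (n := n) w)).args i =
      ((asWkTy (w.label i hi).2).args (Fin.last _)).map fun l => (w.args i).getD l.pred 0 := by
  obtain ⟨k, hk⟩ := Nat.exists_eq_succ_of_ne_zero (Fin.val_ne_zero_iff.2 hi)
  have h1 := texp_mul h w k (by have := i.isLt; omega)
  rw [exp_innerTy w i hi hk, WkTy.texp_eq _ i hi hk] at h1
  obtain ⟨h2, h3⟩ := Exp.appVars_inj.1 h1
  exact ⟨Sum.inl.inj h2, h3⟩

theorem term_mul (h : FreeUniversal.{u}) {n : ℕ} (t : WkTm (wk.obj X) n) :
    (asWkTm (TTStr.mapTm (transportedMul (FreeUniversal.weakeningMonad h) (theta h) X)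
      (n := n) t)).term = (asWkTm t.term.2).term := by
  generalize hs : asWkTm (TTStr.mapTm (transportedMul (FreeUniversal.weakeningMonad h) (theta h) X)
      (n := n) t) = s
  let t' : WkTm (freeStr X) n := asWkTm (TTStr.mapTm (wk.map (thetaHom X)) (n := n) t)
  have h1 : WGAT.tmClass s.tmJ = WGAT.tmClass ((evalModel X).tmJ t'.tmJ) := by
    rw [← hs, ← Model.mapTm_hom]
    exact congrArg (fun f => TTStr.mapTm (X := wk.obj (wk.obj X)) f (n := n) t)
      (transportedMul_comp h)
  obtain ⟨-, h2, -⟩ := free_tmClass_eq h1 ((vars_ctxOf s.1.texp n).trans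
    ((Model.vars_ctx _ _).trans (vars_ctxOf t'.1.texp n)).symm)
  -- The constant to be unfolded is the class of the inner term judgement, so the head constant of
  -- the unfolded term is the underlying term-element of `X`.
  have h3 : t'.term = ⟨t.term.1, WGAT.tmClass (asWkTm t.term.2).tmJ⟩ := rfl
  have h4 : s.texp = (evalModel X).exp t'.texp := h2
  rw [WkTm.texp, WkTm.texp, h3, Model.exp_appVars] at h4
  change _ = (((heapTm _).texp.rename Nat.pred).rename _ : Exp (FreeAlph X)) at h4
  rw [heapTm_tmClass, WkTm.texp, Exp.appVars_rename, Exp.appVars_rename, Exp.appVars_inj,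
    Sum.inr.injEq] at h4
  exact h4.1

/-- A proper ancestor of `j` in the product is an outer ancestor selected by some `l` among the
arguments of the top vertex of the inner heap. The outer ancestor so selected has depth `l`, so `i`
is selected exactly when its depth is an inner ancestor of `#j`. -/
theorem le_mul_iff {n : ℕ} {v : WkTy X n} {w : WkTy (wk.obj X) n} {j : Fin (n + 2)} (hj : j ≠ 0)
    (hv : v.args j =
      ((asWkTy (w.label j hj).2).args (Fin.last _)).map fun l => (w.args j).getD l.pred 0)
    (i : Fin (n + 2)) :
    v.1.Le i j ↔ w.1.Le i j ∧ (asWkTy (w.label j hj).2).1.Le (w.1.depth i) (w.1.depth j) := by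
  generalize hB : asWkTy (w.label j hj).2 = B at hv
  -- The inner heap attached to `j` has size `#j`, so its greatest vertex is `#j` itself.
  have hd : ((Fin.last ((w.label j hj).1 + 1) : Fin ((w.label j hj).1 + 2)) : ℕ) = w.1.depth j := by
    have := w.1.depth_pos j
    rw [Fin.val_last, w.label_fst]
    omega
  have hlen := w.length_args j
  rw [v.le_iff j hj, w.le_iff j hj, ← hd, B.le_iff _ Fin.last_pos.ne', hd, hv, List.mem_map]
  constructor
  · rintro (h | ⟨l, hl, h⟩)
    · obtain rfl := Fin.ext h
      exact ⟨Or.inl rfl, Or.inl rfl⟩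
    · obtain ⟨h1, h2⟩ := B.bounds_of_mem_args hl
      rw [hd] at h2
      obtain ⟨l, rfl⟩ := Nat.exists_eq_succ_of_ne_zero h1.ne'
      -- Inner ancestors of `#j` are smaller than `#j`, so the lookup never reaches the default
      -- value.
      have h3 : l < (w.args j).length := by omega
      rw [Nat.pred_succ, List.getD_eq_getElem _ _ h3] at h
      refine ⟨Or.inr (h ▸ List.getElem_mem h3), Or.inr ?_⟩
      rwa [w.depth_of_getElem i j l (by rw [List.getElem?_eq_getElem h3, h])]
  · rintro ⟨h | h, h'⟩
    · exact Or.inl h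
    · obtain ⟨l, hl, hi⟩ := List.getElem_of_mem h
      have h1 := w.depth_of_getElem i j l (by rw [List.getElem?_eq_getElem hl, hi])
      rcases h' with h' | h'
      -- A proper ancestor of `j` has smaller depth, so the depths of `i` and `j` cannot coincide.
      · omega
      · exact Or.inr ⟨_, h', by rw [h1, Nat.pred_succ, List.getD_eq_getElem _ _ hl, hi]⟩

end Mul

end TypeDep

theorem mainTheorem8 :
    ∃ (h : FreeUniversal.{u}) (θ : wk.{u} ≅ (FreeUniversal.weakeningMonad h).toFunctor),
      SendsToJudgements h θ ∧
      ∀ (X : TTStr.{u}) (n : ℕ),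
        (∀ w : WkTy (wk.obj X) n,
          let v := asWkTy (TTStr.mapTy (transportedMul (FreeUniversal.weakeningMonad h) θ X)
            (n := n) w)
          (∀ (i j : Fin (n + 2)) (_ : i ≠ 0) (hj : j ≠ 0),
            v.1.Le i j ↔ w.1.Le i j ∧
              (asWkTy (w.label j hj).2).1.Le (w.1.depth i) (w.1.depth j)) ∧
          ∀ (i : Fin (n + 2)) (hi : i ≠ 0), v.label i hi = (asWkTy (w.label i hi).2).top) ∧
        ∀ t : WkTm (wk.obj X) n,
          let s := asWkTm (TTStr.mapTm (transportedMul (FreeUniversal.weakeningMonad h) θ X)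
            (n := n) t)
          s.1 = asWkTy (TTStr.mapTy (transportedMul (FreeUniversal.weakeningMonad h) θ X)
            (n := n) t.1) ∧
          s.term = (asWkTm t.term.2).term :=
  ⟨freeUniversal, theta freeUniversal, sendsToJudgements_theta freeUniversal, fun X _ =>
    ⟨fun w => ⟨fun i _ _ hj => le_mul_iff hj (mul_spec freeUniversal w _ hj).2 i,
      fun i hi => (mul_spec freeUniversal w i hi).1⟩,
    -- The heap underlying the image of a term-element is its boundary, and the multiplication
    -- preserves boundaries.
    fun t => ⟨(TTStr.mapTy_bdTm (transportedMul _ (theta freeUniversal) X) t).symm,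
      term_mul freeUniversal t⟩⟩⟩
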